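/- Notation. $\mathcal S(t)=t^{-1}(e^{t/2}-e^{-t/2})$; $[t^d]$ extracts the coefficient of $t^d$; an $\hbar^2$-series of functions is a formal series $\hat f(z,\hbar)=\sum_{k\ge 0}\hbar^{2k}\hat f_k(z)$, and we write $f=\hat f_0$ for its leading term. For a function $f$ of one variable put $f_i=f(z_i)$, and let $d_i\frac1{dx_i}$ be the operator $\phi\,dz_i\mapsto \partial_{z_i}\bigl(\phi/x'(z_i)\bigr)dz_i$. All sums over $r$ and $j$ below have only finitely many nonzero terms. Let $U\subset\mathbb C$ be an open set on which a holomorphic branch of $\log z$ is chosen (so $0\notin U$), and let $\hat x=\sum_k\hbar^{2k}\hat x_k$ be any $\hbar^2$-series of holomorphic functions on $U$ whose leading term $x=\hat x_0$ satisfies $dx\ne 0$ on $U$. (For example $\hat x=\sum_{i=1}^M\frac{1}{\mathcal S(\alpha_i\hbar\partial_y)}\frac{\log(z-a_i)}{\alpha_i}+R(z)$, where $dx$ is rational, $a_1,\dots,a_M$ are its simple poles at which $dy$ has no pole, $1/\alpha_i$ are the residues of $dx$ there, and $R$ is the rest of $x$, on any $U$ that avoids the poles of $dx$ and carries branches of the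 logarithms and of $R$.) For $g\ge 0$, $n\ge 1$, $(g,n)\neq(0,1)$, consider the $n$-differentials $$\omega^{(g)}_n=[\hbar^{2g-2+n}](-1)^n\prod_{i=1}^n\Bigl(\sum_{r\ge0}\bigl(-d_i\tfrac1{dx_i}\bigr)^r[u_i^r]\,e^{u_i(\mathcal S(u_i\hbar D_i)\hat x_i-x_i)}dz_i\Bigr)(-1)^{n-1}\sum_{\sigma\in\{n\text{-cycles}\}}\prod_{i=1}^n\frac1{A_i-B_{\sigma(i)}},\qquad(\ast)$$ where - if $y=z$: $D_i=\partial_{z_i}$, $A_i=z_i+\frac{u_i\hbar}2$, $B_i=z_i-\frac{u_i\hbar}2$; - if $y=\log z$: $D_i=z_i\partial_{z_i}$, $A_i=e^{u_i\hbar/2}z_i$, $B_i=e^{-u_i\hbar/2}z_i$. Given two $\hbar^2$-series $\tilde\psi(\theta,\hbar)$ and $\hat y(z,\hbar)$ with leading terms $\psi$ and $y$, put $x=\log z-\psi(y(z))$. The (formal) Orlov–Scherbin formula is $$\omega^{(g)}_n=[\hbar^{2g-2+n}]\prod_{i=1}^n\Bigl(\sum_{j,r\ge0}\bigl(d_i\tfrac1{dx_i}\bigr)^j\Bigl([v^j]\,e^{-v\psi(\theta)}\partial_\theta^r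 e^{v\mathcal S(v\hbar\partial_\theta)\tilde\psi(\theta)}\Bigr)\Big|_{\theta=y_i}[u_i^r]\Bigr)\prod_{i=1}^n\Bigl(e^{u_i(\mathcal S(u_i\hbar z_i\partial_{z_i})\hat y_i-y_i)}dz_i\Bigr)(-1)^{n-1}\sum_{\sigma\in\{n\text{-cycles}\}}\prod_{i=1}^n\frac1{e^{u_i\hbar/2}z_i-e^{-u_{\sigma(i)}\hbar/2}z_{\sigma(i)}}$$ $$\qquad+\delta_{n,1}[\hbar^{2g}]\sum_{j\ge0}\bigl(d_1\tfrac1{dx_1}\bigr)^{j-1}[v^j]\Bigl(e^{v(\mathcal S(v\hbar\partial_{y_1})\tilde\psi(y_1)-\psi(y_1))}dy_1\Bigr),\qquad(\ast\ast)$$ where $\bigl(d\frac1{dx}\bigr)^{-1}dy=y\,dx$ (this term occurs only for $g=0$). **Proposition 7.1.** For all $g\ge0$, $n\ge1$ with $(g,n)\ne(0,1)$ and all pairwise distinct points $z_1,\dots,z_n\in U$: 1. the differential $(\ast)$ for $y=z$ is equal to $(\ast\ast)$ with $$\hat y(z)=z,\qquad\tilde\psi(\theta)=\frac1{\mathcal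 S(\hbar\partial_\theta)}\log\theta-\hat x(\theta);$$ 2. the differential $(\ast)$ for $y=\log z$ is equal to $(\ast\ast)$ with $$\hat y(z)=\log z-\hat x(z),\qquad\tilde\psi(\theta)=\theta.$$ In both cases the function $x=\log z-\psi(y(z))$ of the Orlov–Scherbin formula is the leading term $x$ of $\hat x$. The formula $(\ast\ast)$ is used formally, without the normalization $y(0)=\psi(0)=0$. -/

import Mathlib

open scoped Nat

noncomputable section

namespace OSFormula

/-- The formal variables: `h` is `ħ`, and `u i`, `v i` are the auxiliary variables attached to the
`i`-th point. -/
inductive Var (n : ℕ) : Type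
  | h : Var n
  | u : Fin n → Var n
  | v : Fin n → Var n

/-- Formal power series in `ħ, u₁, …, uₙ, v₁, …, vₙ` with complex coefficients. -/
abbrev Ser (n : ℕ) : Type := MvPowerSeries (Var n) ℂ

variable {n : ℕ}

/-- The formal variable `w` as a series. -/
abbrev var (w : Var n) : Ser n := MvPowerSeries.X w

/-- A complex number as a constant series. -/
abbrev const (c : ℂ) : Ser n := MvPowerSeries.C c

/-- The formal exponential `e^F` of a series `F` without constant term. -/
def fexp (F : Ser n) : Ser n := (PowerSeries.exp ℂ).subst F

/-- The power series `S(t) = t⁻¹ (e^{t/2} - e^{-t/2}) = ∑_{m even} t^m / (2^m (m+1)!)`. -/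
def S : PowerSeries ℂ :=
  PowerSeries.mk fun m => if Even m then ((2 : ℂ) ^ m * ((m + 1)! : ℂ))⁻¹ else 0

/-- `t S(t) = e^{t/2} - e^{-t/2}`. -/
theorem X_mul_S : PowerSeries.X * S =
    PowerSeries.rescale (1 / 2 : ℂ) (PowerSeries.exp ℂ) -
      PowerSeries.rescale (-(1 / 2) : ℂ) (PowerSeries.exp ℂ) := by
  ext m
  rcases m with _ | m
  · simp [PowerSeries.coeff_rescale, PowerSeries.coeff_zero_X_mul,
      -PowerSeries.coeff_zero_eq_constantCoeff]
  · rw [mul_comm, PowerSeries.coeff_succ_mul_X]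
    simp only [S, PowerSeries.coeff_mk, map_sub, PowerSeries.coeff_rescale,
      PowerSeries.coeff_exp]
    have h2 : ((2 : ℂ) ^ m) ≠ 0 := pow_ne_zero _ two_ne_zero
    have hf : (((m + 1)! : ℕ) : ℂ) ≠ 0 := by exact_mod_cast (m + 1).factorial_ne_zero
    rcases Nat.even_or_odd m with he | ho
    · have e1 : (-(1 / 2) : ℂ) ^ (m + 1) = -(1 / 2) ^ (m + 1) := (he.add_one).neg_pow _
      rw [e1, if_pos he]
      simp only [one_div, inv_pow, pow_succ, map_inv₀, map_natCast]
      field_simp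
      norm_num
    · have e1 : (-(1 / 2) : ℂ) ^ (m + 1) = (1 / 2) ^ (m + 1) := (ho.add_one).neg_pow _
      rw [e1, if_neg (Nat.not_even_iff_odd.mpr ho), sub_self]

/-! ### Series in `ħ²` with function coefficients

A function `f : ℕ → ℂ → ℂ` stands for the formal series `f(z, ħ) = ∑ₖ ħ^{2k} fₖ(z)`. -/

/-- `S(w ħ D) f` at the point `z`, where `w` is one of the variables `u i`, `v i`, `D` is a
derivation acting on functions, and `f = ∑ₖ ħ^{2k} fₖ`. The coefficient of `w^a ħ^b` is
`[t^a] S(t) · (D^a fₖ)(z)` if `b = a + 2k`, and all other coefficients vanish. -/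
def applyS (D : (ℂ → ℂ) → ℂ → ℂ) (f : ℕ → ℂ → ℂ) (w : Var n) (z : ℂ) : Ser n :=
  open Classical in fun e =>
    if e = Finsupp.single w (e w) + Finsupp.single Var.h (e Var.h) ∧
        e w ≤ e Var.h ∧ Even (e Var.h - e w) then
      PowerSeries.coeff (e w) S * (D^[e w] (f ((e Var.h - e w) / 2))) z
    else 0

/-- `e^{w (S(w ħ D) f - f₀)}` at the point `z`, for `f = ∑ₖ ħ^{2k} fₖ`. -/
def expS (D : (ℂ → ℂ) → ℂ → ℂ) (f : ℕ → ℂ → ℂ) (w : Var n) (z : ℂ) : Ser n :=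
  fexp (var w * (applyS D f w z - const (f 0 z)))

/-- `S(ħ ∂)⁻¹ ℓ`, as a series in `ħ²` (the power series `S⁻¹` is even). -/
def invS (l : ℂ → ℂ) : ℕ → ℂ → ℂ :=
  fun k z => PowerSeries.coeff (2 * k) S⁻¹ * iteratedDeriv (2 * k) l z

/-- The derivation `z ∂_z`. -/
def eulerD (f : ℂ → ℂ) : ℂ → ℂ := fun z => z * deriv f z

/-- `∂_θ^r F(θ)`, acting on each coefficient of the formal series `F(θ)`. -/
def thetaDeriv (r : ℕ) (F : ℂ → Ser n) (θ : ℂ) : Ser n :=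
  fun e => iteratedDeriv r (fun t => MvPowerSeries.coeff e (F t)) θ

/-- `e^{-vᵢ ψ(θ)} ∂_θ^r e^{vᵢ S(vᵢ ħ ∂_θ) ψ̃(θ)}`, where `ψ̃ = ∑ₖ ħ^{2k} ψ̃ₖ` and `ψ = ψ̃₀`. -/
def psiFactor (psi : ℕ → ℂ → ℂ) (i : Fin n) (r : ℕ) (θ : ℂ) : Ser n :=
  fexp (-(var (Var.v i) * const (psi 0 θ))) *
    thetaDeriv r (fun t => fexp (var (Var.v i) * applyS deriv psi (Var.v i) t)) θ

/-! ### The sum over `n`-cycles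

The sum `(-1)^{n-1} ∑_σ ∏ᵢ 1 / (aᵢ - b_{σ(i)})` over `n`-cycles is a formal power series in
`ħ, u₁, …, uₙ`, except that for `n = 1` it has a simple pole in `u₁ ħ`. To stay inside power series
the sum multiplied by `∏ᵢ uᵢ ħ` is used, and coefficients are extracted with the exponents
shifted accordingly. -/

/-- `(∏ᵢ uᵢ ħ) · (-1)^{n-1} ∑_{σ ∈ n-cycles} ∏ᵢ 1 / (aᵢ - b_{σ(i)})`. The `n`-cycles are the
permutations with a single orbit; one of them has a fixed point only if `n = 1`, and then
`uᵢ ħ / (aᵢ - bᵢ)` is the inverse of the series `qᵢ` with `aᵢ - bᵢ = uᵢ ħ qᵢ`. -/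
def cycleSum (a b q : Fin n → Ser n) : Ser n :=
  open Classical in
  (-1) ^ (n - 1) * ∑ σ : Equiv.Perm (Fin n) with ∀ i j, σ.SameCycle i j,
    ∏ i, if σ i = i then (q i)⁻¹ else var (Var.u i) * var Var.h * (a i - b (σ i))⁻¹

/-- `z + c u_i ħ`. -/
def addShift (c : ℂ) (i : Fin n) (z : ℂ) : Ser n :=
  const z + const c * (var (Var.u i) * var Var.h)

/-- `e^{c u_i ħ} z`. -/
def mulShift (c : ℂ) (i : Fin n) (z : ℂ) : Ser n :=
  fexp (const c * (var (Var.u i) * var Var.h)) * const z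

/-- `S(u_i ħ) z`. -/
def mulQuot (i : Fin n) (z : ℂ) : Ser n :=
  S.subst (var (Var.u i) * var Var.h) * const z

theorem addShift_sub (i : Fin n) (z : ℂ) :
    addShift (1 / 2) i z - addShift (-(1 / 2)) i z = var (Var.u i) * var Var.h * 1 := by
  have h : (const (1 / 2) : Ser n) + const (1 / 2) = 1 := by
    rw [← map_add]; norm_num
  simp only [addShift, map_neg]
  linear_combination (var (Var.u i) * var Var.h) * h

theorem mulShift_sub (i : Fin n) (z : ℂ) :
    mulShift (1 / 2) i z - mulShift (-(1 / 2)) i z =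
      var (Var.u i) * var Var.h * mulQuot i z := by
  have hs : PowerSeries.HasSubst (var (Var.u i) * var Var.h : Ser n) :=
    PowerSeries.HasSubst.of_constantCoeff_zero (by simp)
  have key := congrArg (PowerSeries.subst (var (Var.u i) * var Var.h : Ser n)) X_mul_S
  have hr : ∀ c : ℂ, (PowerSeries.rescale c (PowerSeries.exp ℂ)).subst
      (var (Var.u i) * var Var.h : Ser n) = fexp (const c * (var (Var.u i) * var Var.h)) := by
    intro c
    rw [PowerSeries.rescale_eq_subst,
      PowerSeries.subst_comp_subst_apply (PowerSeries.HasSubst.smul_X' c) hs, fexp,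
      PowerSeries.subst_smul hs, PowerSeries.subst_X hs, MvPowerSeries.smul_eq_C_mul]
  rw [PowerSeries.subst_mul hs, PowerSeries.subst_X hs, PowerSeries.subst_sub hs, hr, hr] at key
  simp only [mulShift, mulQuot]
  linear_combination -(const z) * key

/-- The cyclic sum with `aᵢ - bⱼ = zᵢ + uᵢħ/2 - zⱼ + uⱼħ/2`, multiplied by `∏ᵢ uᵢ ħ`. -/
def addCycleSum (z : Fin n → ℂ) : Ser n :=
  cycleSum (fun i => addShift (1 / 2) i (z i)) (fun i => addShift (-(1 / 2)) i (z i)) (fun _ => 1)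

/-- The cyclic sum with `aᵢ - bⱼ = e^{uᵢħ/2} zᵢ - e^{-uⱼħ/2} zⱼ`, multiplied by `∏ᵢ uᵢ ħ`. -/
def mulCycleSum (z : Fin n → ℂ) : Ser n :=
  cycleSum (fun i => mulShift (1 / 2) i (z i)) (fun i => mulShift (-(1 / 2)) i (z i))
    (fun i => mulQuot i (z i))

/-! ### Differentials

An `n`-differential is represented by its coefficient `f(z₁, …, zₙ)` with respect to
`dz₁ ⋯ dzₙ`. -/

/-- The operator `dᵢ (1 / dxᵢ)`: it sends `f dzᵢ` to `∂_{zᵢ} (f / x'(zᵢ)) dzᵢ`. -/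
def dInvDx (x : ℂ → ℂ) (i : Fin n) (f : (Fin n → ℂ) → ℂ) : (Fin n → ℂ) → ℂ :=
  fun z => deriv (fun t => f (Function.update z i t) / deriv x t) (z i)

/-- The product of operators `∏ᵢ Tᵢ^{kᵢ}`, applied to `f`. -/
def opProd (T : Fin n → ((Fin n → ℂ) → ℂ) → (Fin n → ℂ) → ℂ) (k : Fin n → ℕ)
    (f : (Fin n → ℂ) → ℂ) : (Fin n → ℂ) → ℂ :=
  (List.finRange n).foldr (fun i F => (T i)^[k i] F) f

/-- `[ħ^{N}] ∏ᵢ [vᵢ^{jᵢ}] [uᵢ^{rᵢ}] F`. -/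
def extract (N : ℕ) (j r : Fin n → ℕ) (F : Ser n) : ℂ :=
  MvPowerSeries.coeff (Finsupp.single Var.h N + ∑ i, Finsupp.single (Var.v i) (j i) +
    ∑ i, Finsupp.single (Var.u i) (r i)) F

/-- The common form of the two explicit formulas for unramified `y`,
`[ħ^{2g-2+n}] (-1)^n ∏ᵢ (∑_r (-dᵢ 1/dxᵢ)^r [uᵢ^r] e^{uᵢ(S(uᵢ ħ D) x̂ᵢ - xᵢ)} dzᵢ) K`,
where `x = x̂₀` and `K` is a cyclic sum; `W` is `K` multiplied by `∏ᵢ uᵢ ħ`, so the exponents of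
`ħ` and of the `uᵢ` are raised by `n` and by `1`. Only finitely many terms of the sum are nonzero. -/
def xyFormula (D : (ℂ → ℂ) → ℂ → ℂ) (W : (Fin n → ℂ) → Ser n) (xh : ℕ → ℂ → ℂ) (g : ℕ) :
    (Fin n → ℂ) → ℂ :=
  fun z => (-1) ^ n * ∑ᶠ r : Fin n → ℕ,
    opProd (fun i f => -dInvDx (xh 0) i f) r
      (fun z' => extract (2 * g + 2 * n - 2) 0 (fun i => r i + 1)
        ((∏ i, expS D xh (Var.u i) (z' i)) * W z')) z

/-- The explicit formula for `ω^{(g)}_n`, `(g, n) ≠ (0, 1)`, in the case `y = z`. -/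
def omegaYz (xh : ℕ → ℂ → ℂ) (g n : ℕ) : (Fin n → ℂ) → ℂ :=
  xyFormula deriv addCycleSum xh g

/-- The explicit formula for `ω^{(g)}_n`, `(g, n) ≠ (0, 1)`, in the case `y = log z`. -/
def omegaYlog (xh : ℕ → ℂ → ℂ) (g n : ℕ) : (Fin n → ℂ) → ℂ :=
  xyFormula eulerD mulCycleSum xh g

/-- `x = log z - ψ(y(z))`, where `l` is a branch of the logarithm, `ψ = ψ̃₀` and `y = ŷ₀`. -/
def osX (l : ℂ → ℂ) (psi yh : ℕ → ℂ → ℂ) : ℂ → ℂ := fun z => l z - psi 0 (yh 0 z)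

/-- The first summand of the Orlov--Scherbin formula,
`[ħ^{2g-2+n}] ∏ᵢ (∑_{j,r} (dᵢ 1/dxᵢ)^j ([vᵢ^j] e^{-vᵢψ(θ)} ∂_θ^r e^{vᵢ S(vᵢħ∂_θ) ψ̃(θ)})|_{θ=yᵢ} [uᵢ^r])`
applied to `∏ᵢ (e^{uᵢ(S(uᵢ ħ zᵢ∂_{zᵢ}) ŷᵢ - yᵢ)} dzᵢ)` times the cyclic sum. -/
def osMain (l : ℂ → ℂ) (psi yh : ℕ → ℂ → ℂ) (g n : ℕ) : (Fin n → ℂ) → ℂ :=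
  fun z => ∑ᶠ jr : (Fin n → ℕ) × (Fin n → ℕ),
    opProd (fun i f => dInvDx (osX l psi yh) i f) jr.1
      (fun z' => extract (2 * g + 2 * n - 2) jr.1 (fun i => jr.2 i + 1)
        ((∏ i, psiFactor psi i (jr.2 i) (yh 0 (z' i))) *
          (∏ i, expS eulerD yh (Var.u i) (z' i)) * mulCycleSum z')) z

/-- The second summand of the Orlov--Scherbin formula for `n = 1` (here `i` is the only index),
`[ħ^{2g}] ∑_{j ≥ 0} (d 1/dx)^{j-1} [v^j] (e^{v (S(vħ∂_y) ψ̃(y) - ψ(y))} dy)`. The term `j = 0` is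
`δ_{g,0} (d 1/dx)⁻¹ dy = δ_{g,0} y dx`; the other terms are written with `j + 1` for `j`. -/
def osExtra (l : ℂ → ℂ) (psi yh : ℕ → ℂ → ℂ) (g : ℕ) (i : Fin n) : (Fin n → ℂ) → ℂ :=
  fun z => (if g = 0 then yh 0 (z i) * deriv (osX l psi yh) (z i) else 0) +
    ∑ᶠ j : ℕ, (dInvDx (osX l psi yh) i)^[j]
      (fun z' => extract (2 * g) (Pi.single i (j + 1)) 0
        (expS deriv psi (Var.v i) (yh 0 (z' i))) * deriv (yh 0) (z' i)) z

/-- The Orlov--Scherbin formula for `ω^{(g)}_n` with data `ψ̃`, `ŷ`. -/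
def omegaOS (l : ℂ → ℂ) (psi yh : ℕ → ℂ → ℂ) (g n : ℕ) : (Fin n → ℂ) → ℂ :=
  fun z => osMain l psi yh g n z +
    if n = 1 then ∑ i : Fin n, osExtra l psi yh g i z else 0

end OSFormula

end

/-! Signs first. The cyclic sum times `∏ uᵢħ` is invariant under `u ↦ -u`: the substitution
exchanges `Aᵢ` and `Bᵢ`, and `σ ↦ σ⁻¹` exchanges them back. So (∗) equals the sum over `r` of `∏ (dᵢ
1/dxᵢ)^{rᵢ} [uᵢ^{rᵢ}]` of `∏ e^{-uᵢ(S(uᵢħD)x̂ᵢ - xᵢ)}` times the cyclic sum (`xyFormula_eq`).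

For `y = log z` this is already (∗∗). Since `S` is even and `(z∂)² log z = 0`, the exponent of `ŷ =
log z - x̂` is the one above (`expS_log_sub`). For `ψ̃ = θ` the factor in `ψ̃` is `v^r`
(`psiFactor_id`), so only `j = r` survives.

For `y = z` the argument is algebraic. Let `A` be the algebra of analytic functions of `n` distinct
points of `U`; the objects are power series in `ħ` over `A[v][u]`. Each order in `ħ` is a polynomial
in `u` and `v`, so all sums are finite. Conjugation by `e^{vψ}` turns `∂_θ` into `∂ᵢ + vᵢψ'(zᵢ)`,
where `ψ' = 1/z - x'`. Under `∑ (d 1/dx)^j [v^j]` a derivative `∂ᵢ` amounts to multiplication by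
`vᵢx'ᵢ` (`XCoords.total_integration`), so `∂ᵢ + vᵢψ'` has the adjoint `∇ᵢ = vᵢ/zᵢ - ∂ᵢ`
(`XCoords.stotal_psiOp_mul`), from which `x'` has disappeared. The sum over `r` becomes the map `T :
u^r c ↦ ∇^r c` (`Coords.trans`). Put `Φ = ∑ uᵢ(S(uᵢħ) - 1)zᵢ`, and `R = ∏ e^{vᵢ(S(vᵢħ∂)/S(ħ∂) - 1)
log zᵢ}`. For `n ≥ 2` it remains to prove an identity that no longer involves `x̂`: `R · T(e^Φ ∏
1/(e^{uᵢħ/2}zᵢ - e^{-u_{σ(i)}ħ/2}z_{σ(i)})) = ∏ 1/(zᵢ + vᵢħ/2 - z_{σ(i)} + v_{σ(i)}ħ/2)`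
(`Coords.expRatio_mul_strans_prod`). It follows from two facts.

`Coords.prod_mul_strans`: multiplying `T(e^Φ G)` by an additive difference multiplies `G` by the
corresponding multiplicative difference, provided that `G` is an eigenvector of a suitable
first-order operator. Products of inverse differences are such eigenvectors, so the factors can be
removed one by one.

`Coords.strans_expPhase_mul_expRatio`: `T(e^Φ) R = 1`. The shifts of the left side by `±ħ/2` in each
`zᵢ` agree, which forces all `∂ᵢ` to vanish. The left side is homogeneous of degree zero when `ħ`
has the degree of `z`, so it does not depend on `ħ` either, and its leading coefficient is `1`.

For `n = 1` the cyclic sum has a pole in `uħ`. Dividing by `u` loses a constant term, and `T` yields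
`(T(e^Φ) - 1)/v` (`Coords.v_mul_strans_lower`). The resulting surplus is cancelled by the second
summand of (∗∗) (`lower_coeff_mul_strans`). -/

open Finset.HasAntidiagonal (antidiagonal mem_antidiagonal)

noncomputable section

namespace OSFormula

/-! ### Exponentials and coefficientwise derivations of multivariate power series. -/

section Series

variable {τ τ' S S' : Type*} [CommRing S] [Algebra ℂ S] [CommRing S'] [Algebra ℂ S']

/-- A power series in a series without constant term, coefficient by coefficient. -/
theorem coeff_subst_eq_sum (f : PowerSeries ℂ) {F : MvPowerSeries τ S}
    (hF : MvPowerSeries.constantCoeff F = 0) (e : τ →₀ ℕ) {N : ℕ} (hN : e.degree < N) :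
    MvPowerSeries.coeff e (f.subst F) =
      ∑ k ∈ Finset.range N, PowerSeries.coeff k f • MvPowerSeries.coeff e (F ^ k) := by
  rw [PowerSeries.coeff_subst (PowerSeries.HasSubst.of_constantCoeff_zero hF)]
  apply finsum_eq_finsetSum_of_support_subset
  intro k hk
  by_contra hkN
  refine hk ?_
  have : N ≤ k := by simpa using hkN
  change _ • _ = _
  rw [MvPowerSeries.coeff_of_lt_order, smul_zero]
  refine lt_of_lt_of_le ?_ (MvPowerSeries.le_order_pow_of_constantCoeff_eq_zero k hF)
  exact_mod_cast lt_of_lt_of_le hN this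

/-- The exponential of a series without constant term. -/
def sexp (F : MvPowerSeries τ S) : MvPowerSeries τ S := (PowerSeries.exp ℂ).subst F

theorem coeff_exp_complex (k : ℕ) : PowerSeries.coeff k (PowerSeries.exp ℂ) = ((k ! : ℂ))⁻¹ := by
  rw [PowerSeries.coeff_exp]; simp

theorem coeff_sexp {F : MvPowerSeries τ S} (hF : MvPowerSeries.constantCoeff F = 0)
    (e : τ →₀ ℕ) {N : ℕ} (hN : e.degree < N) :
    MvPowerSeries.coeff e (sexp F) =
      ∑ k ∈ Finset.range N, ((k ! : ℂ))⁻¹ • MvPowerSeries.coeff e (F ^ k) := by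
  simp only [sexp, coeff_subst_eq_sum _ hF e hN, coeff_exp_complex]

theorem coeff_pow_mul_pow_eq_zero {τ S : Type*} [CommRing S] {F G : MvPowerSeries τ S}
    (hF : MvPowerSeries.constantCoeff F = 0) (hG : MvPowerSeries.constantCoeff G = 0)
    {e : τ →₀ ℕ} {i j : ℕ} (h : e.degree < i + j) :
    MvPowerSeries.coeff e (F ^ i * G ^ j) = 0 := by
  apply MvPowerSeries.coeff_of_lt_order
  calc (e.degree : ℕ∞) < ((i + j : ℕ) : ℕ∞) := by exact_mod_cast h
    _ = (i : ℕ∞) + j := by push_cast; rfl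
    _ ≤ _ := add_le_add (MvPowerSeries.le_order_pow_of_constantCoeff_eq_zero i hF)
        (MvPowerSeries.le_order_pow_of_constantCoeff_eq_zero j hG)
    _ ≤ _ := MvPowerSeries.le_order_mul

/-- The binomial theorem, one coefficient at a time. Below degree `N` only finitely many powers
contribute: the left side is a sum over the triangle `i + j < N`, the right side one over the
square, and the rest of the square vanishes because `F^i G^j` has order at least `i + j`. -/
theorem sexp_add {F G : MvPowerSeries τ S} (hF : MvPowerSeries.constantCoeff F = 0)
    (hG : MvPowerSeries.constantCoeff G = 0) : sexp (F + G) = sexp F * sexp G := by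
  classical
  ext e
  have hFG : MvPowerSeries.constantCoeff (F + G) = 0 := by rw [map_add, hF, hG, add_zero]
  set N := e.degree + 1 with hN
  have lhs : MvPowerSeries.coeff e (sexp (F + G)) = ∑ k ∈ Finset.range N,
      ∑ p ∈ antidiagonal k, (((p.1 ! : ℂ))⁻¹ * ((p.2 ! : ℂ))⁻¹) •
        MvPowerSeries.coeff e (F ^ p.1 * G ^ p.2) := by
    rw [coeff_sexp hFG e (Nat.lt_succ_self _)]
    refine Finset.sum_congr rfl fun k _ => ?_
    rw [(Commute.all F G).add_pow', map_sum, Finset.smul_sum]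
    refine Finset.sum_congr rfl fun p hp => ?_
    rw [map_nsmul, ← Nat.cast_smul_eq_nsmul ℂ, smul_smul]
    congr 1
    have hk : p.1 + p.2 = k := mem_antidiagonal.mp hp
    subst hk
    have h := Nat.add_choose_mul_factorial_mul_factorial p.1 p.2
    rw [← Nat.choose_symm_add] at h
    have h' : (((p.1 + p.2).choose p.1 : ℕ) : ℂ) * (p.1 ! : ℂ) * (p.2 ! : ℂ) =
      ((p.1 + p.2)! : ℂ) := by exact_mod_cast h
    have h1 : ((p.1 ! : ℕ) : ℂ) ≠ 0 := by exact_mod_cast p.1.factorial_ne_zero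
    have h2 : ((p.2 ! : ℕ) : ℂ) ≠ 0 := by exact_mod_cast p.2.factorial_ne_zero
    have h3 : (((p.1 + p.2)! : ℕ) : ℂ) ≠ 0 := by exact_mod_cast (p.1 + p.2).factorial_ne_zero
    field_simp
    linear_combination h'
  have rhs : MvPowerSeries.coeff e (sexp F * sexp G) = ∑ i ∈ Finset.range N,
      ∑ j ∈ Finset.range N, (((i ! : ℂ))⁻¹ * ((j ! : ℂ))⁻¹) •
        MvPowerSeries.coeff e (F ^ i * G ^ j) := by
    rw [MvPowerSeries.coeff_mul]
    have : ∀ p ∈ antidiagonal e,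
        MvPowerSeries.coeff p.1 (sexp F) * MvPowerSeries.coeff p.2 (sexp G) =
        ∑ i ∈ Finset.range N, ∑ j ∈ Finset.range N, (((i ! : ℂ))⁻¹ * ((j ! : ℂ))⁻¹) •
          (MvPowerSeries.coeff p.1 (F ^ i) * MvPowerSeries.coeff p.2 (G ^ j)) := by
      intro p hp
      have hp' : p.1 + p.2 = e := mem_antidiagonal.mp hp
      have hd : p.1.degree + p.2.degree = e.degree := by rw [← hp', map_add]
      rw [coeff_sexp hF p.1 (N := N) (by omega), coeff_sexp hG p.2 (N := N) (by omega),
        Finset.sum_mul_sum]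
      refine Finset.sum_congr rfl fun i _ => Finset.sum_congr rfl fun j _ => ?_
      rw [smul_mul_smul_comm]
    rw [Finset.sum_congr rfl this, Finset.sum_comm]
    refine Finset.sum_congr rfl fun i _ => ?_
    rw [Finset.sum_comm]
    refine Finset.sum_congr rfl fun j _ => ?_
    rw [← Finset.smul_sum, MvPowerSeries.coeff_mul]
  rw [lhs, rhs, Finset.sum_sigma', ← Finset.sum_product']
  rw [← Finset.sum_filter_of_ne (s := Finset.range N ×ˢ Finset.range N)
    (p := fun q => q.1 + q.2 < N)]
  · refine Finset.sum_nbij' (fun x => x.2) (fun q => ⟨q.1 + q.2, q⟩) ?_ ?_ ?_ ?_ ?_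
    · rintro ⟨k, a, b⟩ h
      simp only [Finset.mem_sigma, Finset.mem_range, mem_antidiagonal] at h
      simp only [Finset.mem_filter, Finset.mem_product, Finset.mem_range]
      omega
    · rintro ⟨a, b⟩ h
      simp only [Finset.mem_filter, Finset.mem_product, Finset.mem_range] at h
      exact Finset.mem_sigma.mpr ⟨Finset.mem_range.mpr h.2, mem_antidiagonal.mpr rfl⟩
    · rintro ⟨k, a, b⟩ h
      simp only [Finset.mem_sigma, Finset.mem_range, mem_antidiagonal] at h
      obtain ⟨_, rfl⟩ := h
      rfl
    · rintro ⟨a, b⟩ _; rfl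
    · rintro ⟨k, a, b⟩ _; rfl
  · rintro ⟨i, j⟩ _ hne
    by_contra hc
    exact hne (by rw [coeff_pow_mul_pow_eq_zero hF hG (by simp only at hc; omega), smul_zero])

theorem sexp_zero : sexp (0 : MvPowerSeries τ S) = 1 := by
  rw [sexp, PowerSeries.subst_zero_eq_C_constantCoeff]
  simp

theorem constantCoeff_sexp {F : MvPowerSeries τ S} (hF : MvPowerSeries.constantCoeff F = 0) :
    MvPowerSeries.constantCoeff (sexp F) = 1 := by
  rw [← MvPowerSeries.coeff_zero_eq_constantCoeff_apply, coeff_sexp hF 0 (N := 1) (by simp)]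
  simp

theorem sexp_neg_mul {F : MvPowerSeries τ S} (hF : MvPowerSeries.constantCoeff F = 0) :
    sexp (-F) * sexp F = 1 := by
  rw [← sexp_add (by rw [map_neg, hF, neg_zero]) hF, neg_add_cancel, sexp_zero]

theorem sexp_sum {ι : Type*} (s : Finset ι) (F : ι → MvPowerSeries τ S)
    (hF : ∀ i, MvPowerSeries.constantCoeff (F i) = 0) :
    sexp (∑ i ∈ s, F i) = ∏ i ∈ s, sexp (F i) := by
  classical
  induction s using Finset.induction_on with
  | empty => simp [sexp_zero]
  | insert a s ha ih =>
    rw [Finset.sum_insert ha, Finset.prod_insert ha, sexp_add (hF a) (by simp [hF]), ih]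

/-- Ring homomorphisms that act coefficientwise commute with substitution into a power series. -/
theorem map_subst_of_coeff (Θ : MvPowerSeries τ S →+* MvPowerSeries τ' S')
    (ℓ : (τ' →₀ ℕ) → τ →₀ ℕ) (m : (τ' →₀ ℕ) → S →ₗ[ℂ] S')
    (h : ∀ F e, MvPowerSeries.coeff e (Θ F) = m e (MvPowerSeries.coeff (ℓ e) F))
    (f : PowerSeries ℂ) {F : MvPowerSeries τ S} (hF : MvPowerSeries.constantCoeff F = 0)
    (hΘ : MvPowerSeries.constantCoeff (Θ F) = 0) : Θ (f.subst F) = f.subst (Θ F) := by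
  ext e
  rw [h, coeff_subst_eq_sum f hF (ℓ e) (N := (ℓ e).degree + e.degree + 1) (by omega),
    coeff_subst_eq_sum f hΘ e (N := (ℓ e).degree + e.degree + 1) (by omega), map_sum]
  refine Finset.sum_congr rfl fun k _ => ?_
  rw [map_smul, ← h, map_pow]

/-- The chain rule for the exponential and a derivation that acts coefficientwise. -/
theorem derivation_sexp (δ : Derivation ℂ (MvPowerSeries τ S) (MvPowerSeries τ S))
    (m : (τ →₀ ℕ) → S →ₗ[ℂ] S)
    (h : ∀ F e, MvPowerSeries.coeff e (δ F) = m e (MvPowerSeries.coeff e F))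
    {F : MvPowerSeries τ S} (hF : MvPowerSeries.constantCoeff F = 0) :
    δ (sexp F) = sexp F * δ F := by
  classical
  ext e
  -- One power more than the degree requires, since differentiation turns `F^(k+1)/(k+1)!` into
  -- `F^k/k! · δF` while the power `k = 0` disappears.
  rw [h, coeff_sexp hF e (N := e.degree + 2) (by omega), map_sum, Finset.sum_range_succ',
    MvPowerSeries.coeff_mul]
  have h0 : m e (((0 ! : ℕ) : ℂ)⁻¹ • MvPowerSeries.coeff e (F ^ 0)) = 0 := by
    rw [map_smul, ← h, pow_zero, Derivation.map_one_eq_zero, map_zero, smul_zero]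
  rw [h0, add_zero]
  have h1 : ∀ p ∈ antidiagonal e,
      MvPowerSeries.coeff p.1 (sexp F) * MvPowerSeries.coeff p.2 (δ F) =
      ∑ k ∈ Finset.range (e.degree + 1), ((k ! : ℂ))⁻¹ •
        (MvPowerSeries.coeff p.1 (F ^ k) * MvPowerSeries.coeff p.2 (δ F)) := by
    intro p hp
    have hp' : p.1 + p.2 = e := mem_antidiagonal.mp hp
    have hd : p.1.degree + p.2.degree = e.degree := by rw [← hp', map_add]
    rw [coeff_sexp hF p.1 (N := e.degree + 1) (by omega), Finset.sum_mul]
    simp only [smul_mul_assoc]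
  rw [Finset.sum_congr rfl h1, Finset.sum_comm]
  refine Finset.sum_congr rfl fun k _ => ?_
  rw [← Finset.smul_sum, ← MvPowerSeries.coeff_mul, map_smul, ← h, Derivation.leibniz_pow,
    Nat.add_sub_cancel, map_nsmul, ← Nat.cast_smul_eq_nsmul ℂ, smul_smul, smul_eq_mul]
  congr 1
  rw [Nat.factorial_succ]
  have : ((k + 1 : ℕ) : ℂ) ≠ 0 := by exact_mod_cast Nat.succ_ne_zero k
  have h3 : ((k ! : ℕ) : ℂ) ≠ 0 := by exact_mod_cast k.factorial_ne_zero
  push_cast at this ⊢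
  field_simp

/-- A derivation of the coefficient ring, acting coefficientwise on series. -/
def serDeriv (τ : Type*) (D : Derivation ℂ S S) :
    Derivation ℂ (MvPowerSeries τ S) (MvPowerSeries τ S) :=
  Derivation.mk'
    { toFun := fun F e => D (F e)
      map_add' := fun F G => by funext e; exact map_add D _ _
      map_smul' := fun c F => by funext e; exact D.map_smul c _ }
    (fun F G => by
      classical
      ext e
      rw [smul_eq_mul, smul_eq_mul, mul_comm G]
      change D (MvPowerSeries.coeff e (F * G)) = _
      rw [MvPowerSeries.coeff_mul, map_sum, map_add, MvPowerSeries.coeff_mul,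
        MvPowerSeries.coeff_mul, ← Finset.sum_add_distrib]
      refine Finset.sum_congr rfl fun p _ => ?_
      rw [D.leibniz, smul_eq_mul, smul_eq_mul, mul_comm (MvPowerSeries.coeff p.2 G)]
      rfl)

@[simp] theorem coeff_serDeriv (D : Derivation ℂ S S) (F : MvPowerSeries τ S) (e : τ →₀ ℕ) :
    MvPowerSeries.coeff e (serDeriv τ D F) = D (MvPowerSeries.coeff e F) := rfl

end Series

theorem derivation_sum_apply {ι R : Type*} [CommRing R] [Algebra ℂ R] (s : Finset ι)
    (D : ι → Derivation ℂ R R) (x : R) : (∑ i ∈ s, D i) x = ∑ i ∈ s, D i x := by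
  classical
  induction s using Finset.induction_on with
  | empty => simp
  | insert a s ha ih => rw [Finset.sum_insert ha, Finset.sum_insert ha, Derivation.add_apply, ih]

/-! ### Derivations of the coefficients of a polynomial ring. -/

section PolyDeriv

variable {σ C : Type*} [CommRing C] [Algebra ℂ C]

/-- A derivation of the coefficient ring, acting coefficientwise on polynomials. -/
def polyDeriv (σ : Type*) (D : Derivation ℂ C C) :
    Derivation ℂ (MvPolynomial σ C) (MvPolynomial σ C) :=
  have hc : ∀ (p : MvPolynomial σ C) (r : σ →₀ ℕ), MvPolynomial.coeff r
      (∑ s ∈ p.support, MvPolynomial.monomial s (D (p.coeff s))) = D (p.coeff r) := by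
    classical
    intro p r
    rw [MvPolynomial.coeff_sum]
    simp only [MvPolynomial.coeff_monomial]
    rw [Finset.sum_ite_eq' p.support r]
    split_ifs with h
    · rfl
    · rw [MvPolynomial.notMem_support_iff.mp h, map_zero]
  Derivation.mk'
    { toFun := fun p => ∑ s ∈ p.support, MvPolynomial.monomial s (D (p.coeff s))
      map_add' := fun p q => by
        ext r
        rw [hc, MvPolynomial.coeff_add, MvPolynomial.coeff_add, hc, hc, map_add]
      map_smul' := fun c p => by
        ext r
        rw [hc, MvPolynomial.coeff_smul, RingHom.id_apply, MvPolynomial.coeff_smul, hc,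
          D.map_smul] }
    (fun p q => by
      classical
      ext r
      rw [smul_eq_mul, smul_eq_mul, mul_comm q]
      change MvPolynomial.coeff r (∑ s ∈ (p * q).support, _) = _
      rw [hc, MvPolynomial.coeff_mul, map_sum, MvPolynomial.coeff_add, MvPolynomial.coeff_mul,
        MvPolynomial.coeff_mul, ← Finset.sum_add_distrib]
      refine Finset.sum_congr rfl fun x _ => ?_
      rw [D.leibniz, smul_eq_mul, smul_eq_mul, mul_comm (MvPolynomial.coeff x.2 q)]
      congr 2
      · exact (hc q x.2).symm
      · exact (hc p x.1).symm)

@[simp] theorem coeff_polyDeriv (D : Derivation ℂ C C) (p : MvPolynomial σ C) (r : σ →₀ ℕ) :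
    MvPolynomial.coeff r (polyDeriv σ D p) = D (MvPolynomial.coeff r p) := by
  classical
  change MvPolynomial.coeff r
    (∑ s ∈ p.support, MvPolynomial.monomial s (D (p.coeff s))) = D (p.coeff r)
  rw [MvPolynomial.coeff_sum]
  simp only [MvPolynomial.coeff_monomial]
  rw [Finset.sum_ite_eq' p.support r]
  split_ifs with h
  · rfl
  · rw [MvPolynomial.notMem_support_iff.mp h, map_zero]

@[simp] theorem polyDeriv_C (D : Derivation ℂ C C) (a : C) :
    polyDeriv σ D (MvPolynomial.C a) = MvPolynomial.C (D a) := by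
  classical
  ext r
  rw [coeff_polyDeriv, MvPolynomial.coeff_C, MvPolynomial.coeff_C]
  split_ifs <;> simp

@[simp] theorem polyDeriv_X (D : Derivation ℂ C C) (i : σ) :
    polyDeriv σ D (MvPolynomial.X i) = 0 := by
  classical
  ext r
  rw [coeff_polyDeriv, MvPolynomial.coeff_X]
  split_ifs <;> simp

theorem polyDeriv_comm {D D' : Derivation ℂ C C} (h : ∀ x, D (D' x) = D' (D x))
    (p : MvPolynomial σ C) : polyDeriv σ D (polyDeriv σ D' p) =
      polyDeriv σ D' (polyDeriv σ D p) := by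
  ext r
  simp [h]

end PolyDeriv

/-! ### Substituting commuting operators for polynomial variables. -/

section OpEval

variable {n : ℕ} {C : Type*} [CommRing C] [Algebra ℂ C]

/-- The product of powers `∏ᵢ Nᵢ^{rᵢ}` of operators. -/
def opPow (N : Fin n → Module.End ℂ C) (r : Fin n → ℕ) : Module.End ℂ C :=
  ((List.finRange n).map fun i => N i ^ r i).prod

theorem list_prod_map_mul_of_commute {ι M : Type*} [Monoid M] (l : List ι) (f g : ι → M)
    (h : ∀ i j, Commute (f i) (g j)) :
    (l.map fun i => f i * g i).prod = (l.map f).prod * (l.map g).prod := by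
  induction l with
  | nil => simp
  | cons a l ih =>
    have : Commute (g a) (l.map f).prod := Commute.list_prod_right _ _ fun x hx => by
      obtain ⟨i, _, rfl⟩ := List.mem_map.mp hx
      exact (h i a).symm
    simp only [List.map_cons, List.prod_cons, ih]
    rw [mul_assoc, mul_assoc, ← mul_assoc (g a), this.eq, mul_assoc]

theorem opPow_add {N : Fin n → Module.End ℂ C} (h : ∀ i j, Commute (N i) (N j))
    (r s : Fin n → ℕ) : opPow N (r + s) = opPow N r * opPow N s := by
  rw [opPow, opPow, opPow, ← list_prod_map_mul_of_commute _ _ _ fun i j => (h i j).pow_pow _ _]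
  simp only [Pi.add_apply, pow_add]

theorem opPow_zero (N : Fin n → Module.End ℂ C) : opPow N 0 = 1 := by
  simp [opPow]

theorem opPow_single (N : Fin n → Module.End ℂ C) (i : Fin n) :
    opPow N (Pi.single i 1) = N i := by
  have : ∀ l : List (Fin n), l.Nodup → i ∈ l →
      (l.map fun j => N j ^ (Pi.single i 1 : Fin n → ℕ) j).prod = N i := by
    intro l
    induction l with
    | nil => simp
    | cons a l ih =>
      intro hl hi
      rw [List.map_cons, List.prod_cons]
      by_cases h : a = i
      · subst h
        rw [List.prod_eq_one, Pi.single_eq_same, pow_one, mul_one]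
        intro x hx
        obtain ⟨j, hj, rfl⟩ := List.mem_map.mp hx
        have : j ≠ a := fun e => (List.nodup_cons.mp hl).1 (e ▸ hj)
        rw [Pi.single_eq_of_ne this, pow_zero]
      · rw [Pi.single_eq_of_ne h, pow_zero, one_mul]
        refine ih (List.nodup_cons.mp hl).2 ?_
        rcases List.mem_cons.mp hi with h' | h'
        · exact absurd h'.symm h
        · exact h'
  exact this _ (List.nodup_finRange n) (List.mem_finRange i)

/-- The linear map `∑ c_r X^r ↦ ∑ ∏ᵢ Nᵢ^{rᵢ} c_r`. -/
def opEval (N : Fin n → Module.End ℂ C) : MvPolynomial (Fin n) C →ₗ[ℂ] C :=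
  have hs : ∀ (p : MvPolynomial (Fin n) C) (s : Finset (Fin n →₀ ℕ)), p.support ⊆ s →
      ∑ r ∈ p.support, opPow N r (p.coeff r) = ∑ r ∈ s, opPow N r (p.coeff r) := by
    intro p s h
    refine Finset.sum_subset h fun r _ hr => ?_
    rw [MvPolynomial.notMem_support_iff.mp hr, map_zero]
  { toFun := fun p => ∑ r ∈ p.support, opPow N r (p.coeff r)
    map_add' := fun p q => by
      classical
      rw [hs p (p.support ∪ q.support) Finset.subset_union_left,
        hs q (p.support ∪ q.support) Finset.subset_union_right,
        hs (p + q) (p.support ∪ q.support) MvPolynomial.support_add, ← Finset.sum_add_distrib]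
      simp only [MvPolynomial.coeff_add, map_add]
    map_smul' := fun c p => by
      rw [hs (c • p) p.support MvPolynomial.support_smul, RingHom.id_apply, Finset.smul_sum]
      simp only [MvPolynomial.coeff_smul, map_smul] }

theorem opEval_eq_sum (N : Fin n → Module.End ℂ C) {p : MvPolynomial (Fin n) C}
    {s : Finset (Fin n →₀ ℕ)} (h : p.support ⊆ s) :
    opEval N p = ∑ r ∈ s, opPow N r (p.coeff r) := by
  change ∑ r ∈ p.support, opPow N r (p.coeff r) = _
  refine Finset.sum_subset h fun r _ hr => ?_
  rw [MvPolynomial.notMem_support_iff.mp hr, map_zero]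

theorem opEval_monomial (N : Fin n → Module.End ℂ C) (r : Fin n →₀ ℕ) (c : C) :
    opEval N (MvPolynomial.monomial r c) = opPow N r c := by
  classical
  rw [opEval_eq_sum N MvPolynomial.support_monomial_subset, Finset.sum_singleton,
    MvPolynomial.coeff_monomial, if_pos rfl]

theorem opEval_C (N : Fin n → Module.End ℂ C) (c : C) :
    opEval N (MvPolynomial.C c) = c := by
  rw [MvPolynomial.C_apply, opEval_monomial, Finsupp.coe_zero, opPow_zero, Module.End.one_apply]

/-- Commutativity allows the additional factor `Nᵢ` to be pulled to the front of the ordered product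
of operators. -/
theorem opEval_mul_X {N : Fin n → Module.End ℂ C} (h : ∀ i j, Commute (N i) (N j)) (i : Fin n)
    (p : MvPolynomial (Fin n) C) : opEval N (p * MvPolynomial.X i) = N i (opEval N p) := by
  induction p using MvPolynomial.induction_on' with
  | monomial r c =>
    rw [MvPolynomial.X, MvPolynomial.monomial_mul, mul_one, opEval_monomial, opEval_monomial,
      Finsupp.coe_add, add_comm, opPow_add h, Finsupp.single_eq_pi_single, opPow_single,
      Module.End.mul_apply]
  | add p q hp hq => rw [add_mul, map_add, hp, hq, map_add, map_add]

theorem opEval_X_mul {N : Fin n → Module.End ℂ C} (h : ∀ i j, Commute (N i) (N j)) (i : Fin n)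
    (p : MvPolynomial (Fin n) C) : opEval N (MvPolynomial.X i * p) = N i (opEval N p) := by
  rw [mul_comm, opEval_mul_X h]

end OpEval

/-! ### The twisted derivations and the transformation that they define. -/

/-- Commuting derivations `dᵢ` of a commutative ring with coordinates `zᵢ`, their inverses `wᵢ`,
and parameters `vᵢ` annihilated by all derivations. -/
structure Coords (n : ℕ) (C : Type*) [CommRing C] [Algebra ℂ C] where
  d : Fin n → Derivation ℂ C C
  z : Fin n → C
  w : Fin n → C
  v : Fin n → C
  d_comm : ∀ i j x, d i (d j x) = d j (d i x)
  d_z : ∀ i j, d i (z j) = if i = j then 1 else 0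
  z_mul_w : ∀ i, z i * w i = 1
  d_v : ∀ i j, d i (v j) = 0

namespace Coords

variable {n : ℕ} {C : Type*} [CommRing C] [Algebra ℂ C] (K : Coords n C)

theorem d_w (i j : Fin n) : K.d i (K.w j) = if i = j then -(K.w j * K.w j) else 0 := by
  have h := congrArg (K.d i) (K.z_mul_w j)
  rw [Derivation.leibniz, Derivation.map_one_eq_zero, K.d_z, smul_eq_mul, smul_eq_mul] at h
  have h' := congrArg (K.w j * ·) h
  have hz := K.z_mul_w j
  simp only [mul_zero] at h'
  split_ifs at h' ⊢ with hij
  · linear_combination h' - (K.d i (K.w j)) * hz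
  · linear_combination h' - (K.d i (K.w j)) * hz

/-- The twisted operator `-∂ᵢ + vᵢ / zᵢ`. -/
def nabla (i : Fin n) : Module.End ℂ C :=
  LinearMap.mulLeft ℂ (K.v i * K.w i) - (K.d i).toLinearMap

theorem nabla_apply (i : Fin n) (x : C) : K.nabla i x = K.v i * K.w i * x - K.d i x := rfl

/-- The potential `vⱼ/zⱼ` is annihilated by `∂ᵢ` for `i ≠ j`, so there is no curvature and only
`∂ᵢ∂ⱼ = ∂ⱼ∂ᵢ` is needed. -/
theorem nabla_comm (i j : Fin n) : Commute (K.nabla i) (K.nabla j) := by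
  refine LinearMap.ext fun x => ?_
  simp only [Module.End.mul_apply, nabla_apply, map_sub, Derivation.leibniz, smul_eq_mul, K.d_w,
    K.d_v, K.d_comm i j]
  by_cases h : i = j
  · subst h; ring
  · rw [if_neg h, if_neg (Ne.symm h)]; ring

/-- The transformation `∑ c_r u^r ↦ ∑ ∏ᵢ (-∂ᵢ + vᵢ / zᵢ)^{rᵢ} c_r`. -/
def trans : MvPolynomial (Fin n) C →ₗ[ℂ] C := opEval K.nabla

theorem trans_C (c : C) : K.trans (MvPolynomial.C c) = c := opEval_C _ _

theorem trans_mul_X (i : Fin n) (p : MvPolynomial (Fin n) C) :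
    K.trans (p * MvPolynomial.X i) = K.nabla i (K.trans p) := opEval_mul_X K.nabla_comm i p

/-- The commutator of `∇ᵢ` and `zᵢ` is `-1`, so moving `zᵢ` through `∇ᵢ^r` costs `r ∇ᵢ^{r-1}`. In
terms of `u` this is a derivative `∂_{uᵢ}`. -/
theorem trans_z_mul (i : Fin n) (p : MvPolynomial (Fin n) C) :
    K.trans (MvPolynomial.C (K.z i) * p + MvPolynomial.pderiv i p) = K.z i * K.trans p := by
  induction p using MvPolynomial.induction_on with
  | C a => rw [MvPolynomial.pderiv_C, add_zero, ← map_mul, trans_C, trans_C]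
  | add p q hp hq =>
    rw [map_add K.trans p q, mul_add _ (K.trans p), ← hp, ← hq, ← map_add, map_add (MvPolynomial.pderiv i)]
    congr 1; ring
  | mul_X p j hp =>
    have : MvPolynomial.C (K.z i) * (p * MvPolynomial.X j) +
        MvPolynomial.pderiv i (p * MvPolynomial.X j) =
        (MvPolynomial.C (K.z i) * p + MvPolynomial.pderiv i p) * MvPolynomial.X j +
          (if i = j then p else 0) := by
      rw [MvPolynomial.pderiv_mul, MvPolynomial.pderiv_X]
      by_cases h : i = j
      · subst h; simp; ring
      · rw [Pi.single_eq_of_ne (Ne.symm h), if_neg h]; ring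
    rw [this, map_add, trans_mul_X, hp, trans_mul_X, nabla_apply, nabla_apply,
      Derivation.leibniz, K.d_z, smul_eq_mul, smul_eq_mul]
    by_cases h : i = j
    · subst h; simp; ring
    · rw [if_neg h, if_neg (Ne.symm h), map_zero]; ring

/-- On coefficients `∇ᵢ zᵢ = vᵢ - 1 - zᵢ∂ᵢ`, which expresses multiplication by `vᵢ` through `uᵢ` and
`zᵢ∂ᵢ`. The relation survives further factors `uⱼ` because `vᵢ` commutes with every `∇ⱼ`. -/
theorem trans_euler (i : Fin n) (p : MvPolynomial (Fin n) C) :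
    K.trans (MvPolynomial.C (K.z i) * p * MvPolynomial.X i + p +
      MvPolynomial.C (K.z i) * polyDeriv _ (K.d i) p) = K.v i * K.trans p := by
  induction p using MvPolynomial.induction_on with
  | C a =>
    rw [polyDeriv_C, map_add, map_add, ← map_mul, ← map_mul, trans_mul_X, trans_C, trans_C,
      trans_C, nabla_apply, Derivation.leibniz, K.d_z, smul_eq_mul, smul_eq_mul, if_pos rfl]
    linear_combination (K.v i * a) * K.z_mul_w i
  | add p q hp hq =>
    rw [map_add K.trans p q, mul_add _ (K.trans p), ← hp, ← hq, ← map_add, map_add (polyDeriv _ _)]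
    congr 1; ring
  | mul_X p j hp =>
    have : MvPolynomial.C (K.z i) * (p * MvPolynomial.X j) * MvPolynomial.X i +
        p * MvPolynomial.X j +
        MvPolynomial.C (K.z i) * polyDeriv _ (K.d i) (p * MvPolynomial.X j) =
        (MvPolynomial.C (K.z i) * p * MvPolynomial.X i + p +
          MvPolynomial.C (K.z i) * polyDeriv _ (K.d i) p) * MvPolynomial.X j := by
      rw [Derivation.leibniz, polyDeriv_X, smul_zero, zero_add, smul_eq_mul]; ring
    rw [this, trans_mul_X, hp, trans_mul_X, nabla_apply, nabla_apply, Derivation.leibniz, K.d_v,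
      smul_eq_mul, smul_eq_mul]
    ring

/-- The derivation `∑ zⱼ ∂ⱼ`. -/
def euler : Derivation ℂ C C := ∑ j, K.z j • K.d j

theorem euler_apply (x : C) : K.euler x = ∑ j, K.z j * K.d j x := by
  simp [euler, derivation_sum_apply]

/-- The derivation `∑ zⱼ ∂ⱼ - ∑ uⱼ ∂_{uⱼ}`. -/
def eulerPoly : Derivation ℂ (MvPolynomial (Fin n) C) (MvPolynomial (Fin n) C) :=
  polyDeriv _ K.euler -
    ∑ j, (MvPolynomial.X j : MvPolynomial (Fin n) C) • (MvPolynomial.pderiv j).restrictScalars ℂ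

theorem eulerPoly_C (c : C) : K.eulerPoly (MvPolynomial.C c) = MvPolynomial.C (K.euler c) := by
  simp [eulerPoly, derivation_sum_apply, Derivation.sub_apply]

theorem eulerPoly_X (i : Fin n) : K.eulerPoly (MvPolynomial.X i) = -MvPolynomial.X i := by
  simp only [eulerPoly, Derivation.sub_apply, polyDeriv_X, derivation_sum_apply,
    Derivation.smul_apply, Derivation.restrictScalars_apply, smul_eq_mul,
    zero_sub]
  rw [Finset.sum_eq_single i]
  · simp
  · intro j _ hj; rw [MvPolynomial.pderiv_X_of_ne hj.symm, mul_zero]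
  · simp

/-- Both `∂ᵢ` and multiplication by `vᵢ/zᵢ` lower the degree in `z` by one, the `vᵢ` having degree
zero. -/
theorem euler_nabla (i : Fin n) (x : C) :
    K.euler (K.nabla i x) = K.nabla i (K.euler x) - K.nabla i x := by
  have hw : K.euler (K.w i) = - K.w i := by
    rw [euler_apply, Finset.sum_eq_single i]
    · rw [d_w, if_pos rfl]; linear_combination -(K.w i) * K.z_mul_w i
    · intro j _ hj; rw [d_w, if_neg hj, mul_zero]
    · simp
  have hv : K.euler (K.v i) = 0 := by simp [euler_apply, K.d_v]
  have hd : K.d i (K.euler x) = K.d i x + K.euler (K.d i x) := by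
    simp only [euler_apply, map_sum, Derivation.leibniz, K.d_z, smul_eq_mul, K.d_comm i]
    rw [Finset.sum_add_distrib, add_comm]
    congr 1
    simp
  rw [nabla_apply, nabla_apply, map_sub, Derivation.leibniz, Derivation.leibniz, hw, hv, hd]
  simp only [smul_eq_mul]
  ring

/-- Since `uⱼ` is replaced by an operator of degree `-1`, the transformation preserves degrees once
`uⱼ` is given degree `-1`. -/
theorem euler_trans (p : MvPolynomial (Fin n) C) :
    K.euler (K.trans p) = K.trans (K.eulerPoly p) := by
  induction p using MvPolynomial.induction_on with
  | C a => rw [eulerPoly_C, trans_C, trans_C]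
  | add p q hp hq => rw [map_add, map_add, hp, hq, map_add, map_add]
  | mul_X p j hp =>
    rw [trans_mul_X, euler_nabla, hp, Derivation.leibniz, eulerPoly_X, smul_eq_mul, smul_eq_mul,
      mul_comm (MvPolynomial.X j), map_add, trans_mul_X, mul_neg, map_neg, trans_mul_X]
    ring

end Coords

/-! ### Functions and exponentials of `ħN` for an operator `N`. -/

section Operators

variable {C C' : Type*} [CommRing C] [Algebra ℂ C] [CommRing C'] [Algebra ℂ C']

/-- A linear map, acting coefficientwise on power series. -/
def serMap (f : C →ₗ[ℂ] C') : PowerSeries C →ₗ[ℂ] PowerSeries C' where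
  toFun F := PowerSeries.mk fun k => f (PowerSeries.coeff k F)
  map_add' F G := by ext k; simp
  map_smul' c F := by ext k; simp

@[simp] theorem coeff_serMap (f : C →ₗ[ℂ] C') (F : PowerSeries C) (k : ℕ) :
    PowerSeries.coeff k (serMap f F) = f (PowerSeries.coeff k F) := by
  simp [serMap]

theorem serMap_X_mul (f : C →ₗ[ℂ] C') (F : PowerSeries C) :
    serMap f (PowerSeries.X * F) = PowerSeries.X * serMap f F := by
  ext k
  rcases k with _ | k
  · simp [PowerSeries.coeff_zero_X_mul, -PowerSeries.coeff_zero_eq_constantCoeff]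
  · simp [PowerSeries.coeff_succ_X_mul]

theorem coeff_serDeriv' (D : Derivation ℂ C C) (F : PowerSeries C) (k : ℕ) :
    PowerSeries.coeff k (serDeriv Unit D F) = D (PowerSeries.coeff k F) := rfl

theorem serDeriv_C (D : Derivation ℂ C C) (x : C) :
    serDeriv Unit D (PowerSeries.C x : PowerSeries C) = (PowerSeries.C (D x) : PowerSeries C) := by
  ext k
  rw [coeff_serDeriv', PowerSeries.coeff_C, PowerSeries.coeff_C]
  split_ifs <;> simp

theorem serDeriv_X (D : Derivation ℂ C C) :
    serDeriv Unit D (PowerSeries.X : PowerSeries C) = 0 := by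
  ext k
  rw [coeff_serDeriv', PowerSeries.coeff_X]
  split_ifs <;> simp

/-- The operator `f(ħ N) = ∑ f_a ħ^a N^a` on power series in `ħ`. -/
def opSer (f : PowerSeries C) (N : Module.End ℂ C) (F : PowerSeries C) : PowerSeries C :=
  PowerSeries.mk fun k => ∑ p ∈ antidiagonal k,
    PowerSeries.coeff p.1 f * (N ^ p.1) (PowerSeries.coeff p.2 F)

theorem coeff_opSer (f : PowerSeries C) (N : Module.End ℂ C) (F : PowerSeries C) (k : ℕ) :
    PowerSeries.coeff k (opSer f N F) = ∑ p ∈ antidiagonal k,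
      PowerSeries.coeff p.1 f * (N ^ p.1) (PowerSeries.coeff p.2 F) := PowerSeries.coeff_mk _ _

theorem coeff_opSer_C (f : PowerSeries C) (N : Module.End ℂ C) (x : C) (k : ℕ) :
    PowerSeries.coeff k (opSer f N (PowerSeries.C x)) = PowerSeries.coeff k f * (N ^ k) x := by
  rw [coeff_opSer, Finset.sum_eq_single (k, 0)]
  · simp
  · rintro ⟨a, b⟩ h hne
    have hab : a + b = k := mem_antidiagonal.mp h
    have : b ≠ 0 := by rintro rfl; exact hne (by rw [← hab]; rfl)
    simp [PowerSeries.coeff_C, this]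
  · intro h; exact absurd (mem_antidiagonal.mpr (add_zero k)) h

theorem opSer_sub_left (f g : PowerSeries C) (N : Module.End ℂ C) (F : PowerSeries C) :
    opSer (f - g) N F = opSer f N F - opSer g N F := by
  ext k
  simp only [coeff_opSer, map_sub, sub_mul, Finset.sum_sub_distrib]

/-- When `N` commutes with multiplication by the coefficients of `g`, operators of the form `f(ħN)`
and `g(ħN)` compose by multiplying their symbols. -/
theorem opSer_comp (f g : PowerSeries C) (N : Module.End ℂ C)
    (hg : ∀ k x, N (PowerSeries.coeff k g * x) = PowerSeries.coeff k g * N x) (x : C) :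
    opSer f N (opSer g N (PowerSeries.C x)) = opSer (f * g) N (PowerSeries.C x) := by
  have hg' : ∀ k a x, (N ^ a) (PowerSeries.coeff k g * x) =
      PowerSeries.coeff k g * (N ^ a) x := by
    intro k a
    induction a with
    | zero => intro x; rfl
    | succ a ih => intro x; rw [pow_succ, Module.End.mul_apply, Module.End.mul_apply, hg, ih]
  ext k
  rw [coeff_opSer, coeff_opSer_C, PowerSeries.coeff_mul, Finset.sum_mul]
  refine Finset.sum_congr rfl fun p hp => ?_
  have hk : p.1 + p.2 = k := mem_antidiagonal.mp hp
  rw [coeff_opSer_C, hg', ← hk, pow_add, Module.End.mul_apply, mul_assoc]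

/-- The operator `e^{c ħ N}` on power series in `ħ`. -/
def expOp (c : ℂ) (N : Module.End ℂ C) (F : PowerSeries C) : PowerSeries C :=
  opSer (PowerSeries.map (algebraMap ℂ C) (PowerSeries.rescale c (PowerSeries.exp ℂ))) N F

theorem coeff_expOp (c : ℂ) (N : Module.End ℂ C) (F : PowerSeries C) (k : ℕ) :
    PowerSeries.coeff k (expOp c N F) = ∑ p ∈ antidiagonal k,
      (c ^ p.1 * ((p.1 ! : ℂ))⁻¹) • (N ^ p.1) (PowerSeries.coeff p.2 F) := by
  rw [expOp, coeff_opSer]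
  refine Finset.sum_congr rfl fun p _ => ?_
  rw [PowerSeries.coeff_map, PowerSeries.coeff_rescale, coeff_exp_complex, Algebra.smul_def]

theorem expOp_neg (c : ℂ) (N : Module.End ℂ C) (F : PowerSeries C) :
    expOp c (-N) F = expOp (-c) N F := by
  ext k
  rw [coeff_expOp, coeff_expOp]
  refine Finset.sum_congr rfl fun p _ => ?_
  have : ((-N) ^ p.1) = (-1 : ℂ) ^ p.1 • N ^ p.1 := by rw [← smul_pow, neg_one_smul]
  rw [this, LinearMap.smul_apply, smul_smul, neg_pow c]
  congr 1
  ring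

theorem coeff_zero_expOp (c : ℂ) (N : Module.End ℂ C) (F : PowerSeries C) :
    PowerSeries.coeff 0 (expOp c N F) = PowerSeries.coeff 0 F := by
  rw [coeff_expOp, Finset.sum_eq_single (0, 0)]
  · simp
  · rintro ⟨a, b⟩ h hne
    have := mem_antidiagonal.mp h
    simp only at this
    exact absurd (by rw [show a = 0 by omega, show b = 0 by omega]) hne
  · intro h; exact absurd (mem_antidiagonal.mpr (add_zero 0)) h

theorem expOp_serMap {N P : Module.End ℂ C} (h : Commute P N) (c : ℂ) (F : PowerSeries C) :
    serMap P (expOp c N F) = expOp c N (serMap P F) := by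
  ext k
  rw [coeff_serMap, coeff_expOp, coeff_expOp, map_sum]
  refine Finset.sum_congr rfl fun p _ => ?_
  rw [map_smul, coeff_serMap, ← Module.End.mul_apply, ← Module.End.mul_apply, (h.pow_right _).eq]

/-- The Leibniz formula with a different operator on each factor. This generality is what permits a
derivation of a product to be split by opposite potentials on the two factors. -/
theorem pow_apply_mul {N₁ N₂ N₃ : Module.End ℂ C} (h : ∀ x y, N₃ (x * y) = N₁ x * y + x * N₂ y)
    (k : ℕ) (x y : C) : (N₃ ^ k) (x * y) =
      ∑ p ∈ antidiagonal k, k.choose p.1 • ((N₁ ^ p.1) x * (N₂ ^ p.2) y) := by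
  induction k with
  | zero => simp
  | succ k ih =>
    rw [pow_succ', Module.End.mul_apply, ih, map_sum,
      Finset.sum_antidiagonal_choose_succ_nsmul (fun a b => (N₁ ^ a) x * (N₂ ^ b) y),
      ← Finset.sum_add_distrib]
    refine Finset.sum_congr rfl fun p hp => ?_
    have hk : p.1 + p.2 = k := mem_antidiagonal.mp hp
    have hc : k.choose p.2 = k.choose p.1 := by rw [← hk, Nat.choose_symm_add]
    rw [map_nsmul, h, hc, pow_succ', pow_succ', Module.End.mul_apply, Module.End.mul_apply,
      smul_add, add_comm]

theorem expCoeff_mul {N₁ N₂ N₃ : Module.End ℂ C}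
    (h : ∀ x y, N₃ (x * y) = N₁ x * y + x * N₂ y) (c : ℂ) (k : ℕ) (x y : C) :
    (c ^ k * ((k ! : ℂ))⁻¹) • (N₃ ^ k) (x * y) =
      ∑ p ∈ antidiagonal k, ((c ^ p.1 * ((p.1 ! : ℂ))⁻¹) • (N₁ ^ p.1) x) *
        ((c ^ p.2 * ((p.2 ! : ℂ))⁻¹) • (N₂ ^ p.2) y) := by
  rw [pow_apply_mul h, Finset.smul_sum]
  refine Finset.sum_congr rfl fun p hp => ?_
  have hk : p.1 + p.2 = k := mem_antidiagonal.mp hp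
  subst hk
  rw [smul_mul_smul_comm, ← Nat.cast_smul_eq_nsmul ℂ, smul_smul]
  congr 1
  have hh := Nat.add_choose_mul_factorial_mul_factorial p.1 p.2
  rw [← Nat.choose_symm_add] at hh
  have h' : (((p.1 + p.2).choose p.1 : ℕ) : ℂ) * (p.1 ! : ℂ) * (p.2 ! : ℂ) =
    ((p.1 + p.2)! : ℂ) := by exact_mod_cast hh
  have h1 : ((p.1 ! : ℕ) : ℂ) ≠ 0 := by exact_mod_cast p.1.factorial_ne_zero
  have h2 : ((p.2 ! : ℕ) : ℂ) ≠ 0 := by exact_mod_cast p.2.factorial_ne_zero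
  have h3 : (((p.1 + p.2)! : ℕ) : ℂ) ≠ 0 := by exact_mod_cast (p.1 + p.2).factorial_ne_zero
  rw [pow_add]
  field_simp
  linear_combination (c ^ p.1 * c ^ p.2) * h'

/-- The regrouping behind `expOp_mul`: a total order in `ħ`, split first into operator order and
series order, is split instead according to the two factors. -/
theorem sum_antidiagonal_four {M : Type*} [AddCommMonoid M] (k : ℕ) (f : ℕ → ℕ → ℕ → ℕ → M) :
    ∑ x ∈ antidiagonal k, ∑ y ∈ antidiagonal x.2, ∑ w ∈ antidiagonal x.1, f w.1 y.1 w.2 y.2 =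
      ∑ x ∈ antidiagonal k, ∑ y ∈ antidiagonal x.1, ∑ w ∈ antidiagonal x.2,
        f y.1 y.2 w.1 w.2 := by
  simp only [Finset.sum_sigma']
  refine Finset.sum_nbij'
    (fun x => ⟨(x.2.2.1 + x.2.1.1, x.2.2.2 + x.2.1.2), ⟨(x.2.2.1, x.2.1.1), (x.2.2.2, x.2.1.2)⟩⟩)
    (fun x => ⟨(x.2.1.1 + x.2.2.1, x.2.1.2 + x.2.2.2), ⟨(x.2.1.2, x.2.2.2), (x.2.1.1, x.2.2.1)⟩⟩)
    ?_ ?_ ?_ ?_ ?_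
  · rintro ⟨⟨a, b⟩, ⟨⟨c, d⟩, ⟨e, g⟩⟩⟩ h
    simp only [Finset.mem_sigma, mem_antidiagonal] at h ⊢
    refine ⟨?_, ?_, ?_⟩ <;> first | omega | trivial
  · rintro ⟨⟨a, b⟩, ⟨⟨c, d⟩, ⟨e, g⟩⟩⟩ h
    simp only [Finset.mem_sigma, mem_antidiagonal] at h ⊢
    refine ⟨?_, ?_, ?_⟩ <;> first | omega | trivial
  · rintro ⟨⟨a, b⟩, ⟨⟨c, d⟩, ⟨e, g⟩⟩⟩ h
    simp only [Finset.mem_sigma, mem_antidiagonal] at h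
    obtain ⟨_, rfl, rfl⟩ := h
    rfl
  · rintro ⟨⟨a, b⟩, ⟨⟨c, d⟩, ⟨e, g⟩⟩⟩ h
    simp only [Finset.mem_sigma, mem_antidiagonal] at h
    obtain ⟨_, rfl, rfl⟩ := h
    rfl
  · rintro ⟨⟨a, b⟩, ⟨⟨c, d⟩, ⟨e, g⟩⟩⟩ _
    rfl

/-- The exponentials of operators with a Leibniz rule are multiplicative. -/
theorem expOp_mul {N₁ N₂ N₃ : Module.End ℂ C} (h : ∀ x y, N₃ (x * y) = N₁ x * y + x * N₂ y)
    (c : ℂ) (F G : PowerSeries C) : expOp c N₃ (F * G) = expOp c N₁ F * expOp c N₂ G := by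
  ext k
  rw [PowerSeries.coeff_mul, coeff_expOp]
  simp only [coeff_expOp, PowerSeries.coeff_mul, map_sum, Finset.smul_sum, expCoeff_mul h,
    Finset.sum_mul_sum]
  exact sum_antidiagonal_four k fun a b d e =>
    ((c ^ a * ((a ! : ℂ))⁻¹) • (N₁ ^ a) (PowerSeries.coeff b F)) *
      ((c ^ d * ((d ! : ℂ))⁻¹) • (N₂ ^ d) (PowerSeries.coeff e G))

/-- A series with equal shifts by `± ħ / 2` is annihilated by the derivation. -/
theorem serMap_eq_zero_of_expOp_eq {N : Module.End ℂ C} {F : PowerSeries C}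
    (h : expOp (1 / 2) N F = expOp (-(1 / 2)) N F) : serMap N F = 0 := by
  have key : ∀ k, N (PowerSeries.coeff k F) = 0 := by
    intro k
    induction k using Nat.strong_induction_on with
    | _ k ih =>
      -- In the difference of the two shifts at order `ħ^{k+1}`, the operator order zero cancels and
      -- the order one contributes `N F_k`. Higher orders apply a power of `N` to an earlier
      -- coefficient, which `N` kills by induction.
      have hk := congrArg (PowerSeries.coeff (k + 1)) h
      rw [coeff_expOp, coeff_expOp, ← sub_eq_zero, ← Finset.sum_sub_distrib] at hk
      rw [Finset.sum_eq_single (1, k)] at hk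
      · rw [← sub_smul] at hk
        have hc : ((1 / 2 : ℂ) ^ 1 * ((1 ! : ℕ) : ℂ)⁻¹ - (-(1 / 2)) ^ 1 * ((1 ! : ℕ) : ℂ)⁻¹) = 1 := by
          norm_num
        simpa only [hc, one_smul, pow_one N] using hk
      · rintro ⟨a, b⟩ hab hne
        have hab' : a + b = k + 1 := mem_antidiagonal.mp hab
        rcases a with _ | _ | a
        · simp
        · exact absurd (by rw [show b = k by omega]) hne
        · have : N (PowerSeries.coeff b F) = 0 := ih b (by omega)
          simp only
          rw [pow_succ N, Module.End.mul_apply, this, map_zero, smul_zero, smul_zero, sub_zero]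
      · intro h'; exact absurd (mem_antidiagonal.mpr (add_comm 1 k)) h'
  ext k
  rw [coeff_serMap, key, map_zero]

end Operators

/-! ### The series `f(aħ)` and `e^{caħ}`. -/

section RescaledSeries

variable {R : Type*} [CommRing R] [Algebra ℂ R]

/-- The series `f(a ħ)` for a power series `f` with complex coefficients. -/
def scaled (f : PowerSeries ℂ) (a : R) : PowerSeries R :=
  PowerSeries.rescale a (PowerSeries.map (algebraMap ℂ R) f)

theorem coeff_scaled (f : PowerSeries ℂ) (a : R) (k : ℕ) :
    PowerSeries.coeff k (scaled f a) = a ^ k * algebraMap ℂ R (PowerSeries.coeff k f) := by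
  simp [scaled, PowerSeries.coeff_rescale]

theorem scaled_mul (f g : PowerSeries ℂ) (a : R) :
    scaled (f * g) a = scaled f a * scaled g a := by simp [scaled]

theorem scaled_sub (f g : PowerSeries ℂ) (a : R) :
    scaled (f - g) a = scaled f a - scaled g a := by simp [scaled]

theorem scaled_X (a : R) : scaled PowerSeries.X a = PowerSeries.C a * PowerSeries.X := by
  ext k
  rw [coeff_scaled, PowerSeries.coeff_C_mul, PowerSeries.coeff_X, PowerSeries.coeff_X]
  split_ifs with h
  · simp [h]
  · simp

theorem scaled_one (a : R) : scaled 1 a = 1 := by simp [scaled]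

/-- The series `e^{c a ħ}`. -/
def expSer (c : ℂ) (a : R) : PowerSeries R :=
  scaled (PowerSeries.rescale c (PowerSeries.exp ℂ)) a

theorem coeff_expSer (c : ℂ) (a : R) (k : ℕ) :
    PowerSeries.coeff k (expSer c a) = (c ^ k * ((k ! : ℂ))⁻¹) • a ^ k := by
  rw [expSer, coeff_scaled, PowerSeries.coeff_rescale, coeff_exp_complex, Algebra.smul_def,
    mul_comm]

theorem expSer_mul_expSer_neg (c : ℂ) (a : R) : expSer c a * expSer (-c) a = 1 := by
  rw [expSer, expSer, ← scaled_mul, PowerSeries.exp_mul_exp_eq_exp_add, add_neg_cancel]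
  simp [scaled_one]

theorem X_mul_scaled_S (a : R) : PowerSeries.C a * PowerSeries.X * scaled S a =
    expSer (1 / 2) a - expSer (-(1 / 2)) a := by
  rw [expSer, expSer, ← scaled_sub, ← X_mul_S, scaled_mul, scaled_X]

theorem constantCoeff_scaled_S (a : R) : PowerSeries.constantCoeff (scaled S a) = 1 := by
  rw [← PowerSeries.coeff_zero_eq_constantCoeff_apply, coeff_scaled]
  simp [S, -PowerSeries.coeff_zero_eq_constantCoeff]

theorem constantCoeff_expSer (c : ℂ) (a : R) : PowerSeries.constantCoeff (expSer c a) = 1 := by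
  rw [← PowerSeries.coeff_zero_eq_constantCoeff_apply, coeff_expSer]
  simp

theorem serDeriv_scaled {D : Derivation ℂ R R} {a : R} (h : D a = 0) (f : PowerSeries ℂ) :
    serDeriv Unit D (scaled f a) = 0 := by
  ext k
  rw [coeff_serDeriv', coeff_scaled, Derivation.leibniz, Derivation.leibniz_pow, h]
  simp

theorem serDeriv_expSer {D : Derivation ℂ R R} {a : R} (h : D a = 1) (c : ℂ) :
    serDeriv Unit D (expSer c a) =
      PowerSeries.C (algebraMap ℂ R c) * PowerSeries.X * expSer c a := by
  ext k
  rw [coeff_serDeriv', coeff_expSer, D.map_smul, Derivation.leibniz_pow, h, mul_assoc,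
    PowerSeries.coeff_C_mul]
  rcases k with _ | k
  · simp [PowerSeries.coeff_zero_X_mul, -PowerSeries.coeff_zero_eq_constantCoeff]
  · rw [PowerSeries.coeff_succ_X_mul, coeff_expSer, Nat.add_sub_cancel, smul_eq_mul, mul_one,
      ← Nat.cast_smul_eq_nsmul ℂ, smul_smul, ← Algebra.smul_def, smul_smul, Nat.factorial_succ]
    congr 1
    have : ((k + 1 : ℕ) : ℂ) ≠ 0 := by exact_mod_cast Nat.succ_ne_zero k
    have h3 : ((k ! : ℕ) : ℂ) ≠ 0 := by exact_mod_cast k.factorial_ne_zero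
    push_cast at this ⊢
    field_simp
    ring

end RescaledSeries

/-! ### From multiplicative to additive differences under the transformation. -/

namespace Coords

variable {n : ℕ} {C : Type*} [CommRing C] [Algebra ℂ C] (K : Coords n C)

/-- The scalar `1 / 2` of the algebra. -/
def half (C : Type*) [CommRing C] [Algebra ℂ C] : C := algebraMap ℂ C (1 / 2)

theorem half_add_half : half C + half C = 1 := by
  rw [half, ← map_add, add_halves, map_one]

/-- `∂_{uᵢ}` on power series in `ħ` with coefficients in `C[u]`. -/
def du (i : Fin n) : Derivation ℂ (PowerSeries (MvPolynomial (Fin n) C))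
    (PowerSeries (MvPolynomial (Fin n) C)) :=
  serDeriv Unit ((MvPolynomial.pderiv i).restrictScalars ℂ)

/-- `∂_{zᵢ}` on power series in `ħ` with coefficients in `C[u]`. -/
def dz (i : Fin n) : Derivation ℂ (PowerSeries (MvPolynomial (Fin n) C))
    (PowerSeries (MvPolynomial (Fin n) C)) :=
  serDeriv Unit (polyDeriv _ (K.d i))

/-- An element of `C` as a constant series. -/
def cst (n : ℕ) : C →+* PowerSeries (MvPolynomial (Fin n) C) :=
  PowerSeries.C.comp MvPolynomial.C

/-- The variable `uᵢ` as a series. -/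
def uVar (C : Type*) [CommRing C] (i : Fin n) : PowerSeries (MvPolynomial (Fin n) C) :=
  PowerSeries.C (MvPolynomial.X i)

@[simp] theorem du_cst (i : Fin n) (c : C) : du i (cst n c) = 0 := by
  simp [du, cst, serDeriv_C]

@[simp] theorem dz_cst (i : Fin n) (c : C) : K.dz i (cst n c) = cst n (K.d i c) := by
  simp [dz, cst, serDeriv_C]

theorem du_uVar (i j : Fin n) : du i (uVar C j) = if i = j then 1 else 0 := by
  rw [du, uVar, serDeriv_C, Derivation.restrictScalars_apply, MvPolynomial.pderiv_X]
  split_ifs with h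
  · subst h; simp
  · rw [Pi.single_eq_of_ne (Ne.symm h), map_zero]

@[simp] theorem dz_uVar (i j : Fin n) : K.dz i (uVar C j) = 0 := by
  simp [dz, uVar, serDeriv_C]

@[simp] theorem du_X (i : Fin n) : du i (PowerSeries.X : PowerSeries (MvPolynomial (Fin n) C)) = 0 :=
  serDeriv_X _

@[simp] theorem dz_X (i : Fin n) : K.dz i PowerSeries.X = 0 := serDeriv_X _

/-- The transformation `trans`, acting coefficientwise on power series in `ħ`. -/
def strans : PowerSeries (MvPolynomial (Fin n) C) →ₗ[ℂ] PowerSeries C := serMap K.trans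

theorem strans_X_mul (F : PowerSeries (MvPolynomial (Fin n) C)) :
    K.strans (PowerSeries.X * F) = PowerSeries.X * K.strans F := serMap_X_mul _ _

theorem strans_scalar_mul (c : ℂ) (F : PowerSeries (MvPolynomial (Fin n) C)) :
    K.strans (cst n (algebraMap ℂ C c) * F) = PowerSeries.C (algebraMap ℂ C c) * K.strans F := by
  ext k
  rw [strans, coeff_serMap, cst, RingHom.comp_apply, PowerSeries.coeff_C_mul,
    PowerSeries.coeff_C_mul, coeff_serMap, ← Algebra.smul_def, ← map_smul]
  congr 1
  rw [← MvPolynomial.smul_eq_C_mul, algebraMap_smul]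

theorem strans_z_mul (i : Fin n) (F : PowerSeries (MvPolynomial (Fin n) C)) :
    K.strans (cst n (K.z i) * F + du i F) = PowerSeries.C (K.z i) * K.strans F := by
  ext k
  rw [strans, coeff_serMap, PowerSeries.coeff_C_mul, coeff_serMap, ← trans_z_mul, map_add, cst,
    RingHom.comp_apply, PowerSeries.coeff_C_mul]
  rfl

theorem strans_euler (i : Fin n) (F : PowerSeries (MvPolynomial (Fin n) C)) :
    K.strans (cst n (K.z i) * F * uVar C i + F + cst n (K.z i) * K.dz i F) =
      PowerSeries.C (K.v i) * K.strans F := by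
  ext k
  rw [strans, coeff_serMap, PowerSeries.coeff_C_mul, coeff_serMap, ← trans_euler]
  congr 1
  rw [map_add, map_add, cst, RingHom.comp_apply, PowerSeries.coeff_C_mul, uVar,
    PowerSeries.coeff_mul_C, PowerSeries.coeff_C_mul]
  rfl

/-- `e^{c uᵢ ħ}`. -/
def expU (C : Type*) [CommRing C] [Algebra ℂ C] (c : ℂ) (i : Fin n) :
    PowerSeries (MvPolynomial (Fin n) C) := expSer c (MvPolynomial.X i)

theorem du_expU (c : ℂ) (i j : Fin n) : du i (expU C c j) =
    if i = j then cst n (algebraMap ℂ C c) * PowerSeries.X * expU C c j else 0 := by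
  split_ifs with h
  · subst h
    rw [du, expU, serDeriv_expSer (by simp)]
    rfl
  · rw [du, expU, expSer, serDeriv_scaled]
    rw [Derivation.restrictScalars_apply, MvPolynomial.pderiv_X_of_ne (Ne.symm h)]

@[simp] theorem dz_expU (c : ℂ) (i j : Fin n) : K.dz i (expU C c j) = 0 :=
  serDeriv_scaled (by simp) _

/-- `aᵢ = e^{uᵢħ/2} zᵢ`. -/
def aMul (i : Fin n) : PowerSeries (MvPolynomial (Fin n) C) := expU C (1 / 2) i * cst n (K.z i)

/-- `bᵢ = e^{-uᵢħ/2} zᵢ`. -/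
def bMul (i : Fin n) : PowerSeries (MvPolynomial (Fin n) C) := expU C (-(1 / 2)) i * cst n (K.z i)

/-- `aᵢ = zᵢ + vᵢħ/2`. -/
def aAdd (i : Fin n) : PowerSeries C :=
  PowerSeries.C (K.z i) + PowerSeries.C (half C) * (PowerSeries.C (K.v i) * PowerSeries.X)

/-- `bᵢ = zᵢ - vᵢħ/2`. -/
def bAdd (i : Fin n) : PowerSeries C :=
  PowerSeries.C (K.z i) - PowerSeries.C (half C) * (PowerSeries.C (K.v i) * PowerSeries.X)

/-- The exponent `∑ uᵢ (S(uᵢħ) - 1) zᵢ`. -/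
def phase : PowerSeries (MvPolynomial (Fin n) C) :=
  ∑ i, uVar C i * cst n (K.z i) * (scaled S (MvPolynomial.X i) - 1)

/-- `∏ e^{uᵢ (S(uᵢħ) - 1) zᵢ}`. -/
def expPhase : PowerSeries (MvPolynomial (Fin n) C) := sexp K.phase

theorem constantCoeff_phase : PowerSeries.constantCoeff K.phase = 0 := by
  simp [phase, constantCoeff_scaled_S]

/-- By `uħ S(uħ) = e^{uħ/2} - e^{-uħ/2}`, `ħΦ` is linear in `aᵢ`, `bᵢ` and `ħuᵢzᵢ`. The derivatives
of `Φ` are read off from this form. -/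
theorem X_mul_phase : PowerSeries.X * K.phase =
    ∑ i, (K.aMul i - K.bMul i - PowerSeries.X * (uVar C i * cst n (K.z i))) := by
  rw [phase, Finset.mul_sum]
  refine Finset.sum_congr rfl fun i _ => ?_
  have h := X_mul_scaled_S (MvPolynomial.X i : MvPolynomial (Fin n) C)
  rw [aMul, bMul, expU, expU, uVar]
  linear_combination cst n (K.z i) * h

theorem cst_scalar_neg_half : cst n (algebraMap ℂ C (-(1 / 2))) = -cst n (half C) := by
  rw [half, map_neg, map_neg]

theorem du_aMul (i j : Fin n) : du i (K.aMul j) =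
    if i = j then cst n (half C) * PowerSeries.X * K.aMul j else 0 := by
  rw [aMul, Derivation.leibniz, du_cst, smul_zero, zero_add, du_expU, smul_eq_mul]
  split_ifs
  · rw [half]; ring
  · simp

theorem du_bMul (i j : Fin n) : du i (K.bMul j) =
    if i = j then -(cst n (half C) * PowerSeries.X * K.bMul j) else 0 := by
  rw [bMul, Derivation.leibniz, du_cst, smul_zero, zero_add, du_expU, smul_eq_mul,
    cst_scalar_neg_half]
  split_ifs
  · ring
  · simp

theorem z_mul_dz_aMul (i j : Fin n) : cst n (K.z i) * K.dz i (K.aMul j) =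
    if i = j then K.aMul j else 0 := by
  rw [aMul, Derivation.leibniz, dz_expU, smul_zero, add_zero, dz_cst, K.d_z, smul_eq_mul]
  split_ifs with h
  · subst h; simp; ring
  · simp

theorem z_mul_dz_bMul (i j : Fin n) : cst n (K.z i) * K.dz i (K.bMul j) =
    if i = j then K.bMul j else 0 := by
  rw [bMul, Derivation.leibniz, dz_expU, smul_zero, add_zero, dz_cst, K.d_z, smul_eq_mul]
  split_ifs with h
  · subst h; simp; ring
  · simp

theorem du_phase (i : Fin n) :
    du i K.phase = cst n (half C) * (K.aMul i + K.bMul i) - cst n (K.z i) := by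
  apply PowerSeries.X_mul_cancel
  have h := congrArg (du i) K.X_mul_phase
  rw [Derivation.leibniz, du_X, smul_zero, add_zero, smul_eq_mul, map_sum,
    Finset.sum_eq_single i] at h
  · rw [h, map_sub, map_sub, du_aMul, du_bMul, Derivation.leibniz, Derivation.leibniz, du_X,
      du_cst, du_uVar, if_pos rfl, if_pos rfl, if_pos rfl]
    simp only [smul_eq_mul]
    ring
  · intro j _ hj
    rw [map_sub, map_sub, du_aMul, du_bMul, Derivation.leibniz, Derivation.leibniz, du_X, du_cst,
      du_uVar, if_neg hj.symm, if_neg hj.symm, if_neg hj.symm]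
    simp
  · simp

theorem z_mul_dz_phase (i : Fin n) : PowerSeries.X * (cst n (K.z i) * K.dz i K.phase) =
    K.aMul i - K.bMul i - PowerSeries.X * (uVar C i * cst n (K.z i)) := by
  have h := congrArg (K.dz i) K.X_mul_phase
  rw [Derivation.leibniz, dz_X, smul_zero, add_zero, smul_eq_mul, map_sum,
    Finset.sum_eq_single i] at h
  · rw [mul_left_comm, h, map_sub, map_sub, mul_sub, mul_sub, z_mul_dz_aMul, z_mul_dz_bMul,
      Derivation.leibniz, Derivation.leibniz, dz_X, dz_cst, dz_uVar, if_pos rfl, if_pos rfl,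
      K.d_z, if_pos rfl]
    simp only [smul_eq_mul, map_one]
    ring
  · intro j _ hj
    rw [map_sub, map_sub, aMul, bMul]
    simp [Derivation.leibniz, K.d_z, hj.symm]
  · simp

theorem du_expPhase (i : Fin n) : du i K.expPhase = K.expPhase * du i K.phase :=
  derivation_sexp _ (fun _ => ((MvPolynomial.pderiv i).restrictScalars ℂ).toLinearMap)
    (fun _ _ => rfl) K.constantCoeff_phase

theorem dz_expPhase (i : Fin n) : K.dz i K.expPhase = K.expPhase * K.dz i K.phase :=
  derivation_sexp _ (fun _ => (polyDeriv _ (K.d i)).toLinearMap)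
    (fun _ _ => rfl) K.constantCoeff_phase

/-- The derivation `∂_{uᵢ} + ħ zᵢ ∂_{zᵢ} / 2`. -/
def dPlus (i : Fin n) : Derivation ℂ (PowerSeries (MvPolynomial (Fin n) C))
    (PowerSeries (MvPolynomial (Fin n) C)) :=
  du i + (cst n (half C) * PowerSeries.X * cst n (K.z i)) • K.dz i

/-- The derivation `∂_{uᵢ} - ħ zᵢ ∂_{zᵢ} / 2`. -/
def dMinus (i : Fin n) : Derivation ℂ (PowerSeries (MvPolynomial (Fin n) C))
    (PowerSeries (MvPolynomial (Fin n) C)) :=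
  du i - (cst n (half C) * PowerSeries.X * cst n (K.z i)) • K.dz i

theorem dPlus_apply (i : Fin n) (F : PowerSeries (MvPolynomial (Fin n) C)) : K.dPlus i F =
    du i F + cst n (half C) * PowerSeries.X * (cst n (K.z i) * K.dz i F) := by
  rw [dPlus, Derivation.add_apply, Derivation.smul_apply, smul_eq_mul, mul_assoc _ (cst n (K.z i))]

theorem dMinus_apply (i : Fin n) (F : PowerSeries (MvPolynomial (Fin n) C)) : K.dMinus i F =
    du i F - cst n (half C) * PowerSeries.X * (cst n (K.z i) * K.dz i F) := by
  rw [dMinus, Derivation.sub_apply, Derivation.smul_apply, smul_eq_mul, mul_assoc _ (cst n (K.z i))]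

theorem cst_half : cst n (half C) + cst n (half C) = 1 := by
  rw [← map_add, half_add_half, map_one]

/-- `aᵢ` and `bᵢ` depend on `log zᵢ + uᵢħ/2` and `log zᵢ - uᵢħ/2` respectively. The derivations
`dPlus i` and `dMinus i` are adapted to these two combinations: each kills one of them and
multiplies the other by `±ħ`. -/
theorem dPlus_aMul (i j : Fin n) :
    K.dPlus i (K.aMul j) = if i = j then PowerSeries.X * K.aMul j else 0 := by
  rw [dPlus_apply, du_aMul, z_mul_dz_aMul]
  split_ifs
  · linear_combination (PowerSeries.X * K.aMul j) * cst_half (n := n) (C := C)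
  · simp

theorem dPlus_bMul (i j : Fin n) : K.dPlus i (K.bMul j) = 0 := by
  rw [dPlus_apply, du_bMul, z_mul_dz_bMul]
  split_ifs
  · ring
  · simp

theorem dMinus_aMul (i j : Fin n) : K.dMinus i (K.aMul j) = 0 := by
  rw [dMinus_apply, du_aMul, z_mul_dz_aMul]
  split_ifs
  · ring
  · simp

theorem dMinus_bMul (i j : Fin n) :
    K.dMinus i (K.bMul j) = if i = j then -(PowerSeries.X * K.bMul j) else 0 := by
  rw [dMinus_apply, du_bMul, z_mul_dz_bMul]
  split_ifs
  · linear_combination -(PowerSeries.X * K.bMul j) * cst_half (n := n) (C := C)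
  · simp

/-- In `strans_z_mul` the derivative of `e^Φ` contributes `∂_{uᵢ}Φ = (aᵢ + bᵢ)/2 - zᵢ`, whose last
term cancels the given `zᵢ`. -/
theorem z_mul_strans (i : Fin n) (G : PowerSeries (MvPolynomial (Fin n) C)) :
    PowerSeries.C (K.z i) * K.strans (K.expPhase * G) =
      K.strans (K.expPhase * (cst n (half C) * (K.aMul i + K.bMul i) * G + du i G)) := by
  rw [← strans_z_mul, Derivation.leibniz, du_expPhase, du_phase]
  refine congrArg K.strans ?_
  simp only [smul_eq_mul]
  ring

/-- This is `strans_euler` multiplied by `ħ/2`. The factor `ħ` lets `ħzᵢ∂ᵢΦ = aᵢ - bᵢ - ħuᵢzᵢ` be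
used, and the last term cancels the factor `uᵢzᵢ` of `strans_euler`. -/
theorem v_mul_strans (i : Fin n) (G : PowerSeries (MvPolynomial (Fin n) C)) :
    PowerSeries.C (half C) * (PowerSeries.C (K.v i) * PowerSeries.X) * K.strans (K.expPhase * G) =
      K.strans (K.expPhase * (cst n (half C) * ((K.aMul i - K.bMul i) * G + PowerSeries.X * G +
        PowerSeries.X * (cst n (K.z i) * K.dz i G)))) := by
  have h : PowerSeries.C (half C) * (PowerSeries.C (K.v i) * PowerSeries.X) *
      K.strans (K.expPhase * G) = PowerSeries.C (half C) * (PowerSeries.X *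
        (PowerSeries.C (K.v i) * K.strans (K.expPhase * G))) := by ring
  rw [h, ← strans_euler, ← strans_X_mul, half, ← strans_scalar_mul, Derivation.leibniz,
    dz_expPhase]
  refine congrArg K.strans ?_
  simp only [smul_eq_mul]
  linear_combination (cst n (algebraMap ℂ C (1 / 2)) * G * K.expPhase) * K.z_mul_dz_phase i

/-- The sum of the two preceding formulas: `(aᵢ + bᵢ)/2` and `(aᵢ - bᵢ)/2` add up to `aᵢ`, and the
derivative terms to `dPlus i`. Their difference gives the companion formula for `bᵢ`. -/
theorem aAdd_mul_strans (i : Fin n) (G : PowerSeries (MvPolynomial (Fin n) C)) :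
    K.aAdd i * K.strans (K.expPhase * G) = K.strans (K.expPhase *
      (K.aMul i * G + cst n (half C) * PowerSeries.X * G + K.dPlus i G)) := by
  rw [aAdd, add_mul, z_mul_strans, v_mul_strans, ← map_add, dPlus_apply]
  refine congrArg K.strans ?_
  linear_combination (K.expPhase * K.aMul i * G) * cst_half (n := n) (C := C)

theorem bAdd_mul_strans (i : Fin n) (G : PowerSeries (MvPolynomial (Fin n) C)) :
    K.bAdd i * K.strans (K.expPhase * G) = K.strans (K.expPhase *
      (K.bMul i * G - cst n (half C) * PowerSeries.X * G + K.dMinus i G)) := by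
  rw [bAdd, sub_mul, z_mul_strans, v_mul_strans, ← map_sub, dMinus_apply]
  refine congrArg K.strans ?_
  linear_combination (K.expPhase * K.bMul i * G) * cst_half (n := n) (C := C)

/-- The two corrections `±ħG/2` add up to `ħG`, so the eigenvalue `-ħ` is exactly what removes them.
-/
theorem aAdd_sub_bAdd_mul_strans (i j : Fin n) (G : PowerSeries (MvPolynomial (Fin n) C))
    (hG : K.dPlus i G - K.dMinus j G = -(PowerSeries.X * G)) :
    (K.aAdd i - K.bAdd j) * K.strans (K.expPhase * G) =
      K.strans (K.expPhase * ((K.aMul i - K.bMul j) * G)) := by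
  rw [sub_mul, aAdd_mul_strans, bAdd_mul_strans, ← map_sub]
  refine congrArg K.strans ?_
  linear_combination K.expPhase * hG + (K.expPhase * PowerSeries.X * G) * cst_half (n := n) (C := C)

theorem derivation_apply_inverse {R : Type*} [CommRing R] [Algebra ℂ R] (D : Derivation ℂ R R)
    {a b : R} (h : b * a = 1) : D b = -(b * b * D a) := by
  have h' := congrArg D h
  rw [Derivation.leibniz, Derivation.map_one_eq_zero, smul_eq_mul, smul_eq_mul] at h'
  linear_combination b * h' - (D b) * h

/-- The transformation of `∏ᵢ 1 / (aᵢ - b_{σ(i)})`. -/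
theorem prod_mul_strans (σ : Equiv.Perm (Fin n))
    (k : Fin n → PowerSeries (MvPolynomial (Fin n) C))
    (hk : ∀ i, k i * (K.aMul i - K.bMul (σ i)) = 1) :
    (∏ i, (K.aAdd i - K.bAdd (σ i))) * K.strans (K.expPhase * ∏ i, k i) =
      K.strans K.expPhase := by
  classical
  -- The factors are removed one at a time: the additive difference with index `i` cancels `k i`
  -- under the transformation.
  have key : ∀ s : Finset (Fin n), (∏ i ∈ s, (K.aAdd i - K.bAdd (σ i))) *
      K.strans (K.expPhase * ∏ i, k i) = K.strans (K.expPhase * ∏ i ∈ sᶜ, k i) := by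
    intro s
    induction s using Finset.induction_on with
    | empty => simp
    | insert i s hi ih =>
      have hc : sᶜ = insert i (insert i s)ᶜ := by
        ext x
        simp only [Finset.mem_compl, Finset.mem_insert]
        by_cases h : x = i
        · subst h; simp [hi]
        · simp [h]
      have hni : i ∉ (insert i s)ᶜ := by simp
      rw [Finset.prod_insert hi, mul_assoc, ih, hc, Finset.prod_insert hni]
      set P := ∏ x ∈ (insert i s)ᶜ, k x with hP
      set D : Derivation ℂ (PowerSeries (MvPolynomial (Fin n) C))
        (PowerSeries (MvPolynomial (Fin n) C)) := K.dPlus i - K.dMinus (σ i) with hD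
      -- `dPlus i` acts only on `aᵢ` and `dMinus (σ i)` only on `b_{σ(i)}`. By injectivity of `σ`
      -- neither of them occurs in another factor.
      have hDi : ∀ x, x ≠ i → D (k x) = 0 := by
        intro x hx
        rw [derivation_apply_inverse D (hk x), hD, Derivation.sub_apply, map_sub, map_sub,
          dPlus_aMul, dPlus_bMul, dMinus_aMul, dMinus_bMul, if_neg hx.symm,
          if_neg (fun h => hx (σ.injective h.symm))]
        simp
      -- `D` multiplies both `aᵢ` and `b_{σ(i)}` by `ħ`, hence the inverse of their difference by
      -- `-ħ`.
      have hDk : D (k i) = -(PowerSeries.X * k i) := by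
        rw [derivation_apply_inverse D (hk i), hD, Derivation.sub_apply, map_sub, map_sub,
          dPlus_aMul, dPlus_bMul, dMinus_aMul, dMinus_bMul, if_pos rfl, if_pos rfl]
        linear_combination -(PowerSeries.X * k i) * hk i
      have hDP : ∀ t : Finset (Fin n), i ∉ t → D (∏ x ∈ t, k x) = 0 := by
        intro t
        induction t using Finset.induction_on with
        | empty => intro _; simp
        | insert a t ha iht =>
          intro hit
          rw [Finset.prod_insert ha, Derivation.leibniz,
            hDi a (fun h => hit (h ▸ Finset.mem_insert_self _ _)),
            iht (fun h => hit (Finset.mem_insert_of_mem h)), smul_zero, smul_zero, add_zero]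
      rw [aAdd_sub_bAdd_mul_strans]
      · refine congrArg K.strans ?_
        linear_combination (K.expPhase * P) * hk i
      · change D (k i * P) = _
        rw [Derivation.leibniz, hDP _ hni, hDk, smul_eq_mul, smul_eq_mul]
        ring
  simpa using key Finset.univ

end Coords

/-! ### Homogeneity in `ħ`, and quotients with equal logarithmic derivatives. -/

section

variable {C : Type*} [CommRing C] [Algebra ℂ C]

theorem expOp_eq_opSer (c : ℂ) (N : Module.End ℂ C) (F : PowerSeries C) :
    expOp c N F = opSer (expSer c (1 : C)) N F := by
  rw [expOp, expSer, scaled, PowerSeries.rescale_one, RingHom.id_apply]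

theorem expOp_eq_self {N : Module.End ℂ C} {F : PowerSeries C}
    (h : ∀ k, N (PowerSeries.coeff k F) = 0) (c : ℂ) : expOp c N F = F := by
  ext k
  rw [coeff_expOp, Finset.sum_eq_single (0, k)]
  · simp
  · rintro ⟨a, b⟩ hab hne
    have hab' : a + b = k := mem_antidiagonal.mp hab
    rcases a with _ | a
    · exact absurd (by rw [show b = k by omega]) hne
    · simp only
      rw [pow_succ N, Module.End.mul_apply, h, map_zero, smul_zero]
  · intro h'; exact absurd (mem_antidiagonal.mpr (zero_add k)) h'

theorem S_mul_inv : S * S⁻¹ = 1 :=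
  PowerSeries.mul_inv_cancel _ (by
    rw [← PowerSeries.coeff_zero_eq_constantCoeff_apply]
    simp [S, -PowerSeries.coeff_zero_eq_constantCoeff])

/-- The derivation `D + ħ ∂_ħ` on power series in `ħ`. -/
def gradedDeriv (D : Derivation ℂ C C) : Derivation ℂ (PowerSeries C) (PowerSeries C) :=
  serDeriv Unit D +
    (PowerSeries.X : PowerSeries C) • (PowerSeries.derivative C).restrictScalars ℂ

theorem coeff_gradedDeriv (D : Derivation ℂ C C) (F : PowerSeries C) (k : ℕ) :
    PowerSeries.coeff k (gradedDeriv D F) =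
      D (PowerSeries.coeff k F) + (k : ℂ) • PowerSeries.coeff k F := by
  rw [gradedDeriv, Derivation.add_apply, map_add, coeff_serDeriv', Derivation.smul_apply,
    smul_eq_mul, Derivation.restrictScalars_apply]
  congr 1
  rcases k with _ | k
  · simp [PowerSeries.coeff_zero_X_mul, -PowerSeries.coeff_zero_eq_constantCoeff]
  · rw [PowerSeries.coeff_succ_X_mul, PowerSeries.coeff_derivative, Nat.cast_smul_eq_nsmul,
      nsmul_eq_mul, mul_comm]
    push_cast
    rfl

theorem gradedDeriv_C (D : Derivation ℂ C C) (x : C) :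
    gradedDeriv D (PowerSeries.C x : PowerSeries C) = (PowerSeries.C (D x) : PowerSeries C) := by
  simp [gradedDeriv, serDeriv_C, PowerSeries.derivative_C]

theorem gradedDeriv_X (D : Derivation ℂ C C) :
    gradedDeriv D (PowerSeries.X : PowerSeries C) = PowerSeries.X := by
  simp [gradedDeriv, serDeriv_X]

theorem gradedDeriv_sexp (D : Derivation ℂ C C) {F : PowerSeries C}
    (hF : PowerSeries.constantCoeff F = 0) :
    gradedDeriv D (sexp F) = sexp F * gradedDeriv D F := by
  refine derivation_sexp (τ := Unit) _
    (fun e => D.toLinearMap + ((e () : ℕ) : ℂ) • LinearMap.id) (fun G e => ?_) hF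
  have he : e = Finsupp.single () (e ()) := by ext; simp
  have h := coeff_gradedDeriv D G (e ())
  rw [PowerSeries.coeff, ← he] at h
  exact h

/-- If `N` has degree `-1`, then `ħN` has degree zero, and its exponential commutes with the degree
operator. -/
theorem gradedDeriv_expOp {D : Derivation ℂ C C} {N : Module.End ℂ C}
    (h : ∀ x, D (N x) = N (D x) - N x) (c : ℂ) (F : PowerSeries C) :
    gradedDeriv D (expOp c N F) = expOp c N (gradedDeriv D F) := by
  have hp : ∀ (a : ℕ) x, D ((N ^ a) x) = (N ^ a) (D x) - (a : ℂ) • (N ^ a) x := by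
    intro a
    induction a with
    | zero => intro x; simp
    | succ a ih =>
      intro x
      rw [pow_succ', Module.End.mul_apply, h, ih, map_sub, map_smul, Module.End.mul_apply]
      push_cast
      module
  ext k
  rw [coeff_gradedDeriv, coeff_expOp, coeff_expOp, map_sum, Finset.smul_sum,
    ← Finset.sum_add_distrib]
  refine Finset.sum_congr rfl fun p hpk => ?_
  have hk : p.1 + p.2 = k := mem_antidiagonal.mp hpk
  rw [D.map_smul, hp, coeff_gradedDeriv, map_add, map_smul, ← hk]
  push_cast
  module

/-- `f(aħ N) w` for the exponential and `N w` a coordinate derivation: the inverse of `z + c a ħ`. -/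
theorem opSer_expSer_mul {D : Derivation ℂ C C} {z w a : C} (hz : z * w = 1)
    (hw : D w = -(w * w)) (c : ℂ) :
    opSer (expSer c a) D.toLinearMap (PowerSeries.C w) *
      (PowerSeries.C z + PowerSeries.C (algebraMap ℂ C c) * (PowerSeries.C a * PowerSeries.X)) =
        1 := by
  -- With `D^k(1/z) = (-1)^k k! z^{-k-1}` the factorials cancel, and the shifted `1/z` is the
  -- geometric series of `1/(z + caħ)`.
  have hp : ∀ k : ℕ, (D.toLinearMap ^ k) w = ((-1 : ℂ) ^ k * (k ! : ℂ)) • w ^ (k + 1) := by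
    intro k
    induction k with
    | zero => simp
    | succ k ih =>
      rw [pow_succ', Module.End.mul_apply, ih, map_smul]
      change _ • D (w ^ (k + 1)) = _
      rw [Derivation.leibniz_pow, hw, Nat.add_sub_cancel, smul_eq_mul,
        ← Nat.cast_smul_eq_nsmul ℂ, smul_smul, Nat.factorial_succ, pow_succ (-1 : ℂ)]
      have : w ^ k * -(w * w) = (-1 : ℂ) • w ^ (k + 1 + 1) := by
        rw [neg_one_smul]; ring
      rw [this, smul_smul]
      congr 1
      push_cast
      ring
  have hq : ∀ k : ℕ, PowerSeries.coeff k (opSer (expSer c a) D.toLinearMap (PowerSeries.C w)) =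
      (-(algebraMap ℂ C c * a)) ^ k * w ^ (k + 1) := by
    intro k
    rw [coeff_opSer_C, coeff_expSer, hp, smul_mul_smul_comm]
    have h3 : ((k ! : ℕ) : ℂ) ≠ 0 := by exact_mod_cast k.factorial_ne_zero
    have : c ^ k * ((k ! : ℂ))⁻¹ * ((-1) ^ k * (k ! : ℂ)) = (-c) ^ k := by
      rw [neg_pow c]; field_simp
    rw [this, Algebra.smul_def, map_pow, map_neg]
    ring
  ext k
  rw [mul_add, map_add, PowerSeries.coeff_mul_C, hq]
  rcases k with _ | k
  · rw [← mul_assoc, ← mul_assoc, PowerSeries.coeff_zero_mul_X, PowerSeries.coeff_one, if_pos rfl]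
    linear_combination hz
  · rw [← mul_assoc, ← mul_assoc, PowerSeries.coeff_succ_mul_X, PowerSeries.coeff_mul_C,
      PowerSeries.coeff_mul_C, hq, PowerSeries.coeff_one, if_neg (Nat.succ_ne_zero k)]
    linear_combination ((-(algebraMap ℂ C c * a)) ^ (k + 1) * w ^ (k + 1)) * hz

/-- Both `a` and `b` have logarithmic derivative `α`, so their quotient `a b'` is a constant for
`D`. -/
theorem derivation_mul_inverse_eq_zero {R : Type*} [CommRing R] [Algebra ℂ R]
    (D : Derivation ℂ R R) {a b b' α : R} (ha : D a = α * a) (hb : D b = α * b)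
    (h : b' * b = 1) : D (a * b') = 0 := by
  rw [Derivation.leibniz, Coords.derivation_apply_inverse D h, ha, hb, smul_eq_mul, smul_eq_mul]
  linear_combination (-(a * b' * α)) * h

end

/-! ### The factor `R` and the evaluation of `T(e^Φ)`. -/

namespace Coords

variable {n : ℕ} {C : Type*} [CommRing C] [Algebra ℂ C] (K : Coords n C)

/-- The series `S(v t) / S(t)`. -/
def ratioS (a : C) : PowerSeries C := scaled S a * scaled S⁻¹ 1

/-- `v (S(v ħ ∂) / S(ħ ∂) - 1) log z`. -/
def logRatio (i : Fin n) : PowerSeries C := PowerSeries.mk fun k =>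
  -- The order zero cancels against `-1`, so only the derivatives `∂^k log z = ∂^{k-1}(1/z)` occur
  -- and `C` need not contain a logarithm.
  if k = 0 then 0 else
    K.v i * PowerSeries.coeff k (ratioS (K.v i)) * ((K.d i).toLinearMap ^ (k - 1)) (K.w i)

theorem coeff_logRatio_zero (i : Fin n) : PowerSeries.coeff 0 (K.logRatio i) = 0 := by
  rw [logRatio, PowerSeries.coeff_mk, if_pos rfl]

theorem coeff_logRatio_succ (i : Fin n) (k : ℕ) : PowerSeries.coeff (k + 1) (K.logRatio i) =
    K.v i * PowerSeries.coeff (k + 1) (ratioS (K.v i)) *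
      ((K.d i).toLinearMap ^ k) (K.w i) := by
  rw [logRatio, PowerSeries.coeff_mk, if_neg (Nat.succ_ne_zero k), Nat.add_sub_cancel]

theorem coeff_zero_ratioS (a : C) : PowerSeries.coeff 0 (ratioS a) = 1 := by
  have h : PowerSeries.constantCoeff S = 1 := by
    rw [← PowerSeries.coeff_zero_eq_constantCoeff_apply]
    simp [S, -PowerSeries.coeff_zero_eq_constantCoeff]
  rw [PowerSeries.coeff_zero_eq_constantCoeff_apply, ratioS, map_mul, constantCoeff_scaled_S,
    ← PowerSeries.coeff_zero_eq_constantCoeff_apply, coeff_scaled]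
  simp [h]

theorem deriv_ratioS (i : Fin n) {a : C} (h : K.d i a = 0) (k : ℕ) :
    K.d i (PowerSeries.coeff k (ratioS a)) = 0 := by
  have h' : serDeriv Unit (K.d i) (ratioS a) = 0 := by
    rw [ratioS, Derivation.leibniz, serDeriv_scaled h, serDeriv_scaled (by simp)]
    simp
  have := congrArg (PowerSeries.coeff k) h'
  rwa [coeff_serDeriv', map_zero] at this

theorem d_pow_w {i j : Fin n} (h : i ≠ j) (k : ℕ) :
    K.d i (((K.d j).toLinearMap ^ k) (K.w j)) = 0 := by
  induction k with
  | zero => simpa [K.d_w] using fun h' => absurd h' h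
  | succ k ih =>
    rw [pow_succ', Module.End.mul_apply]
    change K.d i (K.d j _) = 0
    rw [K.d_comm, ih, map_zero]

/-- The logarithmic derivative `v S(v ħ ∂) / S(ħ ∂) (1 / z)`. -/
def logDeriv (i : Fin n) : PowerSeries C :=
  opSer (PowerSeries.C (K.v i) * ratioS (K.v i)) (K.d i).toLinearMap (PowerSeries.C (K.w i))

theorem d_logRatio_self (i : Fin n) : serDeriv Unit (K.d i) (K.logRatio i) =
    K.logDeriv i - PowerSeries.C (K.v i * K.w i) := by
  ext k
  rw [coeff_serDeriv', map_sub, logDeriv, coeff_opSer_C, PowerSeries.coeff_C_mul,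
    PowerSeries.coeff_C]
  rcases k with _ | k
  · rw [coeff_logRatio_zero, coeff_zero_ratioS]; simp
  · rw [coeff_logRatio_succ, Derivation.leibniz, Derivation.leibniz, K.d_v,
      K.deriv_ratioS i (K.d_v i i), if_neg (Nat.succ_ne_zero k), pow_succ' (K.d i).toLinearMap,
      Module.End.mul_apply]
    simp

theorem d_logRatio_of_ne {i j : Fin n} (h : i ≠ j) :
    serDeriv Unit (K.d i) (K.logRatio j) = 0 := by
  ext k
  rw [coeff_serDeriv', map_zero]
  rcases k with _ | k
  · rw [coeff_logRatio_zero, map_zero]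
  · rw [coeff_logRatio_succ, Derivation.leibniz, Derivation.leibniz, K.d_v,
      K.deriv_ratioS i (K.d_v i j), K.d_pow_w h]
    simp

/-- `∏ e^{vᵢ (S(vᵢ ħ ∂) / S(ħ ∂) - 1) log zᵢ}`. -/
def expRatio : PowerSeries C := sexp (∑ i, K.logRatio i)

theorem constantCoeff_logRatio (i : Fin n) : PowerSeries.constantCoeff (K.logRatio i) = 0 := by
  rw [← PowerSeries.coeff_zero_eq_constantCoeff_apply, coeff_logRatio_zero]

theorem constantCoeff_sum_logRatio : PowerSeries.constantCoeff (∑ i, K.logRatio i) = 0 := by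
  simp [constantCoeff_logRatio]

theorem coeff_zero_expRatio : PowerSeries.coeff 0 K.expRatio = 1 := by
  rw [PowerSeries.coeff_zero_eq_constantCoeff_apply]
  exact constantCoeff_sexp K.constantCoeff_sum_logRatio

/-- Formally, `∏ zⱼ^{vⱼ}` times `expRatio` has logarithmic derivative `logDeriv`. The subtracted
`vᵢ/zᵢ` is the share of `zᵢ^{vᵢ}`, a function that need not exist in `C`; the potential in `conabla`
takes its place. -/
theorem d_expRatio (i : Fin n) : serDeriv Unit (K.d i) K.expRatio =
    (K.logDeriv i - PowerSeries.C (K.v i * K.w i)) * K.expRatio := by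
  have h : ∑ j, serDeriv Unit (K.d i) (K.logRatio j) = serDeriv Unit (K.d i) (K.logRatio i) :=
    Finset.sum_eq_single i (fun j _ hj => K.d_logRatio_of_ne hj.symm) (by simp)
  rw [expRatio, derivation_sexp _ (fun _ => (K.d i).toLinearMap) (fun _ _ => rfl)
    K.constantCoeff_sum_logRatio, map_sum, h, d_logRatio_self, mul_comm]

theorem euler_w (i : Fin n) : K.euler (K.w i) = - K.w i := by
  rw [euler_apply, Finset.sum_eq_single i]
  · rw [d_w, if_pos rfl]; linear_combination -(K.w i) * K.z_mul_w i
  · intro j _ hj; rw [d_w, if_neg hj, mul_zero]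
  · simp

theorem euler_v (i : Fin n) : K.euler (K.v i) = 0 := by simp [euler_apply, K.d_v]

theorem euler_z (i : Fin n) : K.euler (K.z i) = K.z i := by simp [euler_apply, K.d_z]

theorem euler_d (i : Fin n) (x : C) : K.euler (K.d i x) = K.d i (K.euler x) - K.d i x := by
  simp only [euler_apply, map_sum, Derivation.leibniz, K.d_z, smul_eq_mul, K.d_comm i]
  rw [Finset.sum_add_distrib]
  simp

/-- At order `ħ^{k+1}` the coefficient is a multiple of `∂^k(1/z)`, of degree `-(k+1)` in `z`, by a
factor of degree zero. -/
theorem graded_logRatio (i : Fin n) : gradedDeriv K.euler (K.logRatio i) = 0 := by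
  have hr : ∀ k, K.euler (PowerSeries.coeff k (ratioS (K.v i))) = 0 := fun k => by
    rw [euler_apply]
    exact Finset.sum_eq_zero fun j _ => by rw [K.deriv_ratioS j (K.d_v j i), mul_zero]
  have hw : ∀ k : ℕ, K.euler (((K.d i).toLinearMap ^ k) (K.w i)) =
      -(((k : ℂ) + 1) • ((K.d i).toLinearMap ^ k) (K.w i)) := by
    intro k
    induction k with
    | zero => simp [euler_w]
    | succ k ih =>
      rw [pow_succ', Module.End.mul_apply]
      change K.euler (K.d i _) = -(_ • K.d i _)
      rw [euler_d, ih, map_neg, Derivation.map_smul]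
      push_cast
      module
  ext k
  rw [coeff_gradedDeriv, map_zero]
  rcases k with _ | k
  · rw [coeff_logRatio_zero, map_zero, smul_zero, add_zero]
  · rw [coeff_logRatio_succ, Derivation.leibniz, Derivation.leibniz, hr, euler_v, hw, smul_zero,
      smul_zero, add_zero, smul_zero, add_zero, smul_eq_mul, mul_neg, mul_smul_comm]
    push_cast
    module

theorem graded_expRatio : gradedDeriv K.euler K.expRatio = 0 := by
  rw [expRatio, gradedDeriv_sexp _ K.constantCoeff_sum_logRatio, map_sum]
  simp [graded_logRatio]

/-- The operator `∂ᵢ + vᵢ / zᵢ`. -/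
def conabla (i : Fin n) : Module.End ℂ C :=
  LinearMap.mulLeft ℂ (K.v i * K.w i) + (K.d i).toLinearMap

theorem conabla_apply (i : Fin n) (x : C) : K.conabla i x = K.v i * K.w i * x + K.d i x := rfl

/-- `e^{cħ(∂ᵢ + vᵢ / zᵢ)}` applied to `expRatio`. -/
def shiftRatio (c : ℂ) (i : Fin n) : PowerSeries C := expOp c (K.conabla i) K.expRatio

theorem expOp_conabla_mul (c : ℂ) (i : Fin n) (F G : PowerSeries C) :
    expOp c (K.conabla i) (F * G) =
      expOp c (K.d i).toLinearMap F * expOp c (K.conabla i) G :=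
  expOp_mul (fun x y => by
    rw [conabla_apply, conabla_apply, Derivation.leibniz]
    simp only [smul_eq_mul, Derivation.coeFn_coe]
    ring) c F G

/-- The operator `conabla i` commutes with its own exponential and sends `expRatio` to `logDeriv i *
expRatio`. On the first factor of this product the exponential acts as the ordinary shift. -/
theorem d_shiftRatio_self (c : ℂ) (i : Fin n) : serDeriv Unit (K.d i) (K.shiftRatio c i) =
    (expOp c (K.d i).toLinearMap (K.logDeriv i) - PowerSeries.C (K.v i * K.w i)) *
      K.shiftRatio c i := by
  have hF : ∀ F : PowerSeries C, serMap (K.conabla i) F =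
      PowerSeries.C (K.v i * K.w i) * F + serDeriv Unit (K.d i) F := by
    intro F; ext k
    rw [coeff_serMap, map_add, PowerSeries.coeff_C_mul]; rfl
  have h := expOp_serMap (Commute.refl (K.conabla i)) c K.expRatio
  have h2 : PowerSeries.C (K.v i * K.w i) * K.expRatio +
      (K.logDeriv i - PowerSeries.C (K.v i * K.w i)) * K.expRatio =
        K.logDeriv i * K.expRatio := by ring
  rw [hF, hF, d_expRatio, h2, expOp_conabla_mul] at h
  rw [shiftRatio]
  linear_combination h

/-- The logarithmic derivative with respect to `zⱼ` involves `zⱼ` alone, so a shift of `zᵢ` leaves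
it unchanged. -/
theorem d_shiftRatio_of_ne (c : ℂ) {i j : Fin n} (h : j ≠ i) :
    serDeriv Unit (K.d j) (K.shiftRatio c i) =
      (K.logDeriv j - PowerSeries.C (K.v j * K.w j)) * K.shiftRatio c i := by
  have hcomm : Commute (K.d j).toLinearMap (K.conabla i) := by
    refine LinearMap.ext fun x => ?_
    simp only [Module.End.mul_apply, conabla_apply,
      Derivation.coeFn_coe, map_add, Derivation.leibniz, K.d_v, K.d_w, if_neg h, smul_eq_mul,
      K.d_comm j i]
    ring
  have h1 := expOp_serMap hcomm c K.expRatio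
  have h2 : serMap (K.d j).toLinearMap K.expRatio =
      serDeriv Unit (K.d j) (K.logRatio j) * K.expRatio := by
    rw [d_logRatio_self, ← d_expRatio]; ext k; rw [coeff_serMap]; rfl
  have h3 : expOp c (K.d i).toLinearMap (serDeriv Unit (K.d j) (K.logRatio j)) =
      serDeriv Unit (K.d j) (K.logRatio j) := by
    refine expOp_eq_self (fun k => ?_) c
    change K.d i (K.d j (PowerSeries.coeff k (K.logRatio j))) = 0
    have := congrArg (PowerSeries.coeff k) (K.d_logRatio_of_ne h.symm)
    rw [coeff_serDeriv', map_zero] at this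
    rw [K.d_comm, this, map_zero]
  rw [h2, expOp_conabla_mul, h3, d_logRatio_self] at h1
  rw [shiftRatio, ← h1]
  ext k; rw [coeff_serMap]; rfl

theorem euler_conabla (i : Fin n) (x : C) :
    K.euler (K.conabla i x) = K.conabla i (K.euler x) - K.conabla i x := by
  rw [conabla_apply, conabla_apply, map_add, Derivation.leibniz, Derivation.leibniz, euler_w,
    euler_v, euler_d]
  simp only [smul_eq_mul]
  ring

theorem graded_shiftRatio (c : ℂ) (i : Fin n) :
    gradedDeriv K.euler (K.shiftRatio c i) = 0 := by
  rw [shiftRatio, gradedDeriv_expOp (K.euler_conabla i), graded_expRatio]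
  ext k; rw [coeff_expOp]; simp

/-- A homogeneous series of degree zero annihilated by all derivations is constant. -/
theorem eq_C_of_derivations_eq_zero {F : PowerSeries C}
    (hd : ∀ i, serDeriv Unit (K.d i) F = 0) (he : gradedDeriv K.euler F = 0) :
    F = PowerSeries.C (PowerSeries.coeff 0 F) := by
  ext k
  rw [PowerSeries.coeff_C]
  split_ifs with hk
  · rw [hk]
  · have h := congrArg (PowerSeries.coeff k) he
    have hz : K.euler (PowerSeries.coeff k F) = 0 := by
      rw [euler_apply]
      refine Finset.sum_eq_zero fun i _ => ?_
      have := congrArg (PowerSeries.coeff k) (hd i)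
      rw [coeff_serDeriv', map_zero] at this
      rw [this, mul_zero]
    rw [coeff_gradedDeriv, hz, zero_add, map_zero] at h
    have hk' : (k : ℂ) ≠ 0 := by exact_mod_cast hk
    have := congrArg ((k : ℂ)⁻¹ • ·) h
    simpa [smul_smul, hk'] using this

theorem exists_inverse_aAdd (i : Fin n) :
    opSer (expSer (1 / 2) (K.v i)) (K.d i).toLinearMap (PowerSeries.C (K.w i)) * K.aAdd i = 1 :=
  opSer_expSer_mul (K.z_mul_w i) (by rw [d_w, if_pos rfl]) _

theorem exists_inverse_bAdd (i : Fin n) :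
    opSer (expSer (-(1 / 2)) (K.v i)) (K.d i).toLinearMap (PowerSeries.C (K.w i)) * K.bAdd i =
      1 := by
  have := opSer_expSer_mul (a := K.v i) (K.z_mul_w i)
    (by rw [d_w, if_pos rfl] : K.d i (K.w i) = _) (-(1 / 2))
  rw [map_neg, map_neg, neg_mul, ← sub_eq_add_neg] at this
  exact this

/-- A computation with symbols: `ħ∂ S(ħ∂) · v S(vħ∂)/S(ħ∂) = vħ∂ S(vħ∂)`. Here `t S(t) = e^{t/2} -
e^{-t/2}` is used once for `t = ħ∂` and once for `t = vħ∂`. -/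
theorem expOp_logDeriv_sub (i : Fin n) :
    expOp (1 / 2) (K.d i).toLinearMap (K.logDeriv i) -
      expOp (-(1 / 2)) (K.d i).toLinearMap (K.logDeriv i) =
    opSer (expSer (1 / 2) (K.v i)) (K.d i).toLinearMap (PowerSeries.C (K.w i)) -
      opSer (expSer (-(1 / 2)) (K.v i)) (K.d i).toLinearMap (PowerSeries.C (K.w i)) := by
  rw [expOp_eq_opSer, expOp_eq_opSer, ← opSer_sub_left, ← opSer_sub_left, ← X_mul_scaled_S,
    ← X_mul_scaled_S, logDeriv, opSer_comp]
  · congr 1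
    have h : scaled S (1 : C) * scaled S⁻¹ 1 = 1 := by rw [← scaled_mul, S_mul_inv, scaled_one]
    rw [ratioS, map_one]
    linear_combination (PowerSeries.C (K.v i) * PowerSeries.X * scaled S (K.v i)) * h
  · intro k x
    rw [PowerSeries.coeff_C_mul]
    simp only [Derivation.coeFn_coe, Derivation.leibniz, K.d_v,
      K.deriv_ratioS i (K.d_v i i), smul_eq_mul]
    ring

theorem d_aAdd (i j : Fin n) : serDeriv Unit (K.d j) (K.aAdd i) = if j = i then 1 else 0 := by
  rw [aAdd, map_add, Derivation.leibniz, Derivation.leibniz, serDeriv_C, serDeriv_C, serDeriv_C,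
    serDeriv_X, K.d_z, K.d_v, half, Derivation.map_algebraMap]
  split_ifs <;> simp

theorem d_bAdd (i j : Fin n) : serDeriv Unit (K.d j) (K.bAdd i) = if j = i then 1 else 0 := by
  rw [bAdd, map_sub, Derivation.leibniz, Derivation.leibniz, serDeriv_C, serDeriv_C, serDeriv_C,
    serDeriv_X, K.d_z, K.d_v, half, Derivation.map_algebraMap]
  split_ifs <;> simp

theorem graded_aAdd (i : Fin n) : gradedDeriv K.euler (K.aAdd i) = K.aAdd i := by
  rw [aAdd, map_add, Derivation.leibniz, Derivation.leibniz, gradedDeriv_C, gradedDeriv_C,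
    gradedDeriv_C, gradedDeriv_X, euler_z, euler_v, half, Derivation.map_algebraMap]
  simp

theorem graded_bAdd (i : Fin n) : gradedDeriv K.euler (K.bAdd i) = K.bAdd i := by
  rw [bAdd, map_sub, Derivation.leibniz, Derivation.leibniz, gradedDeriv_C, gradedDeriv_C,
    gradedDeriv_C, gradedDeriv_X, euler_z, euler_v, half, Derivation.map_algebraMap]
  simp

/-- Formally, `z^v R = e^{v S(vħ∂)/S(ħ∂) log z}`, and the quotient of its values at `z ± ħ/2` is
`e^{(e^{vħ∂/2} - e^{-vħ∂/2}) log z} = (z + vħ/2)/(z - vħ/2)`. Without a logarithm the quotient of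
the two sides is characterized instead: it has no derivatives, degree zero and leading coefficient
`1`. -/
theorem bAdd_mul_shiftRatio (i : Fin n) :
    K.bAdd i * K.shiftRatio (1 / 2) i = K.aAdd i * K.shiftRatio (-(1 / 2)) i := by
  have hu : IsUnit (K.shiftRatio (-(1 / 2)) i) := by
    rw [PowerSeries.isUnit_iff_constantCoeff, ← PowerSeries.coeff_zero_eq_constantCoeff_apply,
      shiftRatio, coeff_zero_expOp, coeff_zero_expRatio]
    exact isUnit_one
  obtain ⟨y, hy⟩ := hu.exists_left_inv
  have ha := K.exists_inverse_aAdd i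
  have hb := K.exists_inverse_bAdd i
  have hs := K.expOp_logDeriv_sub i
  set qa := opSer (expSer (1 / 2) (K.v i)) (K.d i).toLinearMap (PowerSeries.C (K.w i))
  set qb := opSer (expSer (-(1 / 2)) (K.v i)) (K.d i).toLinearMap (PowerSeries.C (K.w i))
  set yp := K.shiftRatio (1 / 2) i with hyp
  set ym := K.shiftRatio (-(1 / 2)) i with hym
  have hinv : (qa * y) * (K.aAdd i * ym) = 1 := by linear_combination y * ym * ha + hy
  have hD : ∀ j, serDeriv Unit (K.d j) ((K.bAdd i * yp) * (qa * y)) = 0 := by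
    intro j
    by_cases h : j = i
    · subst h
      refine derivation_mul_inverse_eq_zero _ (α := qb +
        expOp (1 / 2) (K.d j).toLinearMap (K.logDeriv j) - PowerSeries.C (K.v j * K.w j))
        ?_ ?_ hinv
      · rw [Derivation.leibniz, d_bAdd, if_pos rfl, hyp, d_shiftRatio_self, smul_eq_mul,
          smul_eq_mul, ← hyp]
        linear_combination (-yp) * hb
      · rw [Derivation.leibniz, d_aAdd, if_pos rfl, hym, d_shiftRatio_self, smul_eq_mul,
          smul_eq_mul, ← hym]
        linear_combination (-ym) * ha - (K.aAdd j * ym) * hs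
    · refine derivation_mul_inverse_eq_zero _
        (α := K.logDeriv j - PowerSeries.C (K.v j * K.w j)) ?_ ?_ hinv
      · rw [Derivation.leibniz, d_bAdd, if_neg h, hyp, d_shiftRatio_of_ne _ _ h, smul_eq_mul,
          smul_eq_mul, ← hyp]
        ring
      · rw [Derivation.leibniz, d_aAdd, if_neg h, hym, d_shiftRatio_of_ne _ _ h, smul_eq_mul,
          smul_eq_mul, ← hym]
        ring
  have hE : gradedDeriv K.euler ((K.bAdd i * yp) * (qa * y)) = 0 := by
    refine derivation_mul_inverse_eq_zero _ (α := 1) ?_ ?_ hinv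
    · rw [Derivation.leibniz, graded_bAdd, hyp, graded_shiftRatio]; simp [mul_comm]
    · rw [Derivation.leibniz, graded_aAdd, hym, graded_shiftRatio]; simp [mul_comm]
  have hC := K.eq_C_of_derivations_eq_zero hD hE
  have h0 : PowerSeries.coeff 0 ((K.bAdd i * yp) * (qa * y)) = 1 := by
    have h1 : PowerSeries.coeff 0 (K.bAdd i * yp) = PowerSeries.coeff 0 (K.aAdd i * ym) := by
      have hp1 : PowerSeries.constantCoeff yp = 1 := by
        rw [← PowerSeries.coeff_zero_eq_constantCoeff_apply, hyp, shiftRatio, coeff_zero_expOp,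
          coeff_zero_expRatio]
      have hm1 : PowerSeries.constantCoeff ym = 1 := by
        rw [← PowerSeries.coeff_zero_eq_constantCoeff_apply, hym, shiftRatio, coeff_zero_expOp,
          coeff_zero_expRatio]
      simp [aAdd, bAdd, hp1, hm1]
    rw [PowerSeries.coeff_zero_eq_constantCoeff_apply] at h1 ⊢
    rw [PowerSeries.coeff_zero_eq_constantCoeff_apply] at h1
    rw [map_mul PowerSeries.constantCoeff, h1, ← map_mul, mul_comm, hinv, map_one]
  rw [h0, map_one] at hC
  linear_combination (K.aAdd i * ym) * hC - (K.bAdd i * yp) * hinv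

/-- `∇ᵢ` after the transformation is multiplication by `uᵢ` before it. -/
theorem expOp_strans (c : ℂ) (i : Fin n) (F : PowerSeries (MvPolynomial (Fin n) C)) :
    expOp c (K.nabla i) (K.strans F) = K.strans (F * expU C c i) := by
  have hp : ∀ (a : ℕ) (p : MvPolynomial (Fin n) C),
      (K.nabla i ^ a) (K.trans p) = K.trans (p * MvPolynomial.X i ^ a) := by
    intro a
    induction a with
    | zero => intro p; simp
    | succ a ih =>
      intro p
      rw [pow_succ, Module.End.mul_apply, ← trans_mul_X, ih, pow_succ']
      congr 1; ring
  ext k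
  rw [mul_comm, strans, coeff_expOp, coeff_serMap, PowerSeries.coeff_mul, map_sum]
  refine Finset.sum_congr rfl fun p _ => ?_
  rw [coeff_serMap, hp, expU, coeff_expSer, smul_mul_assoc, map_smul,
    mul_comm (PowerSeries.coeff p.2 F)]

/-- Take `G = e^{-uᵢħ/2}` in `aAdd_mul_strans`: `aᵢG = zᵢ`, and `∂_{uᵢ}G` cancels `ħG/2`. With `bᵢ`
and `e^{uᵢħ/2}` the same right side appears, and this ties the two shifts of `T(e^Φ)` together. -/
theorem aAdd_mul_expOp (i : Fin n) : K.aAdd i * expOp (-(1 / 2)) (K.nabla i)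
    (K.strans K.expPhase) = K.strans (K.expPhase * cst n (K.z i)) := by
  rw [expOp_strans, aAdd_mul_strans, dPlus_apply, du_expU, if_pos rfl, dz_expU,
    cst_scalar_neg_half, aMul]
  refine congrArg K.strans ?_
  have h := expSer_mul_expSer_neg (1 / 2) (MvPolynomial.X i : MvPolynomial (Fin n) C)
  simp only [expU]
  linear_combination (K.expPhase * cst n (K.z i)) * h

theorem bAdd_mul_expOp (i : Fin n) : K.bAdd i * expOp (1 / 2) (K.nabla i)
    (K.strans K.expPhase) = K.strans (K.expPhase * cst n (K.z i)) := by
  rw [expOp_strans, bAdd_mul_strans, dMinus_apply, du_expU, if_pos rfl, dz_expU, bMul]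
  refine congrArg K.strans ?_
  have h := expSer_mul_expSer_neg (1 / 2) (MvPolynomial.X i : MvPolynomial (Fin n) C)
  simp only [expU, half]
  linear_combination (K.expPhase * cst n (K.z i)) * h

/-- The potentials `-vᵢ/zᵢ` and `vᵢ/zᵢ` on the two factors cancel in the Leibniz rule for their
product. -/
theorem expOp_d_mul (c : ℂ) (i : Fin n) (F G : PowerSeries C) :
    expOp c (K.d i).toLinearMap (F * G) =
      expOp (-c) (K.nabla i) F * expOp c (K.conabla i) G := by
  rw [← expOp_neg]
  refine expOp_mul (fun x y => ?_) c F G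
  rw [conabla_apply, LinearMap.neg_apply, nabla_apply]
  simp only [Derivation.coeFn_coe, Derivation.leibniz, smul_eq_mul]
  ring

/-- With `u` of degree `-1` and `z`, `ħ` of degree `1`, both `uz` and `uħ` have degree zero. -/
theorem graded_expPhase : gradedDeriv K.eulerPoly K.expPhase = 0 := by
  suffices h : gradedDeriv K.eulerPoly K.phase = 0 by
    rw [expPhase, gradedDeriv_sexp _ K.constantCoeff_phase, h, mul_zero]
  rw [phase, map_sum]
  refine Finset.sum_eq_zero fun i _ => ?_
  have hS : gradedDeriv K.eulerPoly (scaled S (MvPolynomial.X i)) = 0 := by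
    ext1 k
    rw [coeff_gradedDeriv, coeff_scaled, Derivation.leibniz, Derivation.leibniz_pow,
      eulerPoly_X, Derivation.map_algebraMap, map_zero]
    rcases k with _ | k
    · simp
    · rw [Nat.add_sub_cancel, Nat.cast_smul_eq_nsmul]
      simp only [smul_eq_mul, nsmul_eq_mul]
      ring
  rw [Derivation.leibniz, Derivation.leibniz, map_sub, hS, Derivation.map_one_eq_zero, uVar, cst,
    RingHom.comp_apply, gradedDeriv_C, gradedDeriv_C, eulerPoly_X, eulerPoly_C, euler_z]
  simp only [smul_eq_mul, map_neg]
  ring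

theorem graded_strans (F : PowerSeries (MvPolynomial (Fin n) C)) :
    gradedDeriv K.euler (K.strans F) = K.strans (gradedDeriv K.eulerPoly F) := by
  ext k
  rw [coeff_gradedDeriv, strans, coeff_serMap, coeff_serMap, coeff_gradedDeriv, map_add, map_smul,
    euler_trans]

/-- The transformation of `∏ e^{uᵢ (S(uᵢħ) - 1) zᵢ}`. -/
theorem strans_expPhase_mul_expRatio : K.strans K.expPhase * K.expRatio = 1 := by
  have hd : ∀ i, serDeriv Unit (K.d i) (K.strans K.expPhase * K.expRatio) = 0 := by
    intro i
    -- A series in `ħ` whose shifts by `ħ/2` and `-ħ/2` in `zᵢ` coincide is independent of `zᵢ`.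
    have h : expOp (1 / 2) (K.d i).toLinearMap (K.strans K.expPhase * K.expRatio) =
        expOp (-(1 / 2)) (K.d i).toLinearMap (K.strans K.expPhase * K.expRatio) := by
      have h1 := K.expOp_d_mul (1 / 2) i (K.strans K.expPhase) K.expRatio
      have h2 := K.expOp_d_mul (-(1 / 2)) i (K.strans K.expPhase) K.expRatio
      rw [neg_neg] at h2
      rw [h1, h2]
      have ha := K.exists_inverse_aAdd i
      have hb := K.exists_inverse_bAdd i
      have e1 := K.aAdd_mul_expOp i
      rw [← bAdd_mul_expOp] at e1
      have e2 := K.bAdd_mul_shiftRatio i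
      rw [shiftRatio, shiftRatio] at e2
      set qa := opSer (expSer (1 / 2) (K.v i)) (K.d i).toLinearMap (PowerSeries.C (K.w i))
      set qb := opSer (expSer (-(1 / 2)) (K.v i)) (K.d i).toLinearMap (PowerSeries.C (K.w i))
      set m1 := expOp (-(1 / 2)) (K.nabla i) (K.strans K.expPhase)
      set m2 := expOp (1 / 2) (K.nabla i) (K.strans K.expPhase)
      set y1 := expOp (1 / 2) (K.conabla i) K.expRatio
      set y2 := expOp (-(1 / 2)) (K.conabla i) K.expRatio
      have hab : (qa * qb) * (K.aAdd i * K.bAdd i) = 1 := by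
        linear_combination (qb * K.bAdd i) * ha + hb
      -- The relations `aAdd · m1 = bAdd · m2` and `bAdd · y1 = aAdd · y2` are multiplied. Both
      -- `aAdd` and `bAdd` are invertible, so they can then be cancelled.
      have key : K.aAdd i * K.bAdd i * (m1 * y1) = K.aAdd i * K.bAdd i * (m2 * y2) := by
        linear_combination (K.bAdd i * y1) * e1 + (K.bAdd i * m2) * e2
      linear_combination (qa * qb) * key - (m1 * y1 - m2 * y2) * hab
    have := serMap_eq_zero_of_expOp_eq h
    rw [← this]
    ext k; rw [coeff_serMap]; rfl
  have he : gradedDeriv K.euler (K.strans K.expPhase * K.expRatio) = 0 := by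
    rw [Derivation.leibniz, graded_strans, graded_expPhase, graded_expRatio, map_zero]
    simp
  have h := K.eq_C_of_derivations_eq_zero hd he
  have h0 : PowerSeries.coeff 0 (K.strans K.expPhase * K.expRatio) = 1 := by
    rw [PowerSeries.coeff_zero_eq_constantCoeff_apply, map_mul,
      ← PowerSeries.coeff_zero_eq_constantCoeff_apply,
      ← PowerSeries.coeff_zero_eq_constantCoeff_apply, coeff_zero_expRatio, mul_one, strans, coeff_serMap]
    have : PowerSeries.coeff 0 K.expPhase = MvPolynomial.C 1 := by
      rw [map_one, PowerSeries.coeff_zero_eq_constantCoeff_apply]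
      exact constantCoeff_sexp K.constantCoeff_phase
    rw [this, trans_C]
  rw [h0, map_one] at h
  exact h

/-- The transformation of the cyclic products. -/
theorem expRatio_mul_strans_prod (σ : Equiv.Perm (Fin n))
    (k : Fin n → PowerSeries (MvPolynomial (Fin n) C))
    (hk : ∀ i, k i * (K.aMul i - K.bMul (σ i)) = 1)
    (k' : Fin n → PowerSeries C) (hk' : ∀ i, k' i * (K.aAdd i - K.bAdd (σ i)) = 1) :
    K.expRatio * K.strans (K.expPhase * ∏ i, k i) = ∏ i, k' i := by
  have h1 := K.prod_mul_strans σ k hk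
  have h2 := K.strans_expPhase_mul_expRatio
  have h3 : (∏ i, k' i) * ∏ i, (K.aAdd i - K.bAdd (σ i)) = 1 := by
    rw [← Finset.prod_mul_distrib]; exact Finset.prod_eq_one fun i _ => hk' i
  linear_combination ((∏ i, k' i) * K.expRatio) * h1 + (∏ i, k' i) * h2 -
    (K.expRatio * K.strans (K.expPhase * ∏ i, k i)) * h3

end Coords

/-! ### Division by the product of the polynomial variables. -/

section Shift

variable {n : ℕ} {C : Type*} [CommRing C] [Algebra ℂ C]

/-- The exponent `(1, …, 1)`. -/
def ones (n : ℕ) : Fin n →₀ ℕ := Finsupp.equivFunOnFinite.symm 1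

@[simp] theorem ones_apply (i : Fin n) : ones n i = 1 := rfl

/-- Lowering all exponents of a polynomial by one. -/
def lower (n : ℕ) (C : Type*) [CommRing C] [Algebra ℂ C] :
    MvPolynomial (Fin n) C →ₗ[ℂ] MvPolynomial (Fin n) C where
  toFun p := p.divMonomial (ones n)
  map_add' p q := MvPolynomial.add_divMonomial p q _
  map_smul' c p := by
    ext r
    simp [MvPolynomial.coeff_divMonomial]

@[simp] theorem coeff_lower (p : MvPolynomial (Fin n) C) (r : Fin n →₀ ℕ) :
    MvPolynomial.coeff r (lower n C p) = MvPolynomial.coeff (ones n + r) p :=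
  MvPolynomial.coeff_divMonomial _ _ _

theorem monomial_ones {C : Type*} [CommRing C] : (MvPolynomial.monomial (ones n) 1 : MvPolynomial (Fin n) C) =
    ∏ i, MvPolynomial.X i := by
  rw [MvPolynomial.monomial_eq, map_one, one_mul, Finsupp.prod_fintype _ _ (by simp)]
  simp

theorem lower_prod_X_mul (p : MvPolynomial (Fin n) C) :
    lower n C ((∏ i, MvPolynomial.X i) * p) = p := by
  ext r
  rw [coeff_lower, ← monomial_ones, MvPolynomial.coeff_monomial_mul, one_mul]

theorem serMap_lower_mul (F : PowerSeries (MvPolynomial (Fin n) C)) :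
    serMap (lower n C) ((∏ i, (PowerSeries.C (MvPolynomial.X i) * PowerSeries.X)) * F) =
      PowerSeries.X ^ n * F := by
  have h : (∏ i : Fin n, (PowerSeries.C (MvPolynomial.X i : MvPolynomial (Fin n) C) *
      PowerSeries.X)) * F =
        PowerSeries.C (∏ i, MvPolynomial.X i) * (PowerSeries.X ^ n * F) := by
    rw [Finset.prod_mul_distrib, map_prod, Finset.prod_const, Finset.card_univ, Fintype.card_fin,
      mul_assoc]
  rw [h]
  ext1 k
  rw [coeff_serMap, PowerSeries.coeff_C_mul, lower_prod_X_mul]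

end Shift

/-! ### The transformation for a single point. -/

namespace Coords

variable {n : ℕ} {C : Type*} [CommRing C] [Algebra ℂ C]

theorem strans_X_pow_mul (K : Coords n C) (m : ℕ) (F : PowerSeries (MvPolynomial (Fin n) C)) :
    K.strans (PowerSeries.X ^ m * F) = PowerSeries.X ^ m * K.strans F := by
  induction m with
  | zero => simp
  | succ m ih => rw [pow_succ', mul_assoc, strans_X_mul, ih, ← mul_assoc, ← pow_succ']

/-- This is `trans_euler` for `p/zᵢ`: the derivative of `1/zᵢ` cancels the middle term. -/
theorem trans_mul_X_add (K : Coords n C) (i : Fin n) (p : MvPolynomial (Fin n) C) :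
    K.trans (p * MvPolynomial.X i + polyDeriv _ (K.d i) p) =
      K.v i * K.trans (MvPolynomial.C (K.w i) * p) := by
  rw [← trans_euler, Derivation.leibniz, polyDeriv_C, d_w, if_pos rfl]
  have h : MvPolynomial.C (K.z i) * MvPolynomial.C (K.w i) = (1 : MvPolynomial (Fin n) C) := by
    rw [← map_mul, K.z_mul_w, map_one]
  refine congrArg K.trans ?_
  simp only [smul_eq_mul, map_neg, map_mul]
  linear_combination (MvPolynomial.C (K.w i) * p - p * MvPolynomial.X i -
    polyDeriv _ (K.d i) p) * h

/-- In the case of one point, `lower` divides by the variable. -/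
theorem eq_C_add_lower (p : MvPolynomial (Fin 1) C) :
    p = MvPolynomial.C (MvPolynomial.coeff 0 p) + lower 1 C p * MvPolynomial.X 0 := by
  classical
  ext r
  rw [MvPolynomial.coeff_add, MvPolynomial.coeff_C, MvPolynomial.coeff_mul_X']
  have hr : r = Finsupp.single 0 (r 0) :=
    Finsupp.ext fun i => by rw [Subsingleton.elim i 0]; simp
  have ho : ones 1 = Finsupp.single 0 1 :=
    Finsupp.ext fun i => by rw [Subsingleton.elim i 0]; simp
  rcases h : r 0 with _ | k
  · rw [h, Finsupp.single_zero] at hr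
    subst hr
    simp
  · rw [h] at hr
    have h1 : (0 : Fin 1) ∈ r.support := by simp [h]
    have h2 : ¬ (0 = r) := by rintro rfl; simp at h
    rw [if_neg h2, if_pos h1, coeff_lower, zero_add, hr, ho]
    congr 1
    rw [← Finsupp.single_tsub, ← Finsupp.single_add]
    congr 1
    omega

theorem lower_C_mul (c : C) (p : MvPolynomial (Fin n) C) :
    lower n C (MvPolynomial.C c * p) = MvPolynomial.C c * lower n C p := by
  ext r; simp

theorem lower_polyDeriv (D : Derivation ℂ C C) (p : MvPolynomial (Fin n) C) :
    lower n C (polyDeriv _ D p) = polyDeriv _ D (lower n C p) := by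
  ext r; simp

theorem lower_mul_X (p : MvPolynomial (Fin 1) C) : lower 1 C (p * MvPolynomial.X 0) = p := by
  have := lower_prod_X_mul p
  rwa [Fin.prod_univ_one, mul_comm] at this

/-- `trans_mul_X_add` holds exactly for `lower p`. Replacing `u · lower p` by `p` there introduces
the constant term of `p`, which is the source of the `-1` in `v_mul_strans_lower`. -/
theorem trans_lower (K : Coords 1 C) (p : MvPolynomial (Fin 1) C) :
    K.trans (lower 1 C (polyDeriv _ (K.d 0) p + p * MvPolynomial.X 0)) =
      K.v 0 * K.trans (lower 1 C (MvPolynomial.C (K.w 0) * p)) + MvPolynomial.coeff 0 p := by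
  rw [lower_C_mul, ← trans_mul_X_add, map_add, lower_polyDeriv, lower_mul_X]
  conv_lhs => rw [eq_C_add_lower p]
  rw [map_add K.trans, map_add K.trans, trans_C, map_add K.trans, ← eq_C_add_lower p]
  ring

theorem strans_lower (K : Coords 1 C) (F : PowerSeries (MvPolynomial (Fin 1) C)) :
    K.strans (serMap (lower 1 C) (K.dz 0 F + F * uVar C 0)) =
      PowerSeries.C (K.v 0) * K.strans (serMap (lower 1 C) (cst 1 (K.w 0) * F)) +
        PowerSeries.map MvPolynomial.constantCoeff F := by
  ext k
  rw [strans, coeff_serMap, coeff_serMap, map_add (PowerSeries.coeff k),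
    map_add (PowerSeries.coeff k), PowerSeries.coeff_C_mul, coeff_serMap,
    coeff_serMap, cst, RingHom.comp_apply, PowerSeries.coeff_C_mul, PowerSeries.coeff_map,
    uVar, PowerSeries.coeff_mul_C]
  exact K.trans_lower _

/-- The transformation in the case of one point. -/
theorem v_mul_strans_lower (K : Coords 1 C) : PowerSeries.C (K.v 0) *
    K.strans (serMap (lower 1 C)
      (cst 1 (K.w 0) * (K.expPhase * scaled S⁻¹ (MvPolynomial.X 0)))) =
      K.strans K.expPhase - 1 := by
  set s : PowerSeries (MvPolynomial (Fin 1) C) := scaled S⁻¹ (MvPolynomial.X 0) with hs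
  have hS : scaled S (MvPolynomial.X 0) * s = 1 := by
    rw [hs, ← scaled_mul, S_mul_inv, scaled_one]
  have hds : K.dz 0 s = 0 := serDeriv_scaled (by simp) _
  have hphase : K.dz 0 K.phase =
      uVar C 0 * (scaled S (MvPolynomial.X 0) - 1) := by
    have : K.dz 0 (scaled S (MvPolynomial.X 0)) = 0 := serDeriv_scaled (by simp) _
    rw [phase, Fin.sum_univ_one, Derivation.leibniz, Derivation.leibniz, map_sub, this,
      Derivation.map_one_eq_zero, dz_cst, dz_uVar, K.d_z, if_pos rfl]
    simp only [smul_eq_mul, map_one]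
    ring
  -- At `u = 0` the exponent `Φ` vanishes and `S⁻¹` equals `1`, so the constant term in `u` is `1`.
  have hone : PowerSeries.map MvPolynomial.constantCoeff (K.expPhase * s) = 1 := by
    have hscaled : ∀ f : PowerSeries ℂ, PowerSeries.constantCoeff f = 1 →
        PowerSeries.map (MvPolynomial.constantCoeff (R := C)) (scaled f
          (MvPolynomial.X 0 : MvPolynomial (Fin 1) C)) = 1 := by
      intro f hf
      ext k
      rw [PowerSeries.coeff_map, coeff_scaled, map_mul, map_pow, MvPolynomial.constantCoeff_X,
        PowerSeries.coeff_one, MvPolynomial.algebraMap_apply, MvPolynomial.constantCoeff_C]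
      split_ifs with h
      · subst h; simp [hf]
      · rw [zero_pow h, zero_mul]
    have hS1 : PowerSeries.constantCoeff S = 1 := by
      rw [← PowerSeries.coeff_zero_eq_constantCoeff_apply]
      simp [S, -PowerSeries.coeff_zero_eq_constantCoeff]
    have h1 : PowerSeries.map MvPolynomial.constantCoeff K.phase = 0 := by
      rw [phase, Fin.sum_univ_one, map_mul, map_sub, hscaled S hS1]
      simp
    have h2 : PowerSeries.map MvPolynomial.constantCoeff K.expPhase = 1 := by
      have h0 : MvPowerSeries.constantCoeff (PowerSeries.map (MvPolynomial.constantCoeff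
        (σ := Fin 1) (R := C)) K.phase) = 0 := by rw [h1]; simp
      have := map_subst_of_coeff (τ := Unit) (τ' := Unit)
        (PowerSeries.map (MvPolynomial.constantCoeff (σ := Fin 1) (R := C))) id
        (fun _ => { toFun := MvPolynomial.constantCoeff
                    map_add' := fun p q => map_add _ p q
                    map_smul' := fun c p => by simp [MvPolynomial.constantCoeff_eq] })
        (fun _ _ => rfl) (PowerSeries.exp ℂ) K.constantCoeff_phase h0
      rw [h1] at this
      exact this.trans sexp_zero
    rw [map_mul, h2, one_mul]
    refine hscaled _ ?_
    rw [PowerSeries.constantCoeff_inv, hS1, inv_one]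
  have h := K.strans_lower (K.expPhase * s)
  -- Since `∂Φ = u(S(uħ) - 1)`, the factor `1/S(uħ)` is just what makes the two terms combine to `u
  -- e^Φ`.
  have h1 : K.dz 0 (K.expPhase * s) + K.expPhase * s * uVar C 0 = K.expPhase * uVar C 0 := by
    rw [Derivation.leibniz, hds, dz_expPhase, hphase]
    simp only [smul_eq_mul]
    linear_combination (K.expPhase * uVar C 0) * hS
  have h2 : serMap (lower 1 C) (K.expPhase * uVar C 0) = K.expPhase := by
    ext1 k
    rw [coeff_serMap, uVar, PowerSeries.coeff_mul_C, lower_mul_X]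
  rw [h1, h2, hone] at h
  linear_combination -h

end Coords

/-! ### Integration by parts against the operators `d 1/dx`. -/

/-- Commuting derivations with coordinates `zᵢ` and functions `x'ᵢ = xp i` of the `i`-th coordinate;
`w i` and `xq i` are the inverses. -/
structure XCoords (n : ℕ) (A : Type*) [CommRing A] [Algebra ℂ A] where
  d : Fin n → Derivation ℂ A A
  z : Fin n → A
  w : Fin n → A
  xp : Fin n → A
  xq : Fin n → A
  d_comm : ∀ i j x, d i (d j x) = d j (d i x)
  d_z : ∀ i j, d i (z j) = if i = j then 1 else 0
  z_mul_w : ∀ i, z i * w i = 1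
  xp_mul_xq : ∀ i, xp i * xq i = 1
  d_xp : ∀ i j, i ≠ j → d i (xp j) = 0

namespace XCoords

variable {n : ℕ} {A : Type*} [CommRing A] [Algebra ℂ A] (H : XCoords n A)

/-- The induced data on `A[v₁, …, vₙ]`. -/
def coords : Coords n (MvPolynomial (Fin n) A) where
  d i := polyDeriv _ (H.d i)
  z i := MvPolynomial.C (H.z i)
  w i := MvPolynomial.C (H.w i)
  v i := MvPolynomial.X i
  d_comm i j x := polyDeriv_comm (H.d_comm i j) x
  d_z i j := by rw [polyDeriv_C, H.d_z]; split_ifs <;> simp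
  z_mul_w i := by rw [← map_mul, H.z_mul_w, map_one]
  d_v i j := polyDeriv_X _ _

theorem d_xq {i j : Fin n} (h : i ≠ j) : H.d i (H.xq j) = 0 := by
  have := Coords.derivation_apply_inverse (H.d i) (b := H.xq j) (a := H.xp j)
    (by rw [mul_comm, H.xp_mul_xq])
  rw [this, H.d_xp i j h, mul_zero, neg_zero]

/-- The operator `f ↦ ∂ᵢ (f / x'ᵢ)`. -/
def delta (i : Fin n) : Module.End ℂ A := (H.d i).toLinearMap ∘ₗ LinearMap.mulLeft ℂ (H.xq i)

theorem delta_apply (i : Fin n) (f : A) : H.delta i f = H.d i (H.xq i * f) := rfl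

theorem delta_comm (i j : Fin n) : Commute (H.delta i) (H.delta j) := by
  by_cases h : i = j
  · subst h; exact Commute.refl _
  · refine LinearMap.ext fun x => ?_
    simp only [Module.End.mul_apply, delta_apply, Derivation.leibniz, map_add, smul_eq_mul,
      H.d_xq h, H.d_xq (Ne.symm h), H.d_comm i j, mul_zero, add_zero, map_zero]
    have e2 : H.d j (H.d i (H.xq i)) = 0 := by
      rw [H.d_comm, H.d_xq (Ne.symm h), map_zero]
    rw [e2]
    ring

/-- The map `∑ f_j v^j ↦ ∑ ∏ᵢ (∂ᵢ 1/x'ᵢ)^{jᵢ} f_j`. -/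
def total : MvPolynomial (Fin n) A →ₗ[ℂ] A := opEval H.delta

/-- Because `∂ᵢ f = ∂ᵢ((x'ᵢ f)/x'ᵢ)`, a derivative is the operator `delta i` applied to `x'ᵢ f`, and
`total` turns the variable `vᵢ` into that operator. -/
theorem total_integration (i : Fin n) (p : MvPolynomial (Fin n) A) :
    H.total (polyDeriv _ (H.d i) p) =
      H.total (MvPolynomial.X i * MvPolynomial.C (H.xp i) * p) := by
  induction p using MvPolynomial.induction_on with
  | C a =>
    rw [polyDeriv_C, mul_assoc, ← map_mul, total, opEval_X_mul H.delta_comm, opEval_C, opEval_C,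
      delta_apply, ← mul_assoc, mul_comm (H.xq i), H.xp_mul_xq, one_mul]
  | add p q hp hq => rw [map_add, map_add, hp, hq, mul_add, map_add]
  | mul_X p j hp =>
    have h1 : polyDeriv _ (H.d i) (p * MvPolynomial.X j) =
        polyDeriv _ (H.d i) p * MvPolynomial.X j := by
      rw [Derivation.leibniz, polyDeriv_X, smul_zero, zero_add, smul_eq_mul, mul_comm]
    rw [h1, ← mul_assoc, total, opEval_mul_X H.delta_comm, opEval_mul_X H.delta_comm]
    exact congrArg _ hp

/-- The map `total`, acting coefficientwise on power series in `ħ`. -/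
def stotal : PowerSeries (MvPolynomial (Fin n) A) →ₗ[ℂ] PowerSeries A := serMap H.total

/-- The function `ψ'(zᵢ) = 1 / zᵢ - x'ᵢ`. -/
def psip (i : Fin n) : A := H.w i - H.xp i

/-- The operator `∂ᵢ + vᵢ ψ'(zᵢ)`. -/
def psiOp (i : Fin n) : Module.End ℂ (PowerSeries (MvPolynomial (Fin n) A)) :=
  (serDeriv Unit (polyDeriv _ (H.d i))).toLinearMap +
    LinearMap.mulLeft ℂ (PowerSeries.C (MvPolynomial.X i * MvPolynomial.C (H.psip i)))

theorem psiOp_apply (i : Fin n) (F : PowerSeries (MvPolynomial (Fin n) A)) :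
    H.psiOp i F = serDeriv Unit (polyDeriv _ (H.d i)) F +
      PowerSeries.C (MvPolynomial.X i * MvPolynomial.C (H.psip i)) * F := rfl

theorem serMap_nabla (i : Fin n) (F : PowerSeries (MvPolynomial (Fin n) A)) :
    serMap (H.coords.nabla i) F =
      PowerSeries.C (MvPolynomial.X i * MvPolynomial.C (H.w i)) * F -
        serDeriv Unit (polyDeriv _ (H.d i)) F := by
  ext1 k
  rw [coeff_serMap, map_sub, PowerSeries.coeff_C_mul]
  rfl

/-- By the Leibniz rule and `total_integration` the adjoint of `∂ᵢ + vᵢψ'` is `-∂ᵢ + vᵢ(x'ᵢ + ψ')`,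
and `x'ᵢ + ψ' = 1/zᵢ`. -/
theorem stotal_psiOp_mul (i : Fin n) (F G : PowerSeries (MvPolynomial (Fin n) A)) :
    H.stotal (H.psiOp i F * G) = H.stotal (F * serMap (H.coords.nabla i) G) := by
  rw [← sub_eq_zero, ← map_sub]
  have h : H.psiOp i F * G - F * serMap (H.coords.nabla i) G =
      serDeriv Unit (polyDeriv _ (H.d i)) (F * G) -
        PowerSeries.C (MvPolynomial.X i * MvPolynomial.C (H.xp i)) * (F * G) := by
    rw [psiOp_apply, serMap_nabla, Derivation.leibniz, psip]
    simp only [smul_eq_mul, map_mul, map_sub]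
    ring
  rw [h]
  ext k
  rw [stotal, coeff_serMap, map_sub, map_sub, PowerSeries.coeff_C_mul, coeff_serDeriv',
    total_integration, sub_self, map_zero]

theorem stotal_psiOp_pow_mul (i : Fin n) (r : ℕ) (F G : PowerSeries (MvPolynomial (Fin n) A)) :
    H.stotal ((H.psiOp i ^ r) F * G) = H.stotal (F * serMap (H.coords.nabla i ^ r) G) := by
  induction r generalizing F with
  | zero =>
    have : serMap ((H.coords.nabla i) ^ 0) G = G := by ext1 k; rw [coeff_serMap]; rfl
    rw [this]; rfl
  | succ r ih =>
    have : serMap ((H.coords.nabla i) ^ (r + 1)) G =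
        serMap (H.coords.nabla i) (serMap ((H.coords.nabla i) ^ r) G) := by
      ext1 k; rw [coeff_serMap, coeff_serMap, coeff_serMap, pow_succ']; rfl
    rw [pow_succ, Module.End.mul_apply, ih, stotal_psiOp_mul, this]

theorem d_psip {i j : Fin n} (h : i ≠ j) : H.d i (H.psip j) = 0 := by
  have h1 : H.d i (H.w j) = 0 := by
    rw [Coords.derivation_apply_inverse (H.d i) (b := H.w j) (a := H.z j)
      (by rw [mul_comm, H.z_mul_w]), H.d_z, if_neg h, mul_zero, neg_zero]
  rw [psip, map_sub, h1, H.d_xp i j h, sub_zero]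

theorem d_psiOp_pow {i j : Fin n} (h : i ≠ j) (r : ℕ) {F : PowerSeries (MvPolynomial (Fin n) A)}
    (hF : serDeriv Unit (polyDeriv _ (H.d i)) F = 0) :
    serDeriv Unit (polyDeriv _ (H.d i)) ((H.psiOp j ^ r) F) = 0 := by
  induction r with
  | zero => exact hF
  | succ r ih =>
    have hc : ∀ G : PowerSeries (MvPolynomial (Fin n) A),
        serDeriv Unit (polyDeriv _ (H.d i)) (serDeriv Unit (polyDeriv _ (H.d j)) G) =
        serDeriv Unit (polyDeriv _ (H.d j)) (serDeriv Unit (polyDeriv _ (H.d i)) G) := by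
      intro G
      ext1 k
      simp only [coeff_serDeriv']
      exact polyDeriv_comm (H.d_comm i j) _
    rw [pow_succ', Module.End.mul_apply, psiOp_apply, map_add, hc, ih, map_zero,
      Derivation.leibniz, ih, serDeriv_C, Derivation.leibniz, polyDeriv_X, polyDeriv_C,
      H.d_psip h]
    simp

theorem serMap_nabla_mul {i : Fin n} {F : PowerSeries (MvPolynomial (Fin n) A)}
    (hF : serDeriv Unit (polyDeriv _ (H.d i)) F = 0) (r : ℕ)
    (G : PowerSeries (MvPolynomial (Fin n) A)) :
    serMap (H.coords.nabla i ^ r) (F * G) = F * serMap (H.coords.nabla i ^ r) G := by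
  induction r generalizing G with
  | zero =>
    have : ∀ G, serMap ((H.coords.nabla i) ^ 0) G = G := by
      intro G; ext1 k; rw [coeff_serMap]; rfl
    rw [this, this]
  | succ r ih =>
    have : ∀ G, serMap ((H.coords.nabla i) ^ (r + 1)) G =
        serMap ((H.coords.nabla i) ^ r) (serMap (H.coords.nabla i) G) := by
      intro G; ext1 k; rw [coeff_serMap, coeff_serMap, coeff_serMap, pow_succ]; rfl
    rw [this, this, ← ih]
    congr 1
    rw [serMap_nabla, serMap_nabla, Derivation.leibniz, hF]
    simp only [smul_eq_mul, mul_zero, add_zero]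
    ring

/-- The operators are moved one index at a time. The factor `E j` involves only the coordinate `zⱼ`,
so `∇ᵢ` passes through it for `i ≠ j`, and the `∇ᵢ` commute with each other. -/
theorem stotal_prod_psiOp_mul (E : Fin n → PowerSeries (MvPolynomial (Fin n) A))
    (hE : ∀ i j, i ≠ j → serDeriv Unit (polyDeriv _ (H.d i)) (E j) = 0) (r : Fin n → ℕ)
    (G : PowerSeries (MvPolynomial (Fin n) A)) :
    H.stotal ((∏ i, (H.psiOp i ^ r i) (E i)) * G) =
      H.stotal ((∏ i, E i) * serMap (opPow H.coords.nabla r) G) := by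
  have key : ∀ (l : List (Fin n)), l.Nodup → ∀ G : PowerSeries (MvPolynomial (Fin n) A),
      H.stotal ((l.map fun i => (H.psiOp i ^ r i) (E i)).prod * G) =
      H.stotal ((l.map E).prod * serMap ((l.map fun i => H.coords.nabla i ^ r i).prod) G) := by
    intro l
    induction l with
    | nil =>
      intro _ G
      have : serMap (1 : Module.End ℂ (MvPolynomial (Fin n) A)) G = G := by
        ext1 k; rw [coeff_serMap]; rfl
      simp [this]
    | cons i l ih =>
      intro hl G
      have hil := (List.nodup_cons.mp hl).1
      have hrest : ∀ l' : List (Fin n), i ∉ l' → serDeriv Unit (polyDeriv _ (H.d i))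
          (l'.map fun j => (H.psiOp j ^ r j) (E j)).prod = 0 := by
        intro l'
        induction l' with
        | nil => intro _; simp
        | cons a l' ih' =>
          intro ha
          rw [List.map_cons, List.prod_cons, Derivation.leibniz,
            ih' (fun h => ha (List.mem_cons_of_mem _ h)),
            H.d_psiOp_pow (fun h => ha (by rw [h]; exact List.mem_cons_self)) _
              (hE i a fun h => ha (by rw [h]; exact List.mem_cons_self))]
          simp
      have hop : ∀ l' : List (Fin n), i ∉ l' → ∀ G : PowerSeries (MvPolynomial (Fin n) A),
          serMap ((l'.map fun j => H.coords.nabla j ^ r j).prod) (E i * G) =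
            E i * serMap ((l'.map fun j => H.coords.nabla j ^ r j).prod) G := by
        intro l'
        induction l' with
        | nil =>
          intro _ G
          have : ∀ G, serMap (1 : Module.End ℂ (MvPolynomial (Fin n) A)) G = G := by
            intro G; ext1 k; rw [coeff_serMap]; rfl
          simp [this]
        | cons a l' ih' =>
          intro ha G
          have hcomp : ∀ (N P : Module.End ℂ (MvPolynomial (Fin n) A)) G,
              serMap (N * P) G = serMap N (serMap P G) := by
            intro N P G; ext1 k; simp only [coeff_serMap]; rfl
          have hai : a ≠ i := fun h => ha (by rw [h]; exact List.mem_cons_self)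
          rw [List.map_cons, List.prod_cons, hcomp, hcomp,
            ih' (fun h => ha (List.mem_cons_of_mem _ h)), H.serMap_nabla_mul (hE a i hai)]
      have hcommute : Commute (H.coords.nabla i ^ r i)
          (l.map fun j => H.coords.nabla j ^ r j).prod :=
        Commute.list_prod_right _ _ fun x hx => by
          obtain ⟨j, _, rfl⟩ := List.mem_map.mp hx
          exact (H.coords.nabla_comm i j).pow_pow _ _
      have hcomp : ∀ (N P : Module.End ℂ (MvPolynomial (Fin n) A)) G,
          serMap (N * P) G = serMap N (serMap P G) := by
        intro N P G; ext1 k; simp only [coeff_serMap]; rfl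
      rw [List.map_cons, List.prod_cons, mul_assoc, stotal_psiOp_pow_mul,
        H.serMap_nabla_mul (hrest l hil), mul_left_comm, ih (List.nodup_cons.mp hl).2, hop l hil,
        List.map_cons, List.map_cons, List.prod_cons, List.prod_cons, hcommute.eq, hcomp]
      congr 1
      ring
  have h := key (List.finRange n) (List.nodup_finRange n) G
  rw [opPow, ← List.ofFn_eq_map]
  rw [← List.ofFn_eq_map, ← List.ofFn_eq_map, ← List.ofFn_eq_map, List.prod_ofFn,
    List.prod_ofFn] at h
  exact h

/-- The coefficient of `u^r`, as a power series in `ħ`. -/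
def uCoeff {R : Type*} [CommRing R] [Algebra ℂ R] (r : Fin n →₀ ℕ) :
    PowerSeries (MvPolynomial (Fin n) R) →ₗ[ℂ] PowerSeries R :=
  serMap ((MvPolynomial.lcoeff R r).restrictScalars ℂ)

theorem coeff_uCoeff {R : Type*} [CommRing R] [Algebra ℂ R] (r : Fin n →₀ ℕ)
    (F : PowerSeries (MvPolynomial (Fin n) R)) (k : ℕ) :
    PowerSeries.coeff k (uCoeff r F) = MvPolynomial.coeff r (PowerSeries.coeff k F) := by
  rw [uCoeff, coeff_serMap]; rfl

/-- Integration by parts for the sum over all powers of the `uᵢ`. -/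
theorem sum_total_eq (E : Fin n → PowerSeries (MvPolynomial (Fin n) A))
    (hE : ∀ i j, i ≠ j → serDeriv Unit (polyDeriv _ (H.d i)) (E j) = 0)
    (G : PowerSeries (MvPolynomial (Fin n) (MvPolynomial (Fin n) A))) (N : ℕ)
    (s : Finset (Fin n →₀ ℕ))
    (hs : ∀ k ≤ N, (PowerSeries.coeff k G).support ⊆ s) :
    ∑ r ∈ s, H.total (PowerSeries.coeff N ((∏ i, (H.psiOp i ^ r i) (E i)) * uCoeff r G)) =
      H.total (PowerSeries.coeff N ((∏ i, E i) * H.coords.strans G)) := by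
  have h1 : ∀ r : Fin n →₀ ℕ,
      H.total (PowerSeries.coeff N ((∏ i, (H.psiOp i ^ r i) (E i)) * uCoeff r G)) =
      H.total (PowerSeries.coeff N
        ((∏ i, E i) * serMap (opPow H.coords.nabla r) (uCoeff r G))) := by
    intro r
    have := congrArg (PowerSeries.coeff N) (H.stotal_prod_psiOp_mul E hE r (uCoeff r G))
    rwa [stotal, coeff_serMap, coeff_serMap] at this
  rw [Finset.sum_congr rfl fun r _ => h1 r, ← map_sum]
  congr 1
  simp only [PowerSeries.coeff_mul]
  rw [Finset.sum_comm]
  refine Finset.sum_congr rfl fun p hp => ?_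
  have hp' : p.1 + p.2 = N := mem_antidiagonal.mp hp
  rw [← Finset.mul_sum]
  congr 1
  rw [Coords.strans, coeff_serMap, Coords.trans, opEval_eq_sum _ (hs p.2 (by omega))]
  refine Finset.sum_congr rfl fun r _ => ?_
  rw [coeff_serMap, coeff_uCoeff]

end XCoords

/-! ### Rescaling of the formal variables and the symmetry of the cyclic sums. -/

section Rescaling

variable {n : ℕ}

/-- The formal variables as a disjoint union. -/
def varEquiv (n : ℕ) : Var n ≃ Unit ⊕ (Fin n ⊕ Fin n) where
  toFun
    | Var.h => Sum.inl ()
    | Var.u i => Sum.inr (Sum.inl i)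
    | Var.v i => Sum.inr (Sum.inr i)
  invFun
    | Sum.inl _ => Var.h
    | Sum.inr (Sum.inl i) => Var.u i
    | Sum.inr (Sum.inr i) => Var.v i
  left_inv := by rintro (_ | _ | _) <;> rfl
  right_inv := by rintro (_ | _ | _) <;> rfl

instance : Fintype (Var n) := Fintype.ofEquiv _ (varEquiv n).symm

theorem prod_var {M : Type*} [CommMonoid M] (f : Var n → M) :
    ∏ w, f w = f Var.h * ((∏ i, f (Var.u i)) * ∏ i, f (Var.v i)) := by
  rw [← Equiv.prod_comp (varEquiv n).symm, Fintype.prod_sum_type, Fintype.prod_sum_type]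
  simp [varEquiv]

/-- The exponent of `ħ^N v^j u^r`. -/
def expnt (N : ℕ) (j r : Fin n → ℕ) : Var n →₀ ℕ :=
  Finsupp.single Var.h N + ∑ i, Finsupp.single (Var.v i) (j i) +
    ∑ i, Finsupp.single (Var.u i) (r i)

theorem extract_eq (N : ℕ) (j r : Fin n → ℕ) (F : Ser n) :
    extract N j r F = MvPowerSeries.coeff (expnt N j r) F := rfl

@[simp] theorem expnt_h (N : ℕ) (j r : Fin n → ℕ) : expnt N j r Var.h = N := by
  classical
  simp [expnt]

@[simp] theorem expnt_u (N : ℕ) (j r : Fin n → ℕ) (i : Fin n) : expnt N j r (Var.u i) = r i := by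
  classical
  simp [expnt, Finsupp.single_apply]

@[simp] theorem expnt_v (N : ℕ) (j r : Fin n → ℕ) (i : Fin n) : expnt N j r (Var.v i) = j i := by
  classical
  simp [expnt, Finsupp.single_apply]

/-- The substitution `u ↦ s u`, `v ↦ t v`. -/
def scaleUV (s t : ℂ) : Ser n →+* Ser n :=
  MvPowerSeries.rescale fun
    | Var.h => 1
    | Var.u _ => s
    | Var.v _ => t

theorem coeff_scaleUV (s t : ℂ) (F : Ser n) (e : Var n →₀ ℕ) :
    MvPowerSeries.coeff e (scaleUV s t F) =
      s ^ (∑ i, e (Var.u i)) * t ^ (∑ i, e (Var.v i)) * MvPowerSeries.coeff e F := by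
  rw [scaleUV, MvPowerSeries.coeff_rescale, Finsupp.prod_fintype _ _ (by simp), prod_var,
    Finset.prod_pow_eq_pow_sum, Finset.prod_pow_eq_pow_sum, one_pow, one_mul]

theorem constantCoeff_scaleUV (s t : ℂ) (F : Ser n) :
    MvPowerSeries.constantCoeff (scaleUV s t F) = MvPowerSeries.constantCoeff F := by
  rw [← MvPowerSeries.coeff_zero_eq_constantCoeff_apply, coeff_scaleUV]
  simp

theorem scaleUV_subst (s t : ℂ) (f : PowerSeries ℂ) {F : Ser n}
    (hF : MvPowerSeries.constantCoeff F = 0) :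
    scaleUV s t (f.subst F) = f.subst (scaleUV s t F) :=
  map_subst_of_coeff (scaleUV s t) id
    (fun e => LinearMap.mulLeft ℂ (s ^ (∑ i, e (Var.u i)) * t ^ (∑ i, e (Var.v i))))
    (fun F e => coeff_scaleUV s t F e) f hF (by rw [constantCoeff_scaleUV, hF])

theorem scaleUV_fexp (s t : ℂ) {F : Ser n} (hF : MvPowerSeries.constantCoeff F = 0) :
    scaleUV s t (fexp F) = fexp (scaleUV s t F) := scaleUV_subst s t _ hF

theorem scaleUV_inv (s t : ℂ) (F : Ser n) : scaleUV s t F⁻¹ = (scaleUV s t F)⁻¹ := by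
  by_cases h : MvPowerSeries.constantCoeff F = 0
  · rw [MvPowerSeries.inv_eq_zero.mpr h,
      MvPowerSeries.inv_eq_zero.mpr (by rw [constantCoeff_scaleUV, h]), map_zero]
  · rw [MvPowerSeries.eq_inv_iff_mul_eq_one (by rwa [constantCoeff_scaleUV]), ← map_mul,
      MvPowerSeries.inv_mul_cancel _ h, map_one]

@[simp] theorem scaleUV_const (s t c : ℂ) : scaleUV s t (const c : Ser n) = const c := by
  classical
  ext e
  rw [coeff_scaleUV, MvPowerSeries.coeff_C]
  split_ifs with h
  · subst h; simp
  · rw [mul_zero]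

@[simp] theorem scaleUV_h (s t : ℂ) : scaleUV s t (var Var.h : Ser n) = var Var.h := by
  classical
  ext e
  rw [coeff_scaleUV, MvPowerSeries.coeff_X]
  split_ifs with h
  · subst h; simp
  · rw [mul_zero]

@[simp] theorem scaleUV_u (s t : ℂ) (i : Fin n) :
    scaleUV s t (var (Var.u i)) = const s * var (Var.u i) := by
  classical
  ext e
  rw [coeff_scaleUV, MvPowerSeries.coeff_C_mul, MvPowerSeries.coeff_X]
  split_ifs with h
  · subst h; simp [Finsupp.single_apply]
  · rw [mul_zero, mul_zero]

theorem coeff_S_eq_zero {a : ℕ} (h : ¬ Even a) : PowerSeries.coeff a S = 0 := by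
  rw [S, PowerSeries.coeff_mk, if_neg h]

theorem coeff_zero_S : PowerSeries.coeff 0 S = 1 := by
  simp [S, -PowerSeries.coeff_zero_eq_constantCoeff]

theorem rescale_S {s : ℂ} (hs : s * s = 1) : PowerSeries.rescale s S = S := by
  ext a
  rw [PowerSeries.coeff_rescale]
  by_cases h : Even a
  · obtain ⟨b, rfl⟩ := h
    rw [← two_mul, pow_mul, sq, hs, one_pow, one_mul]
  · rw [coeff_S_eq_zero h, mul_zero]

/-- `S` is even, so only even powers of `uᵢ` occur. -/
theorem scaleUV_applyS {s : ℂ} (hs : s * s = 1) (t : ℂ) (D : (ℂ → ℂ) → ℂ → ℂ) (f : ℕ → ℂ → ℂ)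
    (i : Fin n) (z : ℂ) : scaleUV s t (applyS D f (Var.u i) z) = applyS D f (Var.u i) z := by
  classical
  ext e
  rw [coeff_scaleUV]
  change _ * ite _ _ _ = ite _ _ _
  split_ifs with h
  · by_cases ha : Even (e (Var.u i))
    · have h1 : ∑ j, e (Var.u j) = e (Var.u i) := by
        rw [h.1]; simp [Finsupp.single_apply]
      have h2 : ∑ j, e (Var.v j) = 0 := by
        rw [h.1]; simp
      obtain ⟨b, hb⟩ := ha
      rw [h1, h2, pow_zero, mul_one, hb, ← two_mul, pow_mul, sq, hs, one_pow, one_mul]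
    · rw [coeff_S_eq_zero ha, zero_mul, mul_zero]
  · rw [mul_zero]

theorem scaleUV_expS {s : ℂ} (hs : s * s = 1) (t : ℂ) (D : (ℂ → ℂ) → ℂ → ℂ) (f : ℕ → ℂ → ℂ)
    (i : Fin n) (z : ℂ) : scaleUV s t (expS D f (Var.u i) z) =
      fexp (const s * (var (Var.u i) * (applyS D f (Var.u i) z - const (f 0 z)))) := by
  rw [expS, scaleUV_fexp _ _ (by simp), map_mul, map_sub, scaleUV_applyS hs, scaleUV_const,
    scaleUV_u, mul_assoc]

theorem scaleUV_addShift (s t c : ℂ) (i : Fin n) (z : ℂ) :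
    scaleUV s t (addShift c i z) = addShift (c * s) i z := by
  simp only [addShift, map_add, map_mul, scaleUV_const, scaleUV_u, scaleUV_h]
  ring

theorem scaleUV_mulShift (s t c : ℂ) (i : Fin n) (z : ℂ) :
    scaleUV s t (mulShift c i z) = mulShift (c * s) i z := by
  rw [mulShift, map_mul, scaleUV_fexp _ _ (by simp), mulShift]
  simp only [map_mul, scaleUV_const, scaleUV_u, scaleUV_h]
  congr 2
  ring

theorem scaleUV_mulQuot {s : ℂ} (hs : s * s = 1) (t : ℂ) (i : Fin n) (z : ℂ) :
    scaleUV s t (mulQuot i z) = mulQuot i z := by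
  have h0 : PowerSeries.HasSubst (var (Var.u i) * var Var.h : Ser n) :=
    PowerSeries.HasSubst.of_constantCoeff_zero (by simp)
  have h : (PowerSeries.rescale s S).subst (var (Var.u i) * var Var.h : Ser n) =
      S.subst (const s * (var (Var.u i) * var Var.h)) := by
    rw [PowerSeries.rescale_eq_subst,
      PowerSeries.subst_comp_subst_apply (PowerSeries.HasSubst.smul_X' s) h0,
      PowerSeries.subst_smul h0, PowerSeries.subst_X h0, MvPowerSeries.smul_eq_C_mul]
  rw [mulQuot, map_mul, scaleUV_subst _ _ _ (by simp), map_mul, scaleUV_u, scaleUV_h,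
    scaleUV_const, mul_assoc, ← h, rescale_S hs]

theorem scaleUV_cycleSum (s t : ℂ) (a b q : Fin n → Ser n) :
    scaleUV s t (cycleSum a b q) = (-1) ^ (n - 1) *
      ∑ σ : Equiv.Perm (Fin n) with ∀ i j, σ.SameCycle i j,
        ∏ i, if σ i = i then (scaleUV s t (q i))⁻¹ else
          const s * (var (Var.u i) * var Var.h) * (scaleUV s t (a i) - scaleUV s t (b (σ i)))⁻¹ := by
  classical
  rw [cycleSum, map_mul, map_pow, map_neg, map_one, map_sum]
  congr 1
  refine Finset.sum_congr (by congr) fun σ _ => ?_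
  rw [map_prod]
  refine Finset.prod_congr rfl fun i _ => ?_
  split_ifs
  · rw [scaleUV_inv]
  · rw [map_mul, map_mul, scaleUV_inv, map_sub, scaleUV_u, scaleUV_h, mul_assoc (const s)]

/-- Reindex by `σ ↦ σ⁻¹`, and the product by `i ↦ σ(i)`. The sign attached to each `uᵢħ` reverses
the corresponding difference; a fixed point has neither the sign nor the difference. -/
theorem cycleSum_swap (a b q : Fin n → Ser n) :
    (-1) ^ (n - 1) *
      ∑ σ : Equiv.Perm (Fin n) with ∀ i j, σ.SameCycle i j,
        ∏ i, (if σ i = i then (q i)⁻¹ else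
          const (-1) * (var (Var.u i) * var Var.h) * (b i - a (σ i))⁻¹) = cycleSum a b q := by
  classical
  rw [cycleSum]
  congr 1
  refine Finset.sum_nbij' (fun σ => σ⁻¹) (fun σ => σ⁻¹) ?_ ?_ (fun σ _ => inv_inv σ)
    (fun σ _ => inv_inv σ) ?_
  · intro σ hσ
    simpa [Equiv.Perm.sameCycle_inv] using hσ
  · intro σ hσ
    simpa [Equiv.Perm.sameCycle_inv] using hσ
  · intro σ _
    have h1 : ∏ i, (if σ i = i then (q i)⁻¹ else
        const (-1) * (var (Var.u i) * var Var.h) * (b i - a (σ i))⁻¹) =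
        (∏ i, if σ i = i then (1 : Ser n) else var (Var.u i) * var Var.h) *
          ∏ i, if σ i = i then (q i)⁻¹ else (a (σ i) - b i)⁻¹ := by
      rw [← Finset.prod_mul_distrib]
      refine Finset.prod_congr rfl fun i _ => ?_
      split_ifs
      · rw [one_mul]
      · have h2 : a (σ i) - b i = (-1 : ℂ) • (b i - a (σ i)) := by
          rw [neg_one_smul, neg_sub]
        rw [h2, MvPowerSeries.smul_inv, MvPowerSeries.smul_eq_C_mul, inv_neg, inv_one]
        ring
    have h3 : ∏ i, (if σ⁻¹ i = i then (q i)⁻¹ else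
        var (Var.u i) * var Var.h * (a i - b (σ⁻¹ i))⁻¹) =
        (∏ i, if σ⁻¹ i = i then (1 : Ser n) else var (Var.u i) * var Var.h) *
          ∏ i, if σ⁻¹ i = i then (q i)⁻¹ else (a i - b (σ⁻¹ i))⁻¹ := by
      rw [← Finset.prod_mul_distrib]
      refine Finset.prod_congr rfl fun i _ => ?_
      split_ifs
      · rw [one_mul]
      · rfl
    rw [h1, h3]
    congr 1
    · refine Finset.prod_congr rfl fun i _ => ?_
      have : σ⁻¹ i = i ↔ σ i = i := by
        rw [Equiv.Perm.inv_eq_iff_eq, eq_comm]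
      simp only [this]
    · conv_rhs => rw [← Equiv.prod_comp σ]
      refine Finset.prod_congr rfl fun i _ => ?_
      have : σ⁻¹ (σ i) = i := by simp
      rw [this]
      by_cases h : σ i = i
      · rw [if_pos h, if_pos h.symm, h]
      · rw [if_neg h, if_neg (Ne.symm h)]

theorem flip_cycleSum {a b q : Fin n → Ser n} (ha : ∀ i, scaleUV (-1) 1 (a i) = b i)
    (hb : ∀ i, scaleUV (-1) 1 (b i) = a i) (hq : ∀ i, scaleUV (-1) 1 (q i) = q i) :
    scaleUV (-1) 1 (cycleSum a b q) = cycleSum a b q := by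
  rw [scaleUV_cycleSum, ← cycleSum_swap a b q]
  simp only [ha, hb, hq]

theorem flip_addCycleSum (z : Fin n → ℂ) : scaleUV (-1) 1 (addCycleSum z) = addCycleSum z := by
  refine flip_cycleSum (fun i => ?_) (fun i => ?_) (fun i => map_one _)
  · rw [scaleUV_addShift, mul_neg_one]
  · rw [scaleUV_addShift, mul_neg_one, neg_neg]

theorem flip_mulCycleSum (z : Fin n → ℂ) : scaleUV (-1) 1 (mulCycleSum z) = mulCycleSum z := by
  refine flip_cycleSum (fun i => ?_) (fun i => ?_)
    (fun i => scaleUV_mulQuot (by norm_num) _ _ _)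
  · rw [scaleUV_mulShift, mul_neg_one]
  · rw [scaleUV_mulShift, mul_neg_one, neg_neg]

theorem scaleUV_mulCycleSum_zero (z : Fin n → ℂ) :
    scaleUV 1 0 (mulCycleSum z) = mulCycleSum z := by
  rw [mulCycleSum, scaleUV_cycleSum]
  simp only [scaleUV_mulShift, scaleUV_mulQuot (show (1 : ℂ) * 1 = 1 by norm_num), mul_one,
    map_one, one_mul]
  rw [cycleSum]

end Rescaling

/-! ### Linearity and locality of the operators `d 1/dx`. -/

section Operators

variable {n : ℕ}

theorem dInvDx_smul (x : ℂ → ℂ) (i : Fin n) (c : ℂ) (f : (Fin n → ℂ) → ℂ) :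
    dInvDx x i (c • f) = c • dInvDx x i f := by
  funext z
  simp only [dInvDx, Pi.smul_apply, smul_eq_mul, mul_div_assoc]
  exact deriv_const_mul_field c

theorem iterate_smul_of_smul {E : Type*} [AddCommGroup E] [Module ℂ E] {T : E → E}
    (h : ∀ (c : ℂ) f, T (c • f) = c • T f) (k : ℕ) (c : ℂ) (f : E) :
    T^[k] (c • f) = c • T^[k] f := by
  induction k generalizing f with
  | zero => rfl
  | succ k ih => rw [Function.iterate_succ_apply, Function.iterate_succ_apply, h, ih]

theorem iterate_neg {E : Type*} [AddCommGroup E] [Module ℂ E] {T : E → E}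
    (h : ∀ (c : ℂ) f, T (c • f) = c • T f) (k : ℕ) (f : E) :
    (fun g => -T g)^[k] f = (-1 : ℂ) ^ k • T^[k] f := by
  induction k with
  | zero => simp
  | succ k ih =>
    rw [Function.iterate_succ_apply', Function.iterate_succ_apply', ih, h, pow_succ', mul_smul,
      neg_one_smul]

theorem opProd_smul {T : Fin n → ((Fin n → ℂ) → ℂ) → (Fin n → ℂ) → ℂ}
    (h : ∀ i (c : ℂ) f, T i (c • f) = c • T i f) (r : Fin n → ℕ) (c : ℂ) (f : (Fin n → ℂ) → ℂ) :
    opProd T r (c • f) = c • opProd T r f := by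
  rw [opProd, opProd]
  induction List.finRange n with
  | nil => rfl
  | cons i l ih => rw [List.foldr_cons, List.foldr_cons, ih, iterate_smul_of_smul (h i)]

theorem opProd_zero {T : Fin n → ((Fin n → ℂ) → ℂ) → (Fin n → ℂ) → ℂ}
    (h : ∀ i (c : ℂ) f, T i (c • f) = c • T i f) (r : Fin n → ℕ) : opProd T r 0 = 0 := by
  simpa using opProd_smul h r 0 0

theorem opProd_neg {T : Fin n → ((Fin n → ℂ) → ℂ) → (Fin n → ℂ) → ℂ}
    (h : ∀ i (c : ℂ) f, T i (c • f) = c • T i f) (r : Fin n → ℕ) (f : (Fin n → ℂ) → ℂ) :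
    opProd (fun i g => -T i g) r f = (-1 : ℂ) ^ (∑ i, r i) • opProd T r f := by
  have key : ∀ l : List (Fin n), l.foldr (fun i F => (fun g => -T i g)^[r i] F) f =
      (-1 : ℂ) ^ (l.map r).sum • l.foldr (fun i F => (T i)^[r i] F) f := by
    intro l
    induction l with
    | nil => simp
    | cons i l ih =>
      rw [List.foldr_cons, List.foldr_cons, ih, iterate_neg (h i), iterate_smul_of_smul (h i),
        List.map_cons, List.sum_cons, pow_add, mul_smul]
  rw [opProd, key, opProd, ← List.ofFn_eq_map, List.sum_ofFn]

theorem dInvDx_congr {x : ℂ → ℂ} {V : Set (Fin n → ℂ)} (hV : IsOpen V) {f g : (Fin n → ℂ) → ℂ}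
    (h : Set.EqOn f g V) (i : Fin n) : Set.EqOn (dInvDx x i f) (dInvDx x i g) V := by
  intro z hz
  refine Filter.EventuallyEq.deriv_eq ?_
  have hc : ContinuousAt (fun t => Function.update z i t) (z i) := by fun_prop
  have : ∀ᶠ t in nhds (z i), Function.update z i t ∈ V :=
    hc.eventually (by
      simp only [Function.update_eq_self]
      exact hV.mem_nhds hz)
  filter_upwards [this] with t ht
  rw [h ht]

theorem iterate_dInvDx_congr {x : ℂ → ℂ} {V : Set (Fin n → ℂ)} (hV : IsOpen V)
    {f g : (Fin n → ℂ) → ℂ} (h : Set.EqOn f g V) (i : Fin n) (k : ℕ) :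
    Set.EqOn ((dInvDx x i)^[k] f) ((dInvDx x i)^[k] g) V := by
  induction k with
  | zero => exact h
  | succ k ih =>
    rw [Function.iterate_succ_apply', Function.iterate_succ_apply']
    exact dInvDx_congr hV ih i

theorem opProd_congr {x : ℂ → ℂ} {V : Set (Fin n → ℂ)} (hV : IsOpen V) {f g : (Fin n → ℂ) → ℂ}
    (h : Set.EqOn f g V) (r : Fin n → ℕ) :
    Set.EqOn (opProd (fun i f => dInvDx x i f) r f) (opProd (fun i f => dInvDx x i f) r g) V := by
  rw [opProd, opProd]
  induction List.finRange n with
  | nil => exact h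
  | cons i l ih => exact iterate_dInvDx_congr hV ih i (r i)

/-- The substitution `u ↦ -u` removes all signs. -/
theorem xyFormula_eq (D : (ℂ → ℂ) → ℂ → ℂ) {W : (Fin n → ℂ) → Ser n}
    (hW : ∀ z, scaleUV (-1) 1 (W z) = W z) (xh : ℕ → ℂ → ℂ) (g : ℕ) (z : Fin n → ℂ) :
    xyFormula D W xh g z = ∑ᶠ r : Fin n → ℕ,
      opProd (fun i f => dInvDx (xh 0) i f) r
        (fun z' => extract (2 * g + 2 * n - 2) 0 (fun i => r i + 1)
          ((∏ i, fexp (-(var (Var.u i) *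
            (applyS D xh (Var.u i) (z' i) - const (xh 0 (z' i)))))) * W z')) z := by
  rw [xyFormula, ← smul_eq_mul, smul_finsum]
  refine finsum_congr fun r => ?_
  rw [opProd_neg (fun i c f => dInvDx_smul (xh 0) i c f), Pi.smul_apply, smul_smul,
    ← Pi.smul_apply, ← opProd_smul (fun i c f => dInvDx_smul (xh 0) i c f)]
  refine congrFun (congrArg _ ?_) z
  funext z'
  have h1 : (∏ i, fexp (-(var (Var.u i) *
      (applyS D xh (Var.u i) (z' i) - const (xh 0 (z' i)))))) * W z' =
      scaleUV (-1) 1 ((∏ i, expS D xh (Var.u i) (z' i)) * W z') := by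
    rw [map_mul, hW, map_prod]
    congr 1
    refine Finset.prod_congr rfl fun i _ => ?_
    rw [scaleUV_expS (by norm_num)]
    simp
  -- The exponents of the `uᵢ` are `rᵢ + 1`, so `u ↦ -u` produces `(-1)^{n + ∑ rᵢ}`: one sign for
  -- each operator and one for each factor of the prefactor `(-1)^n`.
  rw [h1, extract_eq, coeff_scaleUV, Pi.smul_apply, smul_eq_mul, extract_eq]
  simp only [expnt_u, expnt_v, Pi.zero_apply, Finset.sum_const_zero, pow_zero, mul_one,
    Finset.sum_add_distrib, Finset.sum_const, Finset.card_univ, Fintype.card_fin, smul_eq_mul]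
  rw [← pow_add, add_comm n]

end Operators

/-! ### The derivation `z∂` and the logarithm. -/

section Euler

theorem differentiableOn_iterate_eulerD {U : Set ℂ} (hU : IsOpen U) {f : ℂ → ℂ}
    (hf : DifferentiableOn ℂ f U) (a : ℕ) : DifferentiableOn ℂ (eulerD^[a] f) U := by
  induction a with
  | zero => exact hf
  | succ a ih =>
    rw [Function.iterate_succ_apply']
    exact differentiableOn_id.mul (ih.deriv hU)

theorem eulerD_congr {U : Set ℂ} (hU : IsOpen U) {f g : ℂ → ℂ} (h : Set.EqOn f g U) :
    Set.EqOn (eulerD f) (eulerD g) U := fun z hz => by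
  rw [eulerD, eulerD, (h.eventuallyEq_of_mem (hU.mem_nhds hz)).deriv_eq]

theorem iterate_eulerD_sub {U : Set ℂ} (hU : IsOpen U) {f g : ℂ → ℂ}
    (hf : DifferentiableOn ℂ f U) (hg : DifferentiableOn ℂ g U) (a : ℕ) :
    Set.EqOn (eulerD^[a] (fun z => f z - g z)) (fun z => eulerD^[a] f z - eulerD^[a] g z) U := by
  induction a with
  | zero => intro z _; rfl
  | succ a ih =>
    intro z hz
    rw [Function.iterate_succ_apply', eulerD_congr hU ih hz, Function.iterate_succ_apply',
      Function.iterate_succ_apply']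
    simp only [eulerD]
    rw [deriv_fun_sub, mul_sub]
    · exact (differentiableOn_iterate_eulerD hU hf a).differentiableAt (hU.mem_nhds hz)
    · exact (differentiableOn_iterate_eulerD hU hg a).differentiableAt (hU.mem_nhds hz)

theorem deriv_log {U : Set ℂ} (hU : IsOpen U) {l : ℂ → ℂ} (hl : DifferentiableOn ℂ l U)
    (hexp : ∀ z ∈ U, Complex.exp (l z) = z) {z : ℂ} (hz : z ∈ U) : z * deriv l z = 1 := by
  have h1 : HasDerivAt (fun t => Complex.exp (l t)) (Complex.exp (l z) * deriv l z) z :=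
    (hl.differentiableAt (hU.mem_nhds hz)).hasDerivAt.cexp
  have h2 : (fun t => Complex.exp (l t)) =ᶠ[nhds z] id :=
    Set.EqOn.eventuallyEq_of_mem (fun t ht => hexp t ht) (hU.mem_nhds hz)
  have h3 := h1.deriv
  rw [h2.deriv_eq, deriv_id, hexp z hz] at h3
  exact h3.symm

theorem iterate_eulerD_log {U : Set ℂ} (hU : IsOpen U) {l : ℂ → ℂ} (hl : DifferentiableOn ℂ l U)
    (hexp : ∀ z ∈ U, Complex.exp (l z) = z) (a : ℕ) :
    Set.EqOn (eulerD^[a + 2] l) 0 U := by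
  induction a with
  | zero =>
    have h : Set.EqOn (eulerD l) (fun _ => 1) U := fun z hz => deriv_log hU hl hexp hz
    intro z hz
    change eulerD (eulerD l) z = 0
    rw [eulerD_congr hU h hz, eulerD, deriv_const, mul_zero]
  | succ a ih =>
    intro z hz
    rw [Function.iterate_succ_apply', eulerD_congr hU ih hz, eulerD]
    change z * deriv (fun _ => (0 : ℂ)) z = 0
    rw [deriv_const, mul_zero]

end Euler

/-! ### The case `y = log z`. -/

section LogCase

variable {n : ℕ}

open Classical in
theorem coeff_applyS (D : (ℂ → ℂ) → ℂ → ℂ) (f : ℕ → ℂ → ℂ) (w : Var n) (z : ℂ)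
    (e : Var n →₀ ℕ) : MvPowerSeries.coeff e (applyS D f w z) =
      if e = Finsupp.single w (e w) + Finsupp.single Var.h (e Var.h) ∧
        e w ≤ e Var.h ∧ Even (e Var.h - e w) then
      PowerSeries.coeff (e w) S * (D^[e w] (f ((e Var.h - e w) / 2))) z
    else 0 := rfl

/-- For `ŷ = log z - x̂`, the exponent in the Orlov--Scherbin formula is the one of `x̂` with the
opposite sign. -/
theorem expS_log_sub {U : Set ℂ} (hU : IsOpen U) {l : ℂ → ℂ} (hl : DifferentiableOn ℂ l U)
    (hexp : ∀ z ∈ U, Complex.exp (l z) = z) {xh : ℕ → ℂ → ℂ}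
    (hxh : ∀ k, DifferentiableOn ℂ (xh k) U) (i : Fin n) {z : ℂ} (hz : z ∈ U) :
    expS eulerD (fun k w => (if k = 0 then l w else 0) - xh k w) (Var.u i) z =
      fexp (-(var (Var.u i) * (applyS eulerD xh (Var.u i) z - const (xh 0 z)))) := by
  classical
  rw [expS]
  congr 1
  rw [← mul_neg]
  congr 1
  suffices h : applyS eulerD (fun k w => (if k = 0 then l w else 0) - xh k w) (Var.u i) z =
      (const (l z) - applyS eulerD xh (Var.u i) z : Ser n) by
    rw [h]
    simp only [if_true, map_sub]
    ring
  ext e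
  rw [map_sub, coeff_applyS, coeff_applyS, MvPowerSeries.coeff_C]
  have hzero : ∀ a, eulerD^[a] (fun _ => (0 : ℂ)) = fun _ => 0 := by
    intro a
    induction a with
    | zero => rfl
    | succ a ih => rw [Function.iterate_succ_apply', ih]; funext t; simp [eulerD]
  by_cases hc : e = Finsupp.single (Var.u i) (e (Var.u i)) + Finsupp.single Var.h (e Var.h) ∧
      e (Var.u i) ≤ e Var.h ∧ Even (e Var.h - e (Var.u i))
  · rw [if_pos hc, if_pos hc]
    obtain ⟨h1, h2, h3⟩ := hc
    have hl' : ∀ k, DifferentiableOn ℂ (fun w => if k = 0 then l w else 0) U := by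
      intro k
      by_cases hk : k = 0
      · simpa [hk] using hl
      · simp [hk]
    rw [iterate_eulerD_sub hU (hl' _) (hxh _) _ hz, mul_sub]
    congr 1
    generalize ha : e (Var.u i) = a at *
    generalize hb : e Var.h = b at *
    by_cases he : e = 0
    · have ha0 : a = 0 := by rw [← ha, he]; rfl
      have hb0 : b = 0 := by rw [← hb, he]; rfl
      subst ha0 hb0
      simp [he, coeff_zero_S, -PowerSeries.coeff_zero_eq_constantCoeff]
    · rw [if_neg he]
      by_cases hk : (b - a) / 2 = 0
      -- Order zero would force `e = 0`, order one is excluded because `S` is even, and from order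
      -- two on `(z∂)² log z = 0`.
      · rcases a with _ | _ | a
        · obtain ⟨c, hc⟩ := h3
          have : b = 0 := by omega
          subst this
          exact absurd (by simpa using h1) he
        · rw [coeff_S_eq_zero (by decide), zero_mul]
        · simp only [hk, if_true]
          rw [iterate_eulerD_log hU hl hexp a hz]
          simp
      · simp only [hk, if_false]
        rw [hzero, mul_zero]
  · rw [if_neg hc, if_neg hc, if_neg, sub_zero]
    rintro rfl
    exact hc ⟨by simp, by simp, by simp⟩

theorem applyS_id (w : Var n) (t : ℂ) :
    applyS deriv (fun k θ => if k = 0 then θ else 0) w t = const t := by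
  classical
  ext e
  rw [coeff_applyS, MvPowerSeries.coeff_C]
  by_cases he : e = 0
  · subst he
    simp [coeff_zero_S, -PowerSeries.coeff_zero_eq_constantCoeff]
  · rw [if_neg he]
    by_cases hc : e = Finsupp.single w (e w) + Finsupp.single Var.h (e Var.h) ∧
        e w ≤ e Var.h ∧ Even (e Var.h - e w)
    · rw [if_pos hc]
      obtain ⟨h1, h2, h3⟩ := hc
      have hzero : ∀ a, deriv^[a] (fun _ : ℂ => (0 : ℂ)) = fun _ => 0 := by
        intro a
        induction a with
        | zero => rfl
        | succ a ih => rw [Function.iterate_succ_apply', ih]; funext t; simp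
      generalize e w = a at *
      generalize e Var.h = b at *
      by_cases hk : (b - a) / 2 = 0
      · rcases a with _ | _ | a
        · obtain ⟨c, hc⟩ := h3
          have : b = 0 := by omega
          subst this
          exact absurd (by simpa using h1) he
        · rw [coeff_S_eq_zero (by decide), zero_mul]
        · simp only [hk, if_true]
          have : deriv^[a + 2] (fun θ : ℂ => θ) = fun _ => 0 := by
            have h1 : deriv (fun θ : ℂ => θ) = fun _ => 1 := by funext t; exact deriv_id t
            have h2 : deriv (fun _ : ℂ => (1 : ℂ)) = fun _ => 0 := by funext t; simp
            rw [Function.iterate_succ_apply, Function.iterate_succ_apply, h1, h2, hzero]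
          rw [this, mul_zero]
      · simp only [hk, if_false]
        rw [hzero, mul_zero]
    · rw [if_neg hc]

theorem coeff_fexp_var_mul_const (w : Var n) (t : ℂ) (e : Var n →₀ ℕ)
    [Decidable (e = Finsupp.single w (e w))] :
    MvPowerSeries.coeff e (fexp (var w * const t)) =
      if e = Finsupp.single w (e w) then t ^ e w * ((e w)! : ℂ)⁻¹ else 0 := by
  classical
  have h := coeff_sexp (F := (var w * const t : Ser n)) (by simp) e
    (N := e.degree + e w + 1) (by omega)
  refine h.trans ?_
  have h1 : ∀ k, MvPowerSeries.coeff e ((var w * const t : Ser n) ^ k) =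
      if e = Finsupp.single w k then t ^ k else 0 := by
    intro k
    rw [mul_pow, ← map_pow, mul_comm, MvPowerSeries.coeff_C_mul, MvPowerSeries.coeff_X_pow]
    split_ifs <;> simp
  simp only [h1]
  rw [Finset.sum_eq_single (e w)]
  · split_ifs with hh
    · rw [smul_eq_mul, mul_comm]
    · rw [smul_zero]
  · intro k _ hk
    rw [if_neg, smul_zero]
    intro he
    exact hk (by rw [he]; simp)
  · intro hh
    exact absurd (Finset.mem_range.mpr (by omega)) hh

theorem coeff_pow_mul_fexp (w : Var n) (m : ℕ) (t : ℂ) (e : Var n →₀ ℕ)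
    [DecidableEq (Var n →₀ ℕ)] :
    MvPowerSeries.coeff e (var w ^ m * fexp (var w * const t)) =
      if e = Finsupp.single w (e w) ∧ m ≤ e w then t ^ (e w - m) * ((e w - m)! : ℂ)⁻¹ else 0 := by
  rw [MvPowerSeries.X_pow_eq, MvPowerSeries.coeff_monomial_mul, one_mul,
    coeff_fexp_var_mul_const]
  by_cases h : m ≤ e w
  · have h1 : (e - Finsupp.single w m) w = e w - m := by simp
    have h2 : e - Finsupp.single w m = Finsupp.single w (e w - m) ↔
        e = Finsupp.single w (e w) := by
      rw [Finsupp.single_tsub]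
      constructor
      · intro h3
        have h4 : Finsupp.single w m ≤ e := Finsupp.single_le_iff.mpr h
        have h5 : Finsupp.single w m ≤ Finsupp.single w (e w) := Finsupp.single_le_single.mpr h
        rw [← tsub_add_cancel_of_le h4, h3, tsub_add_cancel_of_le h5]
        simp
      · intro h3
        rw [← h3]
    rw [if_pos (Finsupp.single_le_iff.mpr h)]
    simp only [h1, h2, h, and_true]
  · rw [if_neg fun h' => h (Finsupp.single_le_iff.mp h'), if_neg fun h' => h h'.2]

theorem deriv_coeff_fexp (w : Var n) (m : ℕ) (e : Var n →₀ ℕ) :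
    deriv (fun t => MvPowerSeries.coeff e (var w ^ m * fexp (var w * const t))) =
      fun t => MvPowerSeries.coeff e (var w ^ (m + 1) * fexp (var w * const t)) := by
  classical
  funext t
  simp only [coeff_pow_mul_fexp]
  by_cases h : e = Finsupp.single w (e w)
  · rcases lt_trichotomy (e w) m with h1 | h1 | h1
    · simp [show ¬ m ≤ e w by omega, show ¬ m + 1 ≤ e w by omega]
    · simp [h1]
    · obtain ⟨k, hk⟩ : ∃ k, e w = m + 1 + k := ⟨e w - (m + 1), by omega⟩
      have h2 : e w - m = k + 1 := by omega
      have h3 : e w - (m + 1) = k := by omega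
      simp only [← h, true_and, show m ≤ e w by omega, show m + 1 ≤ e w by omega, if_true, h2, h3]
      rw [deriv_mul_const_field, deriv_pow_field, Nat.factorial_succ]
      have h4 : ((k + 1 : ℕ) : ℂ) ≠ 0 := by exact_mod_cast Nat.succ_ne_zero k
      have h5 : ((k ! : ℕ) : ℂ) ≠ 0 := by exact_mod_cast k.factorial_ne_zero
      push_cast at h4 ⊢
      field_simp
  · simp [h]

/-- Since `S(vħ∂)θ = θ`, the factor is `e^{-vθ} ∂_θ^r e^{vθ} = v^r`. -/
theorem psiFactor_id (i : Fin n) (r : ℕ) (θ : ℂ) :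
    psiFactor (fun k θ => if k = 0 then θ else 0) i r θ = var (Var.v i) ^ r := by
  have h : thetaDeriv r (fun t => fexp (var (Var.v i) *
      applyS deriv (fun k θ => if k = 0 then θ else 0) (Var.v i) t)) θ =
      (var (Var.v i) ^ r * fexp (var (Var.v i) * const θ) : Ser n) := by
    ext e
    change iteratedDeriv r _ θ = _
    simp only [applyS_id (Var.v i)]
    have key : ∀ m, iteratedDeriv r
        (fun t => MvPowerSeries.coeff e (var (Var.v i) ^ m * fexp (var (Var.v i) * const t))) =
        fun t => MvPowerSeries.coeff e
          (var (Var.v i) ^ (m + r) * fexp (var (Var.v i) * const t) : Ser n) := by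
      induction r with
      | zero => intro m; rw [iteratedDeriv_zero, add_zero]
      | succ r ih =>
        intro m
        rw [iteratedDeriv_succ', deriv_coeff_fexp, ih, add_assoc, add_comm 1]
    have := congrFun (key 0) θ
    simpa using this
  rw [psiFactor, h]
  simp only [if_true]
  rw [mul_left_comm]
  have := sexp_neg_mul (F := (var (Var.v i) * const θ : Ser n)) (by simp)
  change var (Var.v i) ^ r * (sexp (-(var (Var.v i) * const θ)) * sexp (var (Var.v i) * const θ)) = _
  rw [this, mul_one]

theorem finsum_diagonal {α : Type*} [DecidableEq α] (f : α → ℂ) :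
    ∑ᶠ p : α × α, (if p.1 = p.2 then f p.2 else 0) = ∑ᶠ a, f a := by
  have h := finsum_mem_range (f := fun p : α × α => if p.1 = p.2 then f p.2 else 0)
    (g := fun a => (a, a)) fun a b h => congrArg Prod.fst h
  simp only [if_true] at h
  classical
  rw [← h]
  refine finsum_congr fun p => ?_
  by_cases hp : p.1 = p.2
  · have : p ∈ Set.range fun a : α => (a, a) := ⟨p.1, by ext <;> simp [hp]⟩
    rw [finsum_eq_if, if_pos this]
  · rw [if_neg hp, finsum_eq_if, ite_self]

theorem prod_var_pow (r : Fin n → ℕ) : (∏ i, var (Var.v i) ^ r i : Ser n) =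
    MvPowerSeries.monomial (∑ i, Finsupp.single (Var.v i) (r i)) 1 := by
  classical
  have : ∀ s : Finset (Fin n), (∏ i ∈ s, var (Var.v i) ^ r i : Ser n) =
      MvPowerSeries.monomial (∑ i ∈ s, Finsupp.single (Var.v i) (r i)) 1 := by
    intro s
    induction s using Finset.induction_on with
    | empty => rfl
    | insert a s ha ih =>
      rw [Finset.prod_insert ha, Finset.sum_insert ha, ih, MvPowerSeries.X_pow_eq,
        MvPowerSeries.monomial_mul_monomial, one_mul]
  exact this _

/-- Invariance under `v ↦ 0` says that `Q` does not involve the `vᵢ`, so the monomial `v^r` alone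
decides which power of `v` occurs. -/
theorem extract_prod_var_pow_mul {Q : Ser n} (hQ : scaleUV 1 0 Q = Q) (N : ℕ)
    (j r k : Fin n → ℕ) : extract N j k ((∏ i, var (Var.v i) ^ r i) * Q) =
      if j = r then extract N 0 k Q else 0 := by
  classical
  rw [prod_var_pow, extract_eq]
  have hsum : ∀ i, (∑ i, Finsupp.single (Var.v i) (r i) : Var n →₀ ℕ) (Var.v i) = r i := by
    intro i
    simp [Finsupp.single_apply]
  split_ifs with h
  · subst h
    have : expnt N j k = ∑ i, Finsupp.single (Var.v i) (j i) + expnt N 0 k := by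
      simp only [expnt, Pi.zero_apply, Finsupp.single_zero, Finset.sum_const_zero, add_zero]
      abel
    rw [this, MvPowerSeries.coeff_add_monomial_mul, one_mul, extract_eq]
  · rw [MvPowerSeries.coeff_monomial_mul]
    split_ifs with h1
    · obtain ⟨i, hi⟩ := Function.ne_iff.mp h
      have h2 := h1 (Var.v i)
      rw [hsum, expnt_v] at h2
      have h3 : (expnt N j k - ∑ i, Finsupp.single (Var.v i) (r i)) (Var.v i) ≠ 0 := by
        rw [Finsupp.tsub_apply, hsum, expnt_v]
        omega
      rw [← hQ, coeff_scaleUV, zero_pow, mul_zero, zero_mul, mul_zero]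
      intro h4
      exact h3 (Finset.sum_eq_zero_iff.mp h4 i (Finset.mem_univ i))
    · rfl

theorem osX_log (l : ℂ → ℂ) (xh : ℕ → ℂ → ℂ) :
    osX l (fun k θ => if k = 0 then θ else 0)
      (fun k w => (if k = 0 then l w else 0) - xh k w) = xh 0 := by
  funext z
  simp [osX]

/-- The exponent `v(S(vħ∂)θ - θ)` is zero, and its exponential `1` contains no positive power of
`v`. -/
theorem osExtra_log (l : ℂ → ℂ) (yh : ℕ → ℂ → ℂ) {g : ℕ} (hg : g ≠ 0) (i : Fin n)
    (z : Fin n → ℂ) : osExtra l (fun k θ => if k = 0 then θ else 0) yh g i z = 0 := by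
  classical
  rw [osExtra, if_neg hg, zero_add]
  refine finsum_eq_zero_of_forall_eq_zero fun j => ?_
  have h : (fun z' : Fin n → ℂ => extract (2 * g) (Pi.single i (j + 1)) 0
      (expS deriv (fun k θ => if k = 0 then θ else 0) (Var.v i) (yh 0 (z' i))) *
        deriv (yh 0) (z' i)) = (0 : ℂ) • fun _ => 0 := by
    funext z'
    have h1 : (expS deriv (fun k θ => if k = 0 then θ else 0) (Var.v i) (yh 0 (z' i)) : Ser n) =
        1 := by
      rw [expS, applyS_id]
      simp only [if_true, sub_self, mul_zero]
      exact sexp_zero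
    have h2 : expnt (2 * g) (Pi.single i (j + 1)) (0 : Fin n → ℕ) ≠ 0 := by
      intro h0
      have := congrArg (fun e => e (Var.v i)) h0
      simp at this
    rw [h1, extract_eq, MvPowerSeries.coeff_one, if_neg h2]
    simp
  rw [h, iterate_smul_of_smul (dInvDx_smul _ i), zero_smul]
  rfl

/-- The case `y = log z`. -/
theorem omegaYlog_eq_omegaOS {U : Set ℂ} (hU : IsOpen U) {l : ℂ → ℂ}
    (hl : DifferentiableOn ℂ l U) (hexp : ∀ z ∈ U, Complex.exp (l z) = z) {xh : ℕ → ℂ → ℂ}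
    (hxh : ∀ k, DifferentiableOn ℂ (xh k) U) {g : ℕ} (hgn : (g, n) ≠ (0, 1))
    {z : Fin n → ℂ} (hz : ∀ i, z i ∈ U) :
    omegaYlog xh g n z = omegaOS l (fun k θ => if k = 0 then θ else 0)
      (fun k w => (if k = 0 then l w else 0) - xh k w) g n z := by
  classical
  have hextra : (if n = 1 then ∑ i : Fin n, osExtra l (fun k θ => if k = 0 then θ else 0)
      (fun k w => (if k = 0 then l w else 0) - xh k w) g i z else 0) = 0 := by
    split_ifs with h
    · exact Finset.sum_eq_zero fun i _ =>
        osExtra_log l _ (fun hg => hgn (by rw [hg, h])) i z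
    · rfl
  rw [omegaOS, hextra, add_zero, osMain, osX_log, omegaYlog, xyFormula_eq _ flip_mulCycleSum]
  have hV : IsOpen (Set.univ.pi fun _ : Fin n => U) := isOpen_set_pi Set.finite_univ fun _ _ => hU
  obtain ⟨Q, hQ⟩ : ∃ Q : (Fin n → ℂ) → Ser n, Q = fun z' => (∏ i, expS eulerD
    (fun k w => (if k = 0 then l w else 0) - xh k w) (Var.u i) (z' i)) * mulCycleSum z' := ⟨_, rfl⟩
  have hQv : ∀ z', scaleUV 1 0 (Q z') = Q z' := by
    intro z'
    rw [hQ, map_mul, scaleUV_mulCycleSum_zero, map_prod]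
    congr 1
    refine Finset.prod_congr rfl fun i _ => ?_
    rw [scaleUV_expS (by norm_num), show (const 1 : Ser n) = 1 from map_one _, one_mul]
    rfl
  -- The factor `v^r` leaves only the diagonal `j = r` of the double sum.
  have hF : ∀ jr : (Fin n → ℕ) × (Fin n → ℕ),
      opProd (fun i f => dInvDx (xh 0) i f) jr.1 (fun z' => extract (2 * g + 2 * n - 2) jr.1
        (fun i => jr.2 i + 1) ((∏ i, psiFactor (fun k θ => if k = 0 then θ else 0) i (jr.2 i)
          ((fun k w => (if k = 0 then l w else 0) - xh k w) 0 (z' i))) *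
            (∏ i, expS eulerD (fun k w => (if k = 0 then l w else 0) - xh k w) (Var.u i) (z' i)) *
              mulCycleSum z')) z =
      if jr.1 = jr.2 then opProd (fun i f => dInvDx (xh 0) i f) jr.2
        (fun z' => extract (2 * g + 2 * n - 2) 0 (fun i => jr.2 i + 1) (Q z')) z else 0 := by
    rintro ⟨j, r⟩
    have h1 : ∀ z' : Fin n → ℂ, extract (2 * g + 2 * n - 2) j
        (fun i => r i + 1) ((∏ i, psiFactor (fun k θ => if k = 0 then θ else 0) i (r i)
          ((fun k w => (if k = 0 then l w else 0) - xh k w) 0 (z' i))) *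
            (∏ i, expS eulerD (fun k w => (if k = 0 then l w else 0) - xh k w) (Var.u i) (z' i)) *
              mulCycleSum z') =
        if j = r then extract (2 * g + 2 * n - 2) 0 (fun i => r i + 1) (Q z') else 0 := by
      intro z'
      simp only [psiFactor_id]
      rw [mul_assoc, ← extract_prod_var_pow_mul (hQv z'), hQ]
    refine (congrArg (fun F => opProd (fun i f => dInvDx (xh 0) i f) j F z) (funext h1)).trans ?_
    by_cases h : j = r
    · subst h
      simp only [if_true]
    · simp only [if_neg h]
      exact congrFun (opProd_zero (fun i c f => dInvDx_smul (xh 0) i c f) j) z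
  rw [finsum_congr hF]
  refine Eq.trans ?_ (finsum_diagonal fun r => opProd (fun i f => dInvDx (xh 0) i f) r
    (fun z' => extract (2 * g + 2 * n - 2) 0 (fun i => r i + 1) (Q z')) z).symm
  have hflip : ∀ z' ∈ Set.univ.pi fun _ : Fin n => U, (∏ i, fexp (-(var (Var.u i) *
      (applyS eulerD xh (Var.u i) (z' i) - const (xh 0 (z' i)))))) * mulCycleSum z' = Q z' := by
    intro z' hz'
    rw [hQ]
    refine congrArg (· * mulCycleSum z') (Finset.prod_congr rfl fun i _ => ?_)
    rw [expS_log_sub hU hl hexp hxh i (hz' i (Set.mem_univ i))]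
  refine finsum_congr fun r => ?_
  -- The two exponents agree only for points of `U`. This suffices because the operators are local
  -- and the set of tuples in `U` is open.
  refine opProd_congr hV ?_ r (show z ∈ Set.univ.pi fun _ : Fin n => U from fun i _ => hz i)
  intro z' hz'
  exact congrArg (extract _ _ _) (hflip z' hz')

end LogCase

/-! ### Series in `ħ` over polynomials as series in all the formal variables. -/

section ToVar

variable {n : ℕ}

theorem var_finsupp_ext {e e' : Var n →₀ ℕ} (hh : e Var.h = e' Var.h)
    (hu : ∀ i, e (Var.u i) = e' (Var.u i)) (hv : ∀ i, e (Var.v i) = e' (Var.v i)) : e = e' :=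
  Finsupp.ext fun w => by
    cases w with
    | h => exact hh
    | u i => exact hu i
    | v i => exact hv i

/-- The exponents of the variables `uᵢ`. -/
def uPart : (Var n →₀ ℕ) →+ (Fin n →₀ ℕ) where
  toFun e := Finsupp.equivFunOnFinite.symm fun i => e (Var.u i)
  map_zero' := Finsupp.ext fun i => by simp
  map_add' _ _ := Finsupp.ext fun i => by simp

/-- The exponents of the variables `vᵢ`. -/
def vPart : (Var n →₀ ℕ) →+ (Fin n →₀ ℕ) where
  toFun e := Finsupp.equivFunOnFinite.symm fun i => e (Var.v i)
  map_zero' := Finsupp.ext fun i => by simp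
  map_add' _ _ := Finsupp.ext fun i => by simp

@[simp] theorem uPart_apply (e : Var n →₀ ℕ) (i : Fin n) : uPart e i = e (Var.u i) := by
  simp [uPart]

@[simp] theorem vPart_apply (e : Var n →₀ ℕ) (i : Fin n) : vPart e i = e (Var.v i) := by
  simp [vPart]

/-- Splitting an exponent into two summands can be done separately for `ħ`, the `uᵢ` and the `vᵢ`.
This is the multiplicativity of `toVar`. -/
theorem sum_antidiagonal_var [DecidableEq (Var n)] {M : Type*} [AddCommMonoid M] (e : Var n →₀ ℕ)
    (f : ℕ → ℕ → (Fin n →₀ ℕ) → (Fin n →₀ ℕ) → (Fin n →₀ ℕ) → (Fin n →₀ ℕ) → M) :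
    ∑ p ∈ antidiagonal e, f (p.1 Var.h) (p.2 Var.h) (uPart p.1) (uPart p.2) (vPart p.1)
      (vPart p.2) = ∑ a ∈ antidiagonal (e Var.h), ∑ b ∈ antidiagonal (uPart e),
        ∑ c ∈ antidiagonal (vPart e), f a.1 a.2 b.1 b.2 c.1 c.2 := by
  rw [Finset.sum_sigma']
  simp only [Finset.sum_sigma']
  refine Finset.sum_nbij'
    (fun p => ⟨⟨(p.1 Var.h, p.2 Var.h), (uPart p.1, uPart p.2)⟩, (vPart p.1, vPart p.2)⟩)
    (fun x => (expnt x.1.1.1 x.2.1 x.1.2.1, expnt x.1.1.2 x.2.2 x.1.2.2)) ?_ ?_ ?_ ?_ ?_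
  · intro p hp
    have hp' : p.1 + p.2 = e := mem_antidiagonal.mp hp
    simp only [Finset.mem_sigma, mem_antidiagonal]
    refine ⟨⟨?_, ?_⟩, ?_⟩
    · rw [← hp']; rfl
    · rw [← hp', map_add]
    · rw [← hp', map_add]
  · rintro ⟨⟨a, b⟩, c⟩ h
    simp only [Finset.mem_sigma, mem_antidiagonal] at h
    refine mem_antidiagonal.mpr (var_finsupp_ext ?_ (fun i => ?_) (fun i => ?_))
    · simpa using h.1.1
    · have := DFunLike.congr_fun h.1.2 i
      simpa using this
    · have := DFunLike.congr_fun h.2 i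
      simpa using this
  · intro p _
    ext1 <;> exact var_finsupp_ext (by simp) (by simp) (by simp)
  · rintro ⟨⟨⟨a, a'⟩, ⟨b, b'⟩⟩, ⟨c, c'⟩⟩ _
    have h1 : ∀ N (r s : Fin n →₀ ℕ), uPart (expnt N s r) = r := fun N r s =>
      Finsupp.ext fun i => by simp
    have h2 : ∀ N (r s : Fin n →₀ ℕ), vPart (expnt N s r) = s := fun N r s =>
      Finsupp.ext fun i => by simp
    simp [h1, h2]
  · intro p _
    rfl

section

variable {A : Type*} [CommRing A]

/-- The function underlying `toVar`. -/
def toVarFun (F : PowerSeries (MvPolynomial (Fin n) (MvPolynomial (Fin n) A))) :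
    MvPowerSeries (Var n) A := fun e =>
  MvPolynomial.coeff (vPart e) (MvPolynomial.coeff (uPart e) (PowerSeries.coeff (e Var.h) F))

theorem coeff_toVarFun (F : PowerSeries (MvPolynomial (Fin n) (MvPolynomial (Fin n) A)))
    (e : Var n →₀ ℕ) : MvPowerSeries.coeff e (toVarFun F) =
      MvPolynomial.coeff (vPart e)
        (MvPolynomial.coeff (uPart e) (PowerSeries.coeff (e Var.h) F)) := rfl

/-- Power series in `ħ` with polynomial coefficients as power series in all variables: the outer
polynomial variables become the `uᵢ`, the inner ones the `vᵢ`. -/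
def toVar : PowerSeries (MvPolynomial (Fin n) (MvPolynomial (Fin n) A)) →+*
    MvPowerSeries (Var n) A where
  toFun := toVarFun
  map_zero' := by
    ext e
    simp [coeff_toVarFun]
  map_add' F G := by
    ext e
    simp [coeff_toVarFun]
  map_one' := by
    classical
    ext e
    rw [coeff_toVarFun, PowerSeries.coeff_one, MvPowerSeries.coeff_one]
    by_cases he : e = 0
    · subst he; simp
    · rw [if_neg he]
      by_cases h1 : e Var.h = 0
      · rw [if_pos h1, MvPolynomial.coeff_one]
        by_cases h2 : 0 = uPart e
        · rw [if_pos h2, MvPolynomial.coeff_one, if_neg]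
          intro h3
          refine he (var_finsupp_ext h1 (fun i => ?_) fun i => ?_)
          · simpa using (DFunLike.congr_fun h2 i).symm
          · simpa using (DFunLike.congr_fun h3 i).symm
        · rw [if_neg h2, MvPolynomial.coeff_zero]
      · rw [if_neg h1, MvPolynomial.coeff_zero, MvPolynomial.coeff_zero]
  map_mul' F G := by
    classical
    ext e
    rw [coeff_toVarFun, MvPowerSeries.coeff_mul, PowerSeries.coeff_mul, MvPolynomial.coeff_sum,
      MvPolynomial.coeff_sum]
    simp only [MvPolynomial.coeff_mul, MvPolynomial.coeff_sum]
    exact (sum_antidiagonal_var e fun a a' b b' c c' =>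
      MvPolynomial.coeff c (MvPolynomial.coeff b (PowerSeries.coeff a F)) *
        MvPolynomial.coeff c' (MvPolynomial.coeff b' (PowerSeries.coeff a' G))).symm

theorem coeff_toVar (F : PowerSeries (MvPolynomial (Fin n) (MvPolynomial (Fin n) A)))
    (e : Var n →₀ ℕ) : MvPowerSeries.coeff e (toVar F) =
      MvPolynomial.coeff (vPart e)
        (MvPolynomial.coeff (uPart e) (PowerSeries.coeff (e Var.h) F)) := rfl

theorem coeff_expnt_toVar (F : PowerSeries (MvPolynomial (Fin n) (MvPolynomial (Fin n) A)))
    (N : ℕ) (j r : Fin n →₀ ℕ) : MvPowerSeries.coeff (expnt N j r) (toVar F) =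
      MvPolynomial.coeff j (MvPolynomial.coeff r (PowerSeries.coeff N F)) := by
  have h1 : uPart (expnt N j r) = r := Finsupp.ext fun i => by simp
  have h2 : vPart (expnt N j r) = j := Finsupp.ext fun i => by simp
  rw [coeff_toVar, h1, h2, expnt_h]

theorem toVar_X : toVar (PowerSeries.X : PowerSeries (MvPolynomial (Fin n)
    (MvPolynomial (Fin n) A))) = MvPowerSeries.X Var.h := by
  classical
  ext e
  rw [coeff_toVar, PowerSeries.coeff_X, MvPowerSeries.coeff_X]
  by_cases he : e = Finsupp.single Var.h 1
  · subst he
    have h1 : uPart (Finsupp.single (Var.h : Var n) 1) = 0 := Finsupp.ext fun i => by simp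
    have h2 : vPart (Finsupp.single (Var.h : Var n) 1) = 0 := Finsupp.ext fun i => by simp
    simp [h1, h2]
  · rw [if_neg he]
    by_cases h1 : e Var.h = 1
    · rw [if_pos h1, MvPolynomial.coeff_one]
      by_cases h2 : 0 = uPart e
      · rw [if_pos h2, MvPolynomial.coeff_one, if_neg]
        intro h3
        refine he (var_finsupp_ext (by simp [h1]) (fun i => ?_) fun i => ?_)
        · simpa using (DFunLike.congr_fun h2 i).symm
        · simpa using (DFunLike.congr_fun h3 i).symm
      · rw [if_neg h2, MvPolynomial.coeff_zero]
    · rw [if_neg h1, MvPolynomial.coeff_zero, MvPolynomial.coeff_zero]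

theorem toVar_C (a : A) : toVar (PowerSeries.C (MvPolynomial.C (MvPolynomial.C a)) :
    PowerSeries (MvPolynomial (Fin n) (MvPolynomial (Fin n) A))) = MvPowerSeries.C a := by
  classical
  ext e
  rw [coeff_toVar, PowerSeries.coeff_C, MvPowerSeries.coeff_C]
  by_cases he : e = 0
  · subst he; simp
  · rw [if_neg he]
    by_cases h1 : e Var.h = 0
    · rw [if_pos h1, MvPolynomial.coeff_C]
      by_cases h2 : 0 = uPart e
      · rw [if_pos h2, MvPolynomial.coeff_C, if_neg]
        intro h3
        refine he (var_finsupp_ext h1 (fun i => ?_) fun i => ?_)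
        · simpa using (DFunLike.congr_fun h2 i).symm
        · simpa using (DFunLike.congr_fun h3 i).symm
      · rw [if_neg h2, MvPolynomial.coeff_zero]
    · rw [if_neg h1, MvPolynomial.coeff_zero, MvPolynomial.coeff_zero]

theorem toVar_u (i : Fin n) : toVar (PowerSeries.C (MvPolynomial.X i) :
    PowerSeries (MvPolynomial (Fin n) (MvPolynomial (Fin n) A))) =
      MvPowerSeries.X (Var.u i) := by
  classical
  ext e
  rw [coeff_toVar, PowerSeries.coeff_C, MvPowerSeries.coeff_X]
  by_cases he : e = Finsupp.single (Var.u i) 1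
  · subst he
    have h1 : uPart (Finsupp.single (Var.u i) 1) = Finsupp.single i 1 :=
      Finsupp.ext fun j => by simp [Finsupp.single_apply]
    have h2 : vPart (Finsupp.single (Var.u i) 1) = 0 := Finsupp.ext fun i => by simp
    simp [h1, h2]
  · rw [if_neg he]
    by_cases h1 : e Var.h = 0
    · rw [if_pos h1, MvPolynomial.coeff_X]
      by_cases h2 : Finsupp.single i 1 = uPart e
      · rw [if_pos h2, MvPolynomial.coeff_one, if_neg]
        intro h3
        refine he (var_finsupp_ext (by simp [h1]) (fun j => ?_) fun j => ?_)
        · simpa [Finsupp.single_apply] using (DFunLike.congr_fun h2 j).symm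
        · simpa using (DFunLike.congr_fun h3 j).symm
      · rw [if_neg h2, MvPolynomial.coeff_zero]
    · rw [if_neg h1, MvPolynomial.coeff_zero, MvPolynomial.coeff_zero]

theorem toVar_v (i : Fin n) : toVar (PowerSeries.C (MvPolynomial.C (MvPolynomial.X i)) :
    PowerSeries (MvPolynomial (Fin n) (MvPolynomial (Fin n) A))) =
      MvPowerSeries.X (Var.v i) := by
  classical
  ext e
  rw [coeff_toVar, PowerSeries.coeff_C, MvPowerSeries.coeff_X]
  by_cases he : e = Finsupp.single (Var.v i) 1
  · subst he
    have h1 : vPart (Finsupp.single (Var.v i) 1) = Finsupp.single i 1 :=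
      Finsupp.ext fun j => by simp [Finsupp.single_apply]
    have h2 : uPart (Finsupp.single (Var.v i) 1) = 0 := Finsupp.ext fun i => by simp
    simp [h1, h2]
  · rw [if_neg he]
    by_cases h1 : e Var.h = 0
    · rw [if_pos h1, MvPolynomial.coeff_C]
      by_cases h2 : 0 = uPart e
      · rw [if_pos h2, MvPolynomial.coeff_X, if_neg]
        intro h3
        refine he (var_finsupp_ext (by simp [h1]) (fun j => ?_) fun j => ?_)
        · simpa using (DFunLike.congr_fun h2 j).symm
        · simpa [Finsupp.single_apply] using (DFunLike.congr_fun h3 j).symm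
      · rw [if_neg h2, MvPolynomial.coeff_zero]
    · rw [if_neg h1, MvPolynomial.coeff_zero, MvPolynomial.coeff_zero]

theorem constantCoeff_toVar (F : PowerSeries (MvPolynomial (Fin n) (MvPolynomial (Fin n) A)))
    (hF : PowerSeries.constantCoeff F = 0) : MvPowerSeries.constantCoeff (toVar F) = 0 := by
  rw [← MvPowerSeries.coeff_zero_eq_constantCoeff_apply, coeff_toVar]
  simp [hF]

end

variable {A : Type*} [CommRing A] [Algebra ℂ A]

theorem toVar_subst (f : PowerSeries ℂ)
    {F : PowerSeries (MvPolynomial (Fin n) (MvPolynomial (Fin n) A))}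
    (hF : PowerSeries.constantCoeff F = 0) : toVar (f.subst F) = f.subst (toVar F) :=
  map_subst_of_coeff (τ := Unit) toVar (fun e => Finsupp.single () (e Var.h))
    (fun e => ((MvPolynomial.lcoeff A (vPart e)).restrictScalars ℂ) ∘ₗ
      ((MvPolynomial.lcoeff (MvPolynomial (Fin n) A) (uPart e)).restrictScalars ℂ))
    (fun _ _ => rfl) f hF (constantCoeff_toVar F hF)

theorem toVar_sexp {F : PowerSeries (MvPolynomial (Fin n) (MvPolynomial (Fin n) A))}
    (hF : PowerSeries.constantCoeff F = 0) : toVar (sexp F) = sexp (toVar F) := toVar_subst _ hF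

theorem map_subst_complex {τ R R' : Type*} [CommRing R] [Algebra ℂ R] [CommRing R'] [Algebra ℂ R']
    (f : R →ₐ[ℂ] R') (p : PowerSeries ℂ) {F : MvPowerSeries τ R}
    (hF : MvPowerSeries.constantCoeff F = 0) :
    MvPowerSeries.map f.toRingHom (p.subst F) = p.subst (MvPowerSeries.map f.toRingHom F) :=
  map_subst_of_coeff (MvPowerSeries.map f.toRingHom) id (fun _ => f.toLinearMap)
    (fun _ _ => rfl) p hF (by rw [MvPowerSeries.constantCoeff_map, hF, map_zero])

theorem map_sexp {τ R R' : Type*} [CommRing R] [Algebra ℂ R] [CommRing R'] [Algebra ℂ R']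
    (f : R →ₐ[ℂ] R') {F : MvPowerSeries τ R} (hF : MvPowerSeries.constantCoeff F = 0) :
    MvPowerSeries.map f.toRingHom (sexp F) = sexp (MvPowerSeries.map f.toRingHom F) :=
  map_subst_complex f _ hF

theorem scaled_eq_subst {R : Type*} [CommRing R] [Algebra ℂ R] (f : PowerSeries ℂ) (a : R) :
    scaled f a = f.subst (PowerSeries.C a * PowerSeries.X : PowerSeries R) := by
  ext k
  have h := coeff_subst_eq_sum (τ := Unit) f (F := (PowerSeries.C a * PowerSeries.X :
    PowerSeries R)) (by
      change PowerSeries.constantCoeff _ = 0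
      simp) (Finsupp.single () k) (N := k + 1) (by simp)
  refine Eq.trans ?_ h.symm
  have h1 : ∀ m, MvPowerSeries.coeff (Finsupp.single () k)
      ((PowerSeries.C a * PowerSeries.X : PowerSeries R) ^ m) = if k = m then a ^ m else 0 := by
    intro m
    change PowerSeries.coeff k _ = _
    rw [mul_pow, ← map_pow, PowerSeries.coeff_C_mul, PowerSeries.coeff_X_pow]
    split_ifs <;> simp
  rw [Finset.sum_eq_single k]
  · rw [h1, if_pos rfl, coeff_scaled, Algebra.smul_def, mul_comm]
  · intro m _ hm
    rw [h1, if_neg (Ne.symm hm), smul_zero]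
  · intro hk
    exact absurd (Finset.mem_range.mpr (Nat.lt_succ_self k)) hk

/-- The evaluation of a power series in all variables with coefficients in `A` along a character
of `A`. -/
def evSer (ev : A →ₐ[ℂ] ℂ) : MvPowerSeries (Var n) A →+* Ser n := MvPowerSeries.map ev.toRingHom

theorem coeff_evSer (ev : A →ₐ[ℂ] ℂ) (F : MvPowerSeries (Var n) A) (e : Var n →₀ ℕ) :
    MvPowerSeries.coeff e (evSer ev F) = ev (MvPowerSeries.coeff e F) := rfl

theorem evSer_sexp (ev : A →ₐ[ℂ] ℂ) {F : MvPowerSeries (Var n) A}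
    (hF : MvPowerSeries.constantCoeff F = 0) : evSer ev (sexp F) = fexp (evSer ev F) :=
  map_sexp ev hF

@[simp] theorem evSer_X (ev : A →ₐ[ℂ] ℂ) (w : Var n) :
    evSer ev (MvPowerSeries.X w) = var w := by simp [evSer]

@[simp] theorem evSer_C (ev : A →ₐ[ℂ] ℂ) (a : A) :
    evSer ev (MvPowerSeries.C a) = const (n := n) (ev a) := by simp [evSer]

theorem evSer_toVar_scaled (ev : A →ₐ[ℂ] ℂ) (f : PowerSeries ℂ) (i : Fin n) :
    evSer ev (toVar (scaled f (MvPolynomial.X i))) =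
      f.subst (var (Var.u i) * var Var.h : Ser n) := by
  rw [scaled_eq_subst, toVar_subst _ (by simp), map_mul, toVar_u, toVar_X, evSer,
    map_subst_complex _ _ (by simp)]
  simp

theorem evSer_toVar_expU (ev : A →ₐ[ℂ] ℂ) (c : ℂ) (i : Fin n) :
    evSer ev (toVar (Coords.expU (MvPolynomial (Fin n) A) c i)) =
      fexp (const c * (var (Var.u i) * var Var.h) : Ser n) := by
  rw [Coords.expU, expSer, evSer_toVar_scaled, fexp]
  have hs : PowerSeries.HasSubst (var (Var.u i) * var Var.h : Ser n) :=
    PowerSeries.HasSubst.of_constantCoeff_zero (by simp)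
  rw [PowerSeries.rescale_eq_subst,
    PowerSeries.subst_comp_subst_apply (PowerSeries.HasSubst.smul_X' c) hs,
    PowerSeries.subst_smul hs, PowerSeries.subst_X hs, MvPowerSeries.smul_eq_C_mul]

/-- The inclusion of series in `ħ` and the `vᵢ`. -/
def vSer (n : ℕ) (A : Type*) [CommRing A] [Algebra ℂ A] : PowerSeries (MvPolynomial (Fin n) A) →+*
    PowerSeries (MvPolynomial (Fin n) (MvPolynomial (Fin n) A)) :=
  MvPowerSeries.map (IsScalarTower.toAlgHom ℂ (MvPolynomial (Fin n) A)
    (MvPolynomial (Fin n) (MvPolynomial (Fin n) A))).toRingHom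

/-- The inclusion of series in `ħ` and polynomial variables that become the `uᵢ`. -/
def uSer (n : ℕ) (A : Type*) [CommRing A] [Algebra ℂ A] : PowerSeries (MvPolynomial (Fin n) A) →+*
    PowerSeries (MvPolynomial (Fin n) (MvPolynomial (Fin n) A)) :=
  MvPowerSeries.map (MvPolynomial.mapAlgHom (σ := Fin n)
    (IsScalarTower.toAlgHom ℂ A (MvPolynomial (Fin n) A))).toRingHom

theorem coeff_vSer (F : PowerSeries (MvPolynomial (Fin n) A)) (k : ℕ) :
    PowerSeries.coeff k (vSer n A F) = MvPolynomial.C (PowerSeries.coeff k F) := rfl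

theorem coeff_uSer (F : PowerSeries (MvPolynomial (Fin n) A)) (k : ℕ) :
    PowerSeries.coeff k (uSer n A F) = MvPolynomial.map MvPolynomial.C (PowerSeries.coeff k F) :=
  rfl

theorem vSer_sexp {F : PowerSeries (MvPolynomial (Fin n) A)}
    (hF : PowerSeries.constantCoeff F = 0) : vSer n A (sexp F) = sexp (vSer n A F) :=
  map_sexp _ hF

theorem uSer_sexp {F : PowerSeries (MvPolynomial (Fin n) A)}
    (hF : PowerSeries.constantCoeff F = 0) : uSer n A (sexp F) = sexp (uSer n A F) :=
  map_sexp _ hF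

theorem uSer_X : uSer n A PowerSeries.X = PowerSeries.X := MvPowerSeries.map_X _ _

theorem vSer_C (p : MvPolynomial (Fin n) A) :
    vSer n A (PowerSeries.C p) = PowerSeries.C (MvPolynomial.C p) := MvPowerSeries.map_C _ _

theorem uSer_C (p : MvPolynomial (Fin n) A) :
    uSer n A (PowerSeries.C p) = PowerSeries.C (MvPolynomial.map MvPolynomial.C p) :=
  MvPowerSeries.map_C _ _

open Classical in
theorem coeff_toVar_vSer (F : PowerSeries (MvPolynomial (Fin n) A)) (e : Var n →₀ ℕ) :
    MvPowerSeries.coeff e (toVar (vSer n A F)) =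
      if uPart e = 0 then MvPolynomial.coeff (vPart e) (PowerSeries.coeff (e Var.h) F) else 0 := by
  rw [coeff_toVar, coeff_vSer, MvPolynomial.coeff_C]
  by_cases h : uPart e = 0
  · rw [if_pos h, if_pos h.symm]
  · rw [if_neg h, if_neg (Ne.symm h), MvPolynomial.coeff_zero]

open Classical in
theorem coeff_toVar_uSer (F : PowerSeries (MvPolynomial (Fin n) A)) (e : Var n →₀ ℕ) :
    MvPowerSeries.coeff e (toVar (uSer n A F)) =
      if vPart e = 0 then MvPolynomial.coeff (uPart e) (PowerSeries.coeff (e Var.h) F) else 0 := by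
  rw [coeff_toVar, coeff_uSer, MvPolynomial.coeff_map, MvPolynomial.coeff_C]
  by_cases h : vPart e = 0
  · rw [if_pos h, if_pos h.symm]
  · rw [if_neg h, if_neg (Ne.symm h)]

theorem toVar_vSer_serDeriv (D : Derivation ℂ A A) (F : PowerSeries (MvPolynomial (Fin n) A)) :
    toVar (vSer n A (serDeriv Unit (polyDeriv _ D) F)) =
      serDeriv (Var n) D (toVar (vSer n A F)) := by
  classical
  ext e
  rw [coeff_serDeriv, coeff_toVar_vSer, coeff_toVar_vSer, coeff_serDeriv', coeff_polyDeriv]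
  split_ifs <;> simp

/-- The series `S(X_i ħ D) f` for `f = ∑ ħ^{2k} f_k`. -/
def applySer (D : Derivation ℂ A A) (f : ℕ → A) (i : Fin n) :
    PowerSeries (MvPolynomial (Fin n) A) :=
  PowerSeries.mk fun b => ∑ a ∈ Finset.range (b + 1), if Even (b - a) then
    MvPolynomial.monomial (Finsupp.single i a)
      (PowerSeries.coeff a S • (D^[a] (f ((b - a) / 2)))) else 0

open Classical in
theorem coeff_coeff_applySer (D : Derivation ℂ A A) (f : ℕ → A) (i : Fin n) (b : ℕ)
    (r : Fin n →₀ ℕ) : MvPolynomial.coeff r (PowerSeries.coeff b (applySer D f i)) =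
      if r = Finsupp.single i (r i) ∧ r i ≤ b ∧ Even (b - r i) then
        PowerSeries.coeff (r i) S • (D^[r i] (f ((b - r i) / 2))) else 0 := by
  rw [applySer, PowerSeries.coeff_mk, MvPolynomial.coeff_sum]
  have h1 : ∀ a, MvPolynomial.coeff r (if Even (b - a) then
      MvPolynomial.monomial (Finsupp.single i a)
        (PowerSeries.coeff a S • (D^[a] (f ((b - a) / 2)))) else 0) =
      if Finsupp.single i a = r ∧ Even (b - a) then
        PowerSeries.coeff a S • (D^[a] (f ((b - a) / 2))) else 0 := by
    intro a
    by_cases h : Even (b - a)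
    · rw [if_pos h, MvPolynomial.coeff_monomial]
      simp [h]
    · simp [h]
  simp only [h1]
  by_cases hb : r i ≤ b
  · rw [Finset.sum_eq_single (r i)]
    · by_cases hr : Finsupp.single i (r i) = r ∧ Even (b - r i)
      · rw [if_pos hr, if_pos ⟨hr.1.symm, hb, hr.2⟩]
      · rw [if_neg hr, if_neg fun h => hr ⟨h.1.symm, h.2.2⟩]
    · intro a _ ha
      rw [if_neg]
      rintro ⟨h2, _⟩
      exact ha (by rw [← h2]; simp)
    · intro h2
      exact absurd (Finset.mem_range.mpr (by omega)) h2
  · rw [if_neg fun h => hb h.2.1]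
    refine Finset.sum_eq_zero fun a ha => if_neg ?_
    rintro ⟨h2, _⟩
    rw [← h2, Finsupp.single_eq_same] at hb
    have := Finset.mem_range.mp ha
    omega

theorem evSer_toVar_vSer_applySer (ev : A →ₐ[ℂ] ℂ) (D : Derivation ℂ A A) (f : ℕ → A) (i : Fin n)
    {D' : (ℂ → ℂ) → ℂ → ℂ} {f' : ℕ → ℂ → ℂ} {z : ℂ}
    (h : ∀ a k, ev (D^[a] (f k)) = (D'^[a] (f' k)) z) :
    evSer ev (toVar (vSer n A (applySer D f i))) = applyS D' f' (Var.v i) z := by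
  classical
  ext e
  rw [coeff_evSer, coeff_toVar_vSer, coeff_coeff_applySer, coeff_applyS, vPart_apply]
  have h1 : e = Finsupp.single (Var.v i) (e (Var.v i)) + Finsupp.single Var.h (e Var.h) ↔
      uPart e = 0 ∧ vPart e = Finsupp.single i (e (Var.v i)) := by
    constructor
    · intro h
      rw [h]
      constructor <;> ext j <;> simp [Finsupp.single_apply]
    · rintro ⟨h2, h3⟩
      refine var_finsupp_ext (by simp) (fun j => ?_) fun j => ?_
      · simpa [Finsupp.single_apply] using DFunLike.congr_fun h2 j
      · simpa [Finsupp.single_apply] using DFunLike.congr_fun h3 j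
  by_cases hu : uPart e = 0
  · simp only [h1, hu, if_true, true_and]
    rw [apply_ite ev, map_zero, map_smul, h, smul_eq_mul]
  · simp [h1, hu]

theorem evSer_toVar_uSer_applySer (ev : A →ₐ[ℂ] ℂ) (D : Derivation ℂ A A) (f : ℕ → A) (i : Fin n)
    {D' : (ℂ → ℂ) → ℂ → ℂ} {f' : ℕ → ℂ → ℂ} {z : ℂ}
    (h : ∀ a k, ev (D^[a] (f k)) = (D'^[a] (f' k)) z) :
    evSer ev (toVar (uSer n A (applySer D f i))) = applyS D' f' (Var.u i) z := by
  classical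
  ext e
  rw [coeff_evSer, coeff_toVar_uSer, coeff_coeff_applySer, coeff_applyS, uPart_apply]
  have h1 : e = Finsupp.single (Var.u i) (e (Var.u i)) + Finsupp.single Var.h (e Var.h) ↔
      vPart e = 0 ∧ uPart e = Finsupp.single i (e (Var.u i)) := by
    constructor
    · intro h
      rw [h]
      constructor <;> ext j <;> simp [Finsupp.single_apply]
    · rintro ⟨h2, h3⟩
      refine var_finsupp_ext (by simp) (fun j => ?_) fun j => ?_
      · simpa [Finsupp.single_apply] using DFunLike.congr_fun h3 j
      · simpa [Finsupp.single_apply] using DFunLike.congr_fun h2 j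
  by_cases hu : vPart e = 0
  · simp only [h1, hu, if_true, true_and]
    rw [apply_ite ev, map_zero, map_smul, h, smul_eq_mul]
  · simp [h1, hu]

end ToVar

/-! ### The algebra of analytic functions on an open set of `n`-tuples. -/

section Analytic

variable {n : ℕ} {Ω : TopologicalSpace.Opens (Fin n → ℂ)}

/-- The extension by zero of a function on `Ω`. -/
def extZero (f : Ω → ℂ) : (Fin n → ℂ) → ℂ := Function.extend Subtype.val f 0

theorem extZero_apply (f : Ω → ℂ) (z : Ω) : extZero f z = f z :=
  Subtype.val_injective.extend_apply _ _ _

theorem extZero_eqOn {f : Ω → ℂ} {F : (Fin n → ℂ) → ℂ} (h : ∀ z : Ω, f z = F z) :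
    Set.EqOn F (extZero f) Ω := fun z hz => by
  rw [← h ⟨z, hz⟩]
  exact (extZero_apply f ⟨z, hz⟩).symm

/-- The algebra of analytic functions on `Ω`. -/
def analyticAlg (Ω : TopologicalSpace.Opens (Fin n → ℂ)) : Subalgebra ℂ (Ω → ℂ) where
  carrier := {f | AnalyticOnNhd ℂ (extZero f) Ω}
  mul_mem' {f g} hf hg := (AnalyticOnNhd.mul hf hg).congr Ω.isOpen
    (extZero_eqOn fun z => by simp [extZero_apply])
  add_mem' {f g} hf hg := (AnalyticOnNhd.add hf hg).congr Ω.isOpen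
    (extZero_eqOn fun z => by simp [extZero_apply])
  algebraMap_mem' c := (analyticOnNhd_const (v := c)).congr Ω.isOpen (extZero_eqOn fun z => rfl)

/-- The restriction to `Ω` of an analytic function. -/
def ofAnalytic (F : (Fin n → ℂ) → ℂ) (hF : AnalyticOnNhd ℂ F Ω) : analyticAlg Ω :=
  ⟨fun z => F z, hF.congr Ω.isOpen (extZero_eqOn fun _ => rfl)⟩

/-- The evaluation at a point. -/
def evAt (z : Ω) : analyticAlg Ω →ₐ[ℂ] ℂ :=
  (Pi.evalAlgHom ℂ (fun _ : Ω => ℂ) z).comp (analyticAlg Ω).val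

@[simp] theorem evAt_ofAnalytic (z : Ω) (F : (Fin n → ℂ) → ℂ) (hF : AnalyticOnNhd ℂ F Ω) :
    evAt z (ofAnalytic F hF) = F z := rfl

theorem analyticAlg_ext {f g : analyticAlg Ω} (h : ∀ z : Ω, evAt z f = evAt z g) : f = g :=
  Subtype.ext (funext h)

theorem analyticAt_extZero (f : analyticAlg Ω) (z : Ω) : AnalyticAt ℂ (extZero f.1) z :=
  f.2 z z.2

theorem extZero_eventuallyEq {f : Ω → ℂ} {F : (Fin n → ℂ) → ℂ} (h : ∀ z : Ω, f z = F z) (z : Ω) :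
    F =ᶠ[nhds (z : Fin n → ℂ)] extZero f :=
  (extZero_eqOn h).eventuallyEq_of_mem (Ω.isOpen.mem_nhds z.2)

theorem analyticOnNhd_partial (f : analyticAlg Ω) (v : Fin n → ℂ) :
    AnalyticOnNhd ℂ (fun z => fderiv ℂ (extZero f.1) z v) Ω :=
  (ContinuousLinearMap.apply ℂ ℂ v).comp_analyticOnNhd (AnalyticOnNhd.fderiv f.2)

/-- The partial derivatives of analytic functions. -/
def partialD (i : Fin n) : Derivation ℂ (analyticAlg Ω) (analyticAlg Ω) :=
  Derivation.mk'
    { toFun := fun f => ofAnalytic _ (analyticOnNhd_partial f (Pi.single i 1))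
      map_add' := fun f g => analyticAlg_ext fun z => by
        rw [map_add, evAt_ofAnalytic, evAt_ofAnalytic, evAt_ofAnalytic,
          ← (extZero_eventuallyEq (F := extZero f.1 + extZero g.1)
            (fun w => by simp [extZero_apply]) z).fderiv_eq,
          fderiv_add (analyticAt_extZero f z).differentiableAt
            (analyticAt_extZero g z).differentiableAt]
        rfl
      map_smul' := fun c f => analyticAlg_ext fun z => by
        rw [RingHom.id_apply, map_smul, evAt_ofAnalytic, evAt_ofAnalytic,
          ← (extZero_eventuallyEq (F := c • extZero f.1)
            (fun w => by simp [extZero_apply]) z).fderiv_eq,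
          fderiv_const_smul (analyticAt_extZero f z).differentiableAt]
        rfl }
    fun f g => analyticAlg_ext fun z => by
      change fderiv ℂ (extZero (f * g).1) z (Pi.single i 1) =
        f.1 z * fderiv ℂ (extZero g.1) z (Pi.single i 1) +
          g.1 z * fderiv ℂ (extZero f.1) z (Pi.single i 1)
      rw [← (extZero_eventuallyEq (F := extZero f.1 * extZero g.1)
            (fun w => by simp [extZero_apply]) z).fderiv_eq,
        fderiv_mul (analyticAt_extZero f z).differentiableAt
            (analyticAt_extZero g z).differentiableAt, extZero_apply, extZero_apply]
      rfl

theorem evAt_partialD (i : Fin n) (f : analyticAlg Ω) (z : Ω) :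
    evAt z (partialD i f) = fderiv ℂ (extZero f.1) z (Pi.single i 1) := rfl

theorem eventually_update_mem (z : Ω) (i : Fin n) :
    ∀ᶠ t in nhds ((z : Fin n → ℂ) i), Function.update (z : Fin n → ℂ) i t ∈ Ω := by
  have hc : ContinuousAt (fun t => Function.update (z : Fin n → ℂ) i t) ((z : Fin n → ℂ) i) := by
    fun_prop
  refine hc.eventually ?_
  simp only [Function.update_eq_self]
  exact Ω.isOpen.mem_nhds z.2

/-- Partial derivatives as derivatives in one variable. -/
theorem evAt_partialD_eq_deriv {f : analyticAlg Ω} {F : (Fin n → ℂ) → ℂ}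
    (h : ∀ z : Ω, evAt z f = F z) (i : Fin n) (z : Ω) :
    evAt z (partialD i f) =
      deriv (fun t => F (Function.update (z : Fin n → ℂ) i t)) ((z : Fin n → ℂ) i) := by
  have h1 : (fun t => F (Function.update (z : Fin n → ℂ) i t)) =ᶠ[nhds ((z : Fin n → ℂ) i)]
      fun t => extZero f.1 (Function.update (z : Fin n → ℂ) i t) := by
    filter_upwards [eventually_update_mem z i] with t ht
    exact extZero_eqOn h ht
  rw [h1.deriv_eq, evAt_partialD]
  have h2 := hasDerivAt_update (z : Fin n → ℂ) i ((z : Fin n → ℂ) i)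
  have h3 : HasFDerivAt (extZero f.1) (fderiv ℂ (extZero f.1) z)
      (Function.update (z : Fin n → ℂ) i ((z : Fin n → ℂ) i)) := by
    rw [Function.update_eq_self]
    exact (analyticAt_extZero f z).differentiableAt.hasFDerivAt
  exact (h3.comp_hasDerivAt _ h2).deriv.symm

/-- Symmetry of the second Fréchet derivative of an analytic function. -/
theorem partialD_comm (i j : Fin n) (f : analyticAlg Ω) :
    partialD i (partialD j f) = partialD j (partialD i f) := by
  have h : ∀ (i j : Fin n) (z : Ω), evAt z (partialD i (partialD j f)) =
      fderiv ℂ (fderiv ℂ (extZero f.1)) z (Pi.single i 1) (Pi.single j 1) := by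
    intro i j z
    rw [evAt_partialD, ← (extZero_eventuallyEq (f := (partialD j f).1)
      (F := fun w => fderiv ℂ (extZero f.1) w (Pi.single j 1)) (fun w => rfl) z).fderiv_eq]
    have h1 : DifferentiableAt ℂ (fderiv ℂ (extZero f.1)) z :=
      (AnalyticOnNhd.fderiv f.2 z z.2).differentiableAt
    rw [fderiv_clm_apply h1 (differentiableAt_const _)]
    simp
  refine analyticAlg_ext fun z => ?_
  rw [h, h]
  have : IsSymmSndFDerivAt ℂ (extZero f.1) z :=
    ((analyticAt_extZero f z).contDiffAt (n := ⊤)).isSymmSndFDerivAt (by simp)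
  exact this _ _

/-- The function of the `i`-th coordinate given by a holomorphic function of one variable. -/
def coordFun {U : Set ℂ} (hΩ : ∀ z ∈ Ω, ∀ i, z i ∈ U) {f : ℂ → ℂ} (hf : AnalyticOnNhd ℂ f U)
    (i : Fin n) : analyticAlg Ω :=
  ofAnalytic (fun z => f (z i)) fun z hz =>
    (hf (z i) (hΩ z hz i)).comp_of_eq ((ContinuousLinearMap.proj i :
      (Fin n → ℂ) →L[ℂ] ℂ).analyticAt z) rfl

theorem evAt_iterate_partialD {f : analyticAlg Ω} {i : Fin n} {F : ℂ → ℂ}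
    (h : ∀ z : Ω, evAt z f = F ((z : Fin n → ℂ) i)) (r : ℕ) (z : Ω) :
    evAt z ((partialD i)^[r] f) = iteratedDeriv r F ((z : Fin n → ℂ) i) := by
  induction r generalizing f F with
  | zero => rw [iteratedDeriv_zero]; exact h z
  | succ r ih =>
    rw [Function.iterate_succ_apply, iteratedDeriv_succ']
    refine ih fun w => ?_
    rw [evAt_partialD_eq_deriv (F := fun w => F (w i)) h i w]
    simp

theorem partialD_of_ne {f : analyticAlg Ω} {i j : Fin n} (hij : i ≠ j) {F : ℂ → ℂ}
    (h : ∀ z : Ω, evAt z f = F ((z : Fin n → ℂ) j)) : partialD i f = 0 := by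
  refine analyticAlg_ext fun z => ?_
  rw [evAt_partialD_eq_deriv (F := fun w => F (w j)) h i z, map_zero]
  simp [Function.update_of_ne (Ne.symm hij)]

end Analytic

/-! ### Infinite sums of analytic operators as values of `total`. -/

section Totals

variable {n : ℕ} {Ω : TopologicalSpace.Opens (Fin n → ℂ)} {x : ℂ → ℂ}
  {H : XCoords n (analyticAlg Ω)}

theorem evAt_delta (hd : ∀ i, H.d i = partialD i)
    (hq : ∀ i (z : Ω), evAt z (H.xq i) = (deriv x ((z : Fin n → ℂ) i))⁻¹) (i : Fin n)
    {f : analyticAlg Ω} {F : (Fin n → ℂ) → ℂ} (h : ∀ z : Ω, evAt z f = F z) (z : Ω) :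
    evAt z (H.delta i f) = dInvDx x i F z := by
  rw [XCoords.delta_apply, hd, evAt_partialD_eq_deriv (F := fun w => F w / deriv x (w i))]
  · simp only [Function.update_self]
    rfl
  · intro w
    rw [map_mul, hq, h, div_eq_inv_mul]

theorem evAt_opPow_delta (hd : ∀ i, H.d i = partialD i)
    (hq : ∀ i (z : Ω), evAt z (H.xq i) = (deriv x ((z : Fin n → ℂ) i))⁻¹) (r : Fin n → ℕ)
    {f : analyticAlg Ω} {F : (Fin n → ℂ) → ℂ} (h : ∀ z : Ω, evAt z f = F z) (z : Ω) :
    evAt z (opPow H.delta r f) = opProd (fun i g => dInvDx x i g) r F z := by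
  have hpow : ∀ (i : Fin n) (k : ℕ) (f : analyticAlg Ω) (F : (Fin n → ℂ) → ℂ),
      (∀ z : Ω, evAt z f = F z) →
        ∀ z : Ω, evAt z ((H.delta i ^ k) f) = (dInvDx x i)^[k] F z := by
    intro i k
    induction k with
    | zero => intro f F h z; exact h z
    | succ k ih =>
      intro f F h z
      rw [pow_succ, Module.End.mul_apply, Function.iterate_succ_apply]
      exact ih _ _ (fun w => evAt_delta hd hq i h w) z
  have key : ∀ (l : List (Fin n)) (z : Ω),
      evAt z ((l.map fun i => H.delta i ^ r i).prod f) =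
        l.foldr (fun i G => (dInvDx x i)^[r i] G) F z := by
    intro l
    induction l with
    | nil => exact h
    | cons i l ih =>
      intro z
      rw [List.map_cons, List.prod_cons, Module.End.mul_apply, List.foldr_cons]
      exact hpow i (r i) _ _ ih z
  exact key _ z

/-- The sum over all powers of the operators `dᵢ (1 / dxᵢ)`. -/
theorem finsum_opProd_eq (hd : ∀ i, H.d i = partialD i)
    (hq : ∀ i (z : Ω), evAt z (H.xq i) = (deriv x ((z : Fin n → ℂ) i))⁻¹)
    (p : MvPolynomial (Fin n) (analyticAlg Ω)) {F : (Fin n → ℕ) → (Fin n → ℂ) → ℂ}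
    (h : ∀ (r : Fin n →₀ ℕ) (z : Ω), evAt z (MvPolynomial.coeff r p) = F r z) (z : Ω) :
    ∑ᶠ r : Fin n → ℕ, opProd (fun i g => dInvDx x i g) r (F r) z = evAt z (H.total p) := by
  rw [← finsum_comp_equiv Finsupp.equivFunOnFinite, XCoords.total,
    opEval_eq_sum _ (Finset.Subset.refl _), map_sum]
  have h1 : ∀ r : Fin n →₀ ℕ, opProd (fun i g => dInvDx x i g) r (F r) z =
      evAt z (opPow H.delta r (MvPolynomial.coeff r p)) := fun r =>
    (evAt_opPow_delta hd hq r (h r) z).symm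
  refine (finsum_congr h1).trans (finsum_eq_finsetSum_of_support_subset _ fun r hr => ?_)
  by_contra hc
  refine hr ?_
  simp only
  rw [MvPolynomial.notMem_support_iff.mp hc, map_zero, map_zero]

/-- The double sum is finite: only `r ∈ s` contribute, and each `p r` is a polynomial, with finitely
many exponents `j`. -/
theorem finsum_opProd_pair_eq (hd : ∀ i, H.d i = partialD i)
    (hq : ∀ i (z : Ω), evAt z (H.xq i) = (deriv x ((z : Fin n → ℂ) i))⁻¹)
    (p : (Fin n →₀ ℕ) → MvPolynomial (Fin n) (analyticAlg Ω)) {s : Finset (Fin n →₀ ℕ)}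
    (hs : ∀ r ∉ s, p r = 0) {F : (Fin n → ℕ) × (Fin n → ℕ) → (Fin n → ℂ) → ℂ}
    (h : ∀ (j r : Fin n →₀ ℕ) (z : Ω), evAt z (MvPolynomial.coeff j (p r)) = F (j, r) z) (z : Ω) :
    ∑ᶠ jr : (Fin n → ℕ) × (Fin n → ℕ), opProd (fun i g => dInvDx x i g) jr.1 (F jr) z =
      evAt z (H.total (∑ r ∈ s, p r)) := by
  classical
  let e : (Fin n →₀ ℕ) × (Fin n →₀ ℕ) ≃ (Fin n → ℕ) × (Fin n → ℕ) :=
    Equiv.prodCongr Finsupp.equivFunOnFinite Finsupp.equivFunOnFinite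
  set t := s.biUnion fun r => (p r).support with ht
  rw [← finsum_comp_equiv e]
  have h1 : ∀ jr : (Fin n →₀ ℕ) × (Fin n →₀ ℕ),
      opProd (fun i g => dInvDx x i g) (e jr).1 (F (e jr)) z =
        evAt z (opPow H.delta jr.1 (MvPolynomial.coeff jr.1 (p jr.2))) := fun jr =>
    (evAt_opPow_delta hd hq jr.1 (h jr.1 jr.2) z).symm
  have h2 : Function.support (fun jr : (Fin n →₀ ℕ) × (Fin n →₀ ℕ) =>
      evAt z (opPow H.delta jr.1 (MvPolynomial.coeff jr.1 (p jr.2)))) ⊆ ↑(t ×ˢ s) := by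
    rintro ⟨j, r⟩ hjr
    by_contra hc
    refine hjr ?_
    simp only
    have : MvPolynomial.coeff j (p r) = 0 := by
      by_cases hr : r ∈ s
      · rw [← MvPolynomial.notMem_support_iff]
        intro hj
        exact hc (Finset.mem_coe.mpr (Finset.mem_product.mpr
          ⟨Finset.mem_biUnion.mpr ⟨r, hr, hj⟩, hr⟩))
      · rw [hs r hr, MvPolynomial.coeff_zero]
    rw [this, map_zero, map_zero]
  rw [finsum_congr h1, finsum_eq_finsetSum_of_support_subset _ h2, Finset.sum_product_right,
    map_sum, map_sum]
  refine Finset.sum_congr rfl fun r hr => ?_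
  have h3 : (p r).support ⊆ t := Finset.subset_biUnion_of_mem (fun r => (p r).support) hr
  rw [XCoords.total, opEval_eq_sum _ h3, map_sum]

end Totals

/-! ### Coordinates on tuples of distinct points. -/

section Coordinates

variable {n : ℕ} {Ω : TopologicalSpace.Opens (Fin n → ℂ)} {U : Set ℂ}

theorem evAt_coordFun (hΩ : ∀ z ∈ Ω, ∀ i, z i ∈ U) {f : ℂ → ℂ} (hf : AnalyticOnNhd ℂ f U)
    (i : Fin n) (z : Ω) : evAt z (coordFun hΩ hf i) = f ((z : Fin n → ℂ) i) := rfl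

theorem evAt_partialD_coordFun (hΩ : ∀ z ∈ Ω, ∀ i, z i ∈ U) {f : ℂ → ℂ}
    (hf : AnalyticOnNhd ℂ f U) (i : Fin n) (z : Ω) :
    evAt z (partialD i (coordFun hΩ hf i)) = deriv f ((z : Fin n → ℂ) i) := by
  have := evAt_iterate_partialD (evAt_coordFun hΩ hf i) 1 z
  rwa [iteratedDeriv_one] at this

/-- The coordinates on `Ω` and the derivatives of a function `x` without critical points. -/
def xCoords (hΩ : ∀ z ∈ Ω, ∀ i, z i ∈ U) (h0 : ∀ z ∈ U, z ≠ 0) {x : ℂ → ℂ}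
    (hx : AnalyticOnNhd ℂ x U) (hdx : ∀ z ∈ U, deriv x z ≠ 0) : XCoords n (analyticAlg Ω) where
  d := partialD
  z := coordFun hΩ analyticOnNhd_id
  w := coordFun hΩ (analyticOnNhd_id.inv h0)
  xp := coordFun hΩ hx.deriv
  xq := coordFun hΩ (hx.deriv.inv hdx)
  d_comm := partialD_comm
  d_z i j := by
    split_ifs with h
    · subst h
      refine analyticAlg_ext fun z => ?_
      rw [evAt_partialD_coordFun, deriv_id'', map_one]
    · exact partialD_of_ne (F := fun t => t) h (evAt_coordFun hΩ analyticOnNhd_id j)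
  z_mul_w i := analyticAlg_ext fun z => by
    rw [map_mul, map_one]
    exact mul_inv_cancel₀ (h0 _ (hΩ z z.2 i))
  xp_mul_xq i := analyticAlg_ext fun z => by
    rw [map_mul, map_one]
    exact mul_inv_cancel₀ (hdx _ (hΩ z z.2 i))
  d_xp i j h := partialD_of_ne h (evAt_coordFun hΩ hx.deriv j)

/-- Distinctness of the points makes each `zᵢ - zⱼ` a unit of the algebra, and hence the
denominators of the cyclic sums invertible. -/
theorem exists_inverse_sub (hinj : ∀ z ∈ Ω, Function.Injective z) (hΩ : ∀ z ∈ Ω, ∀ i, z i ∈ U)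
    {i j : Fin n} (h : i ≠ j) : ∃ y : analyticAlg Ω,
      y * (coordFun hΩ analyticOnNhd_id i - coordFun hΩ analyticOnNhd_id j) = 1 := by
  have hp : ∀ k : Fin n, AnalyticOnNhd ℂ (fun z : Fin n → ℂ => z k) Ω := fun k z _ =>
    (ContinuousLinearMap.proj k : (Fin n → ℂ) →L[ℂ] ℂ).analyticAt z
  have hne : ∀ z ∈ (Ω : Set (Fin n → ℂ)), z i - z j ≠ 0 := fun z hz =>
    sub_ne_zero.mpr fun e => h (hinj z hz e)
  refine ⟨ofAnalytic _ (((hp i).sub (hp j)).inv hne), analyticAlg_ext fun z => ?_⟩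
  rw [map_mul, map_one, map_sub]
  exact inv_mul_cancel₀ (hne z z.2)

end Coordinates

/-! ### The exponents as series over the algebra. -/

section Exponents

variable {n : ℕ} {A : Type*} [CommRing A] [Algebra ℂ A]

/-- Because `S` is even, `S⁻¹(-t)` also inverts `S(t)`; by uniqueness of the inverse `S⁻¹` is even.
-/
theorem coeff_S_inv_eq_zero {k : ℕ} (h : ¬ Even k) : PowerSeries.coeff k S⁻¹ = 0 := by
  have h1 : PowerSeries.rescale (-1 : ℂ) S⁻¹ = S⁻¹ := by
    have h2 : S * PowerSeries.rescale (-1 : ℂ) S⁻¹ = 1 := by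
      have := congrArg (PowerSeries.rescale (-1 : ℂ)) S_mul_inv
      rwa [map_mul, rescale_S (by norm_num), map_one] at this
    have h3 := S_mul_inv
    linear_combination S⁻¹ * h2 - PowerSeries.rescale (-1 : ℂ) S⁻¹ * h3
  have h4 := congrArg (PowerSeries.coeff k) h1
  rw [PowerSeries.coeff_rescale, (Nat.not_even_iff_odd.mp h).neg_one_pow] at h4
  linear_combination -(1 / 2) * h4

theorem applySer_sub (D : Derivation ℂ A A) (f g : ℕ → A) (i : Fin n) :
    applySer D (fun k => f k - g k) i = applySer D f i - applySer D g i := by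
  have hit : ∀ (a : ℕ) (x y : A), D^[a] (x - y) = D^[a] x - D^[a] y := by
    intro a
    induction a with
    | zero => intro x y; rfl
    | succ a ih => intro x y; rw [Function.iterate_succ_apply, map_sub, ih]; rfl
  ext1 b
  rw [map_sub, applySer, applySer, applySer, PowerSeries.coeff_mk, PowerSeries.coeff_mk,
    PowerSeries.coeff_mk, ← Finset.sum_sub_distrib]
  refine Finset.sum_congr rfl fun a _ => ?_
  split_ifs
  · rw [hit, smul_sub, map_sub]
  · rw [sub_zero]

theorem serDeriv_applySer {D E : Derivation ℂ A A} (hDE : ∀ x, E (D x) = D (E x)) {f : ℕ → A}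
    (hf : ∀ k, E (f k) = 0) (i : Fin n) : serDeriv Unit (polyDeriv _ E) (applySer D f i) = 0 := by
  have hit : ∀ (a : ℕ) (x : A), E (D^[a] x) = D^[a] (E x) := by
    intro a
    induction a with
    | zero => intro x; rfl
    | succ a ih => intro x; rw [Function.iterate_succ_apply, ih, hDE]; rfl
  have h0 : ∀ a : ℕ, D^[a] (0 : A) = 0 := by
    intro a
    induction a with
    | zero => rfl
    | succ a ih => rw [Function.iterate_succ_apply, map_zero, ih]
  ext1 b
  ext r
  rw [coeff_serDeriv', coeff_polyDeriv, coeff_coeff_applySer]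
  split_ifs
  · rw [E.map_smul, hit, hf, h0, smul_zero, map_zero, MvPolynomial.coeff_zero]
  · rw [map_zero]; simp

theorem coeff_zero_applySer (D : Derivation ℂ A A) (f : ℕ → A) (i : Fin n) :
    PowerSeries.coeff 0 (applySer D f i) = MvPolynomial.C (f 0) := by
  rw [applySer, PowerSeries.coeff_mk]
  simp [coeff_zero_S, -PowerSeries.coeff_zero_eq_constantCoeff]

/-- The exponent `X_i (S(X_i ħ D) f - f₀)`. -/
def expSerArg (D : Derivation ℂ A A) (f : ℕ → A) (i : Fin n) :
    PowerSeries (MvPolynomial (Fin n) A) :=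
  PowerSeries.C (MvPolynomial.X i) *
    (applySer D f i - PowerSeries.C (MvPolynomial.C (f 0)))

theorem constantCoeff_expSerArg (D : Derivation ℂ A A) (f : ℕ → A) (i : Fin n) :
    PowerSeries.constantCoeff (expSerArg D f i) = 0 := by
  rw [expSerArg, map_mul, map_sub, ← PowerSeries.coeff_zero_eq_constantCoeff_apply (applySer D f i),
    coeff_zero_applySer]
  simp

theorem expSerArg_sub (D : Derivation ℂ A A) (f g : ℕ → A) (i : Fin n) :
    expSerArg D (fun k => f k - g k) i = expSerArg D f i - expSerArg D g i := by
  rw [expSerArg, applySer_sub, expSerArg, expSerArg]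
  simp only [map_sub]
  ring

theorem serDeriv_expSerArg {D E : Derivation ℂ A A} (hDE : ∀ x, E (D x) = D (E x)) {f : ℕ → A}
    (hf : ∀ k, E (f k) = 0) (i : Fin n) :
    serDeriv Unit (polyDeriv _ E) (expSerArg D f i) = 0 := by
  rw [expSerArg, Derivation.leibniz, map_sub, serDeriv_applySer hDE hf, serDeriv_C, serDeriv_C,
    polyDeriv_C, polyDeriv_X, hf]
  simp

/-- The coefficients of `S(ħ D)⁻¹ a`. -/
def invSer (D : Derivation ℂ A A) (a : A) (k : ℕ) : A :=
  PowerSeries.coeff (2 * k) S⁻¹ • D^[2 * k] a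

/-- The Cauchy product of `S(vt)` and `S⁻¹(t)`. Only even orders of `S⁻¹` enter the `ħ²`-series, and
this loses nothing because `S⁻¹` is even. Subtracting the logarithm removes the order zero, so that
derivatives of `1/z` remain. -/
theorem expSerArg_invSer (H : XCoords n A) (i : Fin n) {a : A} (ha : H.d i a = H.w i) :
    expSerArg (H.d i) (invSer (H.d i) a) i = H.coords.logRatio i := by
  have hS : PowerSeries.coeff 0 S⁻¹ = 1 := by
    rw [PowerSeries.coeff_zero_eq_constantCoeff_apply, PowerSeries.constantCoeff_inv,
      ← PowerSeries.coeff_zero_eq_constantCoeff_apply, coeff_zero_S, inv_one]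
  have hsm : ∀ (k : ℕ) (c : ℂ) (x : A), (H.d i)^[k] (c • x) = c • (H.d i)^[k] x := fun k c x =>
    iterate_smul_of_smul (T := fun y => H.d i y) (fun c x => (H.d i).map_smul c x) k c x
  have hw : ∀ k, ((H.coords.d i).toLinearMap ^ k) (H.coords.w i) =
      MvPolynomial.C ((H.d i)^[k + 1] a) := by
    intro k
    induction k with
    | zero => rw [Function.iterate_one, ha]; rfl
    | succ k ih =>
      rw [pow_succ', Module.End.mul_apply, ih, Function.iterate_succ_apply' _ (k + 1)]
      exact polyDeriv_C (H.d i) _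
  have happ : ∀ b, PowerSeries.coeff b (applySer (H.d i) (invSer (H.d i) a) i) =
      PowerSeries.coeff b (Coords.ratioS (MvPolynomial.X i : MvPolynomial (Fin n) A)) *
        MvPolynomial.C ((H.d i)^[b] a) := by
    intro b
    rw [applySer, PowerSeries.coeff_mk, Coords.ratioS, PowerSeries.coeff_mul,
      Finset.Nat.sum_antidiagonal_eq_sum_range_succ (fun p q =>
        PowerSeries.coeff p (scaled S (MvPolynomial.X i : MvPolynomial (Fin n) A)) *
          PowerSeries.coeff q (scaled S⁻¹ 1)), Finset.sum_mul]
    refine Finset.sum_congr rfl fun p hp => ?_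
    have hpb : p ≤ b := Nat.lt_succ_iff.mp (Finset.mem_range.mp hp)
    rw [coeff_scaled, coeff_scaled, one_pow, one_mul]
    split_ifs with he
    · obtain ⟨c, hc⟩ := he
      have h2 : 2 * ((b - p) / 2) = b - p := by omega
      rw [invSer, h2, hsm, ← Function.iterate_add_apply, show p + (b - p) = b by omega,
        ← MvPolynomial.C_mul_X_pow_eq_monomial, Algebra.smul_def, Algebra.smul_def, map_mul,
        map_mul, MvPolynomial.algebraMap_apply, MvPolynomial.algebraMap_apply]
      ring
    · rw [coeff_S_inv_eq_zero he, map_zero, mul_zero, zero_mul]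
  ext1 b
  rw [expSerArg, PowerSeries.coeff_C_mul, map_sub, happ]
  rcases b with _ | b
  · rw [H.coords.coeff_logRatio_zero, Coords.coeff_zero_ratioS, PowerSeries.coeff_zero_C, invSer, hS]
    simp
  · rw [H.coords.coeff_logRatio_succ, PowerSeries.coeff_C, if_neg (Nat.succ_ne_zero b), sub_zero,
      hw, mul_assoc]
    rfl

end Exponents

/-! ### The factors built from `ψ̃`. -/

section Psi

variable {n : ℕ} {Ω : TopologicalSpace.Opens (Fin n → ℂ)}

theorem evSer_toVar_vSer_applySer_partialD {psi : ℕ → ℂ → ℂ} {p : ℕ → analyticAlg Ω} {i : Fin n}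
    (hp : ∀ k (z : Ω), evAt z (p k) = psi k ((z : Fin n → ℂ) i)) (z : Ω) :
    evSer (evAt z) (toVar (vSer n _ (applySer (partialD i) p i))) =
      applyS deriv psi (Var.v i) ((z : Fin n → ℂ) i) :=
  evSer_toVar_vSer_applySer _ _ _ _ fun a k => by
    rw [evAt_iterate_partialD (hp k), iteratedDeriv_eq_iterate]

theorem evSer_toVar_uSer_applySer_partialD {psi : ℕ → ℂ → ℂ} {p : ℕ → analyticAlg Ω} {i : Fin n}
    (hp : ∀ k (z : Ω), evAt z (p k) = psi k ((z : Fin n → ℂ) i)) (z : Ω) :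
    evSer (evAt z) (toVar (uSer n _ (applySer (partialD i) p i))) =
      applyS deriv psi (Var.u i) ((z : Fin n → ℂ) i) :=
  evSer_toVar_uSer_applySer _ _ _ _ fun a k => by
    rw [evAt_iterate_partialD (hp k), iteratedDeriv_eq_iterate]

theorem vSer_expSerArg {A : Type*} [CommRing A] [Algebra ℂ A] (D : Derivation ℂ A A) (p : ℕ → A)
    (i : Fin n) : toVar (vSer n A (expSerArg D p i)) = MvPowerSeries.X (Var.v i) *
      (toVar (vSer n A (applySer D p i)) - MvPowerSeries.C (p 0)) := by
  rw [expSerArg, map_mul, map_mul, map_sub, map_sub, vSer_C, vSer_C, toVar_v, toVar_C]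

theorem uSer_expSerArg {A : Type*} [CommRing A] [Algebra ℂ A] (D : Derivation ℂ A A) (p : ℕ → A)
    (i : Fin n) : toVar (uSer n A (expSerArg D p i)) = MvPowerSeries.X (Var.u i) *
      (toVar (uSer n A (applySer D p i)) - MvPowerSeries.C (p 0)) := by
  rw [expSerArg, map_mul, map_mul, map_sub, map_sub, uSer_C, uSer_C, MvPolynomial.map_X,
    MvPolynomial.map_C, toVar_u, toVar_C]

theorem toVar_vSer_sexp {A : Type*} [CommRing A] [Algebra ℂ A]
    {F : PowerSeries (MvPolynomial (Fin n) A)} (hF : PowerSeries.constantCoeff F = 0) :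
    toVar (vSer n A (sexp F)) = sexp (toVar (vSer n A F)) := by
  rw [vSer_sexp hF, toVar_sexp]
  rw [← PowerSeries.coeff_zero_eq_constantCoeff_apply, coeff_vSer,
    PowerSeries.coeff_zero_eq_constantCoeff_apply, hF, map_zero]

theorem toVar_uSer_sexp {A : Type*} [CommRing A] [Algebra ℂ A]
    {F : PowerSeries (MvPolynomial (Fin n) A)} (hF : PowerSeries.constantCoeff F = 0) :
    toVar (uSer n A (sexp F)) = sexp (toVar (uSer n A F)) := by
  rw [uSer_sexp hF, toVar_sexp]
  rw [← PowerSeries.coeff_zero_eq_constantCoeff_apply, coeff_uSer,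
    PowerSeries.coeff_zero_eq_constantCoeff_apply, hF, map_zero]

/-- The exponential `e^{v (S(v ħ ∂) ψ̃ - ψ)}`. -/
theorem expS_v_eq {psi : ℕ → ℂ → ℂ} {p : ℕ → analyticAlg Ω} {i : Fin n}
    (hp : ∀ k (z : Ω), evAt z (p k) = psi k ((z : Fin n → ℂ) i)) (z : Ω) :
    expS deriv psi (Var.v i) ((z : Fin n → ℂ) i) =
      evSer (evAt z) (toVar (vSer n _ (sexp (expSerArg (partialD i) p i)))) := by
  rw [toVar_vSer_sexp (constantCoeff_expSerArg _ _ _), vSer_expSerArg, evSer_sexp _ (by simp),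
    map_mul, map_sub, evSer_X, evSer_C, evSer_toVar_vSer_applySer_partialD hp, hp, expS]

theorem fexp_neg_u_eq {xh : ℕ → ℂ → ℂ} {p : ℕ → analyticAlg Ω} {i : Fin n}
    (hp : ∀ k (z : Ω), evAt z (p k) = xh k ((z : Fin n → ℂ) i)) (z : Ω) :
    fexp (-(var (Var.u i) * (applyS deriv xh (Var.u i) ((z : Fin n → ℂ) i) -
      const (xh 0 ((z : Fin n → ℂ) i))))) =
      evSer (evAt z) (toVar (uSer n _ (sexp (-expSerArg (partialD i) p i)))) := by
  rw [toVar_uSer_sexp (by rw [map_neg, constantCoeff_expSerArg, neg_zero]), map_neg, map_neg,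
    uSer_expSerArg, evSer_sexp _ (by simp), map_neg, map_mul, map_sub, evSer_X, evSer_C,
    evSer_toVar_uSer_applySer_partialD hp, hp]

theorem coeff_iterate_serDeriv {τ A : Type*} [CommRing A] [Algebra ℂ A] (D : Derivation ℂ A A)
    (r : ℕ) (F : MvPowerSeries τ A) (e : τ →₀ ℕ) :
    MvPowerSeries.coeff e ((serDeriv τ D)^[r] F) = D^[r] (MvPowerSeries.coeff e F) := by
  induction r generalizing F with
  | zero => rfl
  | succ r ih => rw [Function.iterate_succ_apply, Function.iterate_succ_apply, ih, coeff_serDeriv]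

theorem serDeriv_X_mul_C {A : Type*} [CommRing A] [Algebra ℂ A] (D : Derivation ℂ A A)
    (w : Var n) (a : A) : serDeriv (Var n) D (MvPowerSeries.X w * MvPowerSeries.C a) =
      MvPowerSeries.X w * MvPowerSeries.C (D a) := by
  classical
  ext e
  rw [coeff_serDeriv, MvPowerSeries.coeff_mul_C, MvPowerSeries.coeff_mul_C,
    MvPowerSeries.coeff_X, Derivation.leibniz]
  split_ifs <;> simp

/-- Conjugation by `e^{vψ}` turns `∂ᵢ` into `∂ᵢ + vᵢψ'`. The exponential may contain infinitely many
powers of `v` at order `ħ⁰`, so this is stated for series in all variables and not over polynomials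
in `v`. -/
theorem serDeriv_sexp_mul {A : Type*} [CommRing A] [Algebra ℂ A] (H : XCoords n A) {i : Fin n}
    {b : A} (hb : H.d i b = H.psip i) (G : PowerSeries (MvPolynomial (Fin n) A)) :
    serDeriv (Var n) (H.d i)
        (sexp (MvPowerSeries.X (Var.v i) * MvPowerSeries.C b) * toVar (vSer n A G)) =
      sexp (MvPowerSeries.X (Var.v i) * MvPowerSeries.C b) *
        toVar (vSer n A (H.psiOp i G)) := by
  have h1 : serDeriv (Var n) (H.d i) (sexp (MvPowerSeries.X (Var.v i) * MvPowerSeries.C b)) =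
      sexp (MvPowerSeries.X (Var.v i) * MvPowerSeries.C b) *
        serDeriv (Var n) (H.d i) (MvPowerSeries.X (Var.v i) * MvPowerSeries.C b) :=
    derivation_sexp _ (fun _ => (H.d i).toLinearMap) (fun _ _ => rfl) (by simp)
  have h2 : toVar (vSer n A (H.psiOp i G)) = serDeriv (Var n) (H.d i) (toVar (vSer n A G)) +
      MvPowerSeries.X (Var.v i) * MvPowerSeries.C (H.psip i) * toVar (vSer n A G) := by
    rw [XCoords.psiOp_apply, map_add, map_add, toVar_vSer_serDeriv, map_mul (vSer n _),
      map_mul toVar, vSer_C, map_mul MvPolynomial.C, map_mul PowerSeries.C, map_mul toVar,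
      toVar_v, toVar_C]
  rw [Derivation.leibniz, h1, h2, serDeriv_X_mul_C, hb, smul_eq_mul, smul_eq_mul]
  generalize sexp (MvPowerSeries.X (Var.v i) * MvPowerSeries.C b) = e
  generalize toVar (vSer n A G) = f
  generalize serDeriv (Var n) (H.d i) f = f'
  ring

theorem iterate_serDeriv_sexp {A : Type*} [CommRing A] [Algebra ℂ A] (H : XCoords n A) {i : Fin n}
    {p : ℕ → A} (hp0 : H.d i (p 0) = H.psip i) (r : ℕ) :
    (serDeriv (Var n) (H.d i))^[r]
        (sexp (MvPowerSeries.X (Var.v i) * toVar (vSer n A (applySer (H.d i) p i)))) =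
      sexp (MvPowerSeries.X (Var.v i) * MvPowerSeries.C (p 0)) *
        toVar (vSer n A ((H.psiOp i ^ r) (sexp (expSerArg (H.d i) p i)))) := by
  induction r with
  | zero =>
    have h1 : MvPowerSeries.X (Var.v i) * toVar (vSer n A (applySer (H.d i) p i)) =
        MvPowerSeries.X (Var.v i) * MvPowerSeries.C (p 0) +
          toVar (vSer n A (expSerArg (H.d i) p i)) := by
      rw [vSer_expSerArg, mul_sub]
      exact (add_sub_cancel _ _).symm
    rw [Function.iterate_zero_apply, h1, sexp_add (by simp) (by rw [vSer_expSerArg]; simp),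
      pow_zero, Module.End.one_apply, toVar_vSer_sexp (constantCoeff_expSerArg _ _ _)]
  | succ r ih =>
    rw [Function.iterate_succ_apply', ih, serDeriv_sexp_mul H hp0, pow_succ',
      Module.End.mul_apply]

/-- After `r` derivatives a factor `e^{vψ}` splits off and is cancelled by `e^{-vψ}`. What is left
is polynomial in `v` at every order of `ħ`. -/
theorem psiFactor_eq {H : XCoords n (analyticAlg Ω)} (hd : ∀ i, H.d i = partialD i)
    {psi : ℕ → ℂ → ℂ} {p : ℕ → analyticAlg Ω} {i : Fin n}
    (hp : ∀ k (z : Ω), evAt z (p k) = psi k ((z : Fin n → ℂ) i))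
    (hp0 : H.d i (p 0) = H.psip i) (r : ℕ) (z : Ω) :
    psiFactor psi i r ((z : Fin n → ℂ) i) = evSer (evAt z) (toVar (vSer n _
      ((H.psiOp i ^ r) (sexp (expSerArg (H.d i) p i))))) := by
  have hev : ∀ z : Ω, evSer (evAt z)
      (sexp (MvPowerSeries.X (Var.v i) * toVar (vSer n _ (applySer (H.d i) p i)))) =
      fexp (var (Var.v i) * applyS deriv psi (Var.v i) ((z : Fin n → ℂ) i)) := by
    intro z
    rw [evSer_sexp _ (by simp), map_mul, evSer_X, hd,
      evSer_toVar_vSer_applySer_partialD hp]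
  have htheta : thetaDeriv r (fun t => fexp (var (Var.v i) * applyS deriv psi (Var.v i) t))
      ((z : Fin n → ℂ) i) = evSer (evAt z)
        (sexp (MvPowerSeries.X (Var.v i) * MvPowerSeries.C (p 0)) *
          toVar (vSer n _ ((H.psiOp i ^ r) (sexp (expSerArg (H.d i) p i))))) := by
    rw [← iterate_serDeriv_sexp H hp0]
    ext e
    rw [coeff_evSer, coeff_iterate_serDeriv, hd]
    refine (evAt_iterate_partialD (fun w => ?_) r z).symm
    rw [← coeff_evSer, ← hd, hev]
  have hone : fexp (-(var (Var.v i) * const (psi 0 ((z : Fin n → ℂ) i)))) *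
      evSer (evAt z) (sexp (MvPowerSeries.X (Var.v i) * MvPowerSeries.C (p 0))) = 1 := by
    have h1 : evSer (evAt z) (sexp (MvPowerSeries.X (Var.v i) * MvPowerSeries.C (p 0))) =
        fexp (var (Var.v i) * const (psi 0 ((z : Fin n → ℂ) i))) := by
      rw [evSer_sexp _ (by simp), map_mul, evSer_X, evSer_C, hp]
    rw [h1]
    exact sexp_neg_mul (by simp)
  rw [psiFactor, htheta, map_mul, ← mul_assoc, hone, one_mul]

end Psi

/-! ### Evaluation of `Φ` and of the shifted points. -/

section CyclicSums

variable {n : ℕ} {A : Type*} [CommRing A] [Algebra ℂ A]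

theorem coeff_subst_u_mul_h (i : Fin n) (e : Var n →₀ ℕ) [DecidableEq (Var n)] :
    MvPowerSeries.coeff e (S.subst (var (Var.u i) * var Var.h : Ser n)) =
      if e = Finsupp.single (Var.u i) (e (Var.u i)) + Finsupp.single Var.h (e (Var.u i)) then
        PowerSeries.coeff (e (Var.u i)) S else 0 := by
  rw [coeff_subst_eq_sum S (by simp) e (N := e.degree + e (Var.u i) + 1) (by omega)]
  have h : ∀ k, MvPowerSeries.coeff e ((var (Var.u i) * var Var.h : Ser n) ^ k) =
      if e = Finsupp.single (Var.u i) k + Finsupp.single Var.h k then 1 else 0 := by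
    intro k
    rw [mul_pow, MvPowerSeries.X_pow_eq, MvPowerSeries.X_pow_eq,
      MvPowerSeries.monomial_mul_monomial, MvPowerSeries.coeff_monomial, one_mul]
  simp only [h]
  rw [Finset.sum_eq_single (e (Var.u i))]
  · split_ifs <;> simp
  · intro k _ hk
    rw [if_neg, smul_zero]
    intro he
    exact hk (by rw [he]; simp)
  · intro hh
    exact absurd (Finset.mem_range.mpr (by omega)) hh

/-- The function `z` is an eigenfunction of `z∂` with eigenvalue `1`, so `S(uħ z∂)z = S(uħ)z`. -/
theorem applyS_eulerD_id (i : Fin n) (z : ℂ) :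
    applyS eulerD (fun k w => if k = 0 then w else 0) (Var.u i) z = mulQuot i z := by
  classical
  have h0 : ∀ a, eulerD^[a] (fun _ => (0 : ℂ)) = fun _ => 0 := by
    intro a
    induction a with
    | zero => rfl
    | succ a ih => rw [Function.iterate_succ_apply', ih]; funext t; simp [eulerD]
  have h1 : ∀ a, eulerD^[a] (fun w : ℂ => w) = fun w => w := by
    intro a
    induction a with
    | zero => rfl
    | succ a ih => rw [Function.iterate_succ_apply', ih]; funext t; simp [eulerD]
  ext e
  rw [coeff_applyS, mulQuot, MvPowerSeries.coeff_mul_C, coeff_subst_u_mul_h]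
  by_cases hc : e = Finsupp.single (Var.u i) (e (Var.u i)) + Finsupp.single Var.h (e (Var.u i))
  · have hh : e Var.h = e (Var.u i) := by
      conv_lhs => rw [hc]
      simp
    rw [if_pos hc, if_pos (by rw [hh]; exact ⟨hc, le_rfl, by simp⟩), hh]
    simp [h1]
  · rw [if_neg hc, zero_mul]
    by_cases hc' : e = Finsupp.single (Var.u i) (e (Var.u i)) + Finsupp.single Var.h (e Var.h) ∧
        e (Var.u i) ≤ e Var.h ∧ Even (e Var.h - e (Var.u i))
    · rw [if_pos hc']
      obtain ⟨h2, h3, c, h4⟩ := hc'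
      have : (e Var.h - e (Var.u i)) / 2 ≠ 0 := by
        intro h5
        have h6 : e Var.h = e (Var.u i) := by omega
        exact hc (by rw [← h6]; rw [h6] at h2 ⊢; exact h2)
      simp only [this, if_false]
      rw [h0, mul_zero]
    · rw [if_neg hc']

variable (H : XCoords n A) (ev : A →ₐ[ℂ] ℂ) {z : Fin n → ℂ}

theorem toVar_cst_z (i : Fin n) : toVar (Coords.cst n (H.coords.z i)) = MvPowerSeries.C (H.z i) :=
  toVar_C _

theorem prod_expS_eulerD_id (hz : ∀ i, ev (H.z i) = z i) :
    ∏ i, expS eulerD (fun k w => if k = 0 then w else 0) (Var.u i) (z i) =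
      evSer ev (toVar H.coords.expPhase) := by
  rw [Coords.expPhase, toVar_sexp H.coords.constantCoeff_phase,
    evSer_sexp _ (constantCoeff_toVar _ H.coords.constantCoeff_phase), Coords.phase, map_sum,
    map_sum]
  refine Eq.trans ?_ (sexp_sum _ _ fun i => ?_).symm
  · refine Finset.prod_congr rfl fun i _ => ?_
    rw [map_mul, map_mul, map_sub, map_mul, map_mul, map_sub, evSer_toVar_scaled, toVar_cst_z,
      Coords.uVar, toVar_u, evSer_X, evSer_C, map_one, map_one, hz, expS, applyS_eulerD_id,
      mulQuot]
    simp only [if_true]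
    change fexp _ = fexp _
    congr 1
    ring
  · simp only [map_mul, Coords.uVar, toVar_u, evSer_X, MvPowerSeries.constantCoeff_X, zero_mul]

theorem evSer_aMul (hz : ∀ i, ev (H.z i) = z i) (i : Fin n) :
    evSer ev (toVar (H.coords.aMul i)) = mulShift (1 / 2) i (z i) := by
  rw [Coords.aMul, map_mul, map_mul, evSer_toVar_expU, toVar_cst_z, evSer_C, hz, mulShift]

theorem evSer_bMul (hz : ∀ i, ev (H.z i) = z i) (i : Fin n) :
    evSer ev (toVar (H.coords.bMul i)) = mulShift (-(1 / 2)) i (z i) := by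
  rw [Coords.bMul, map_mul, map_mul, evSer_toVar_expU, toVar_cst_z, evSer_C, hz, mulShift]

theorem toVar_uSer_half : toVar (uSer n A (PowerSeries.C (Coords.half (MvPolynomial (Fin n) A)))) =
    MvPowerSeries.C (algebraMap ℂ A (1 / 2)) := by
  rw [uSer_C, Coords.half, MvPolynomial.algebraMap_apply, MvPolynomial.map_C, toVar_C]

theorem evSer_aAdd (hz : ∀ i, ev (H.z i) = z i) (i : Fin n) :
    evSer ev (toVar (uSer n A (H.coords.aAdd i))) = addShift (1 / 2) i (z i) := by
  have h1 : uSer n A (PowerSeries.C (H.coords.z i)) =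
      PowerSeries.C (MvPolynomial.C (MvPolynomial.C (H.z i))) := by
    rw [uSer_C]; exact congrArg _ (MvPolynomial.map_C _ _)
  have h2 : uSer n A (PowerSeries.C (H.coords.v i)) = PowerSeries.C (MvPolynomial.X i) := by
    rw [uSer_C]; exact congrArg _ (MvPolynomial.map_X _ _)
  rw [Coords.aAdd]
  simp only [map_add, map_mul]
  rw [toVar_uSer_half, h1, h2, uSer_X, toVar_X, toVar_C, toVar_u, evSer_C, evSer_C, evSer_X,
    evSer_X, hz, AlgHom.commutes]
  rfl

theorem evSer_bAdd (hz : ∀ i, ev (H.z i) = z i) (i : Fin n) :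
    evSer ev (toVar (uSer n A (H.coords.bAdd i))) = addShift (-(1 / 2)) i (z i) := by
  have h1 : uSer n A (PowerSeries.C (H.coords.z i)) =
      PowerSeries.C (MvPolynomial.C (MvPolynomial.C (H.z i))) := by
    rw [uSer_C]; exact congrArg _ (MvPolynomial.map_C _ _)
  have h2 : uSer n A (PowerSeries.C (H.coords.v i)) = PowerSeries.C (MvPolynomial.X i) := by
    rw [uSer_C]; exact congrArg _ (MvPolynomial.map_X _ _)
  rw [Coords.bAdd]
  simp only [map_sub, map_mul]
  rw [toVar_uSer_half, h1, h2, uSer_X, toVar_X, toVar_C, toVar_u, evSer_C, evSer_C, evSer_X,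
    evSer_X, hz, AlgHom.commutes, addShift,
    show (const (-(1 / 2)) : Ser n) = -const (1 / 2) from map_neg _ _, neg_mul, ← sub_eq_add_neg]
  rfl

end CyclicSums

/-! ### Coefficient extraction with exponents raised by one. -/

section Extraction

variable {n : ℕ} {A : Type*} [CommRing A] [Algebra ℂ A]

theorem coe_ones_add (r : Fin n →₀ ℕ) : ⇑(ones n + r) = fun i => r i + 1 := by
  funext i
  rw [Finsupp.add_apply, add_comm]
  rfl

theorem extract_evSer_uSer (ev : A →ₐ[ℂ] ℂ) (P : PowerSeries (MvPolynomial (Fin n) A)) (N : ℕ)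
    (r : Fin n →₀ ℕ) : extract N 0 (fun i => r i + 1) (evSer ev (toVar (uSer n A P))) =
      ev (MvPolynomial.coeff r (lower n A (PowerSeries.coeff N P))) := by
  have h : expnt N (0 : Fin n → ℕ) (fun i => r i + 1) =
      expnt N ⇑(0 : Fin n →₀ ℕ) ⇑(ones n + r) := by rw [coe_ones_add]; rfl
  rw [extract_eq, coeff_evSer, h, coeff_expnt_toVar, coeff_uSer, MvPolynomial.coeff_map,
    MvPolynomial.coeff_C, if_pos rfl, coeff_lower]

theorem extract_evSer_vSer (ev : A →ₐ[ℂ] ℂ) (P : PowerSeries (MvPolynomial (Fin n) A)) (N : ℕ)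
    (j : Fin n →₀ ℕ) : extract N (fun i => j i + 1) 0 (evSer ev (toVar (vSer n A P))) =
      ev (MvPolynomial.coeff j (lower n A (PowerSeries.coeff N P))) := by
  have h : expnt N (fun i => j i + 1) (0 : Fin n → ℕ) =
      expnt N ⇑(ones n + j) ⇑(0 : Fin n →₀ ℕ) := by rw [coe_ones_add]; rfl
  rw [extract_eq, coeff_evSer, h, coeff_expnt_toVar, coeff_vSer, MvPolynomial.coeff_C,
    if_pos rfl, coeff_lower]

theorem coeff_coeff_vSer_mul (Q : PowerSeries (MvPolynomial (Fin n) A))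
    (G : PowerSeries (MvPolynomial (Fin n) (MvPolynomial (Fin n) A))) (N : ℕ) (r : Fin n →₀ ℕ) :
    MvPolynomial.coeff (ones n + r) (PowerSeries.coeff N (vSer n A Q * G)) =
      PowerSeries.coeff N
        (Q * XCoords.uCoeff r (serMap (lower n (MvPolynomial (Fin n) A)) G)) := by
  rw [PowerSeries.coeff_mul, PowerSeries.coeff_mul, MvPolynomial.coeff_sum]
  refine Finset.sum_congr rfl fun p _ => ?_
  rw [coeff_vSer, MvPolynomial.coeff_C_mul, XCoords.coeff_uCoeff, coeff_serMap, coeff_lower]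

theorem coeff_mul_uCoeff_eq_zero {R : Type*} [CommRing R] [Algebra ℂ R] (Q : PowerSeries R)
    {L : PowerSeries (MvPolynomial (Fin n) R)} {N : ℕ} {r : Fin n →₀ ℕ}
    (h : ∀ k ≤ N, MvPolynomial.coeff r (PowerSeries.coeff k L) = 0) :
    PowerSeries.coeff N (Q * XCoords.uCoeff r L) = 0 := by
  rw [PowerSeries.coeff_mul]
  refine Finset.sum_eq_zero fun p hp => ?_
  have hp' : p.1 + p.2 = N := mem_antidiagonal.mp hp
  rw [XCoords.coeff_uCoeff, h p.2 (by omega), mul_zero]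

theorem extract_evSer_mul (ev : A →ₐ[ℂ] ℂ) (Q : PowerSeries (MvPolynomial (Fin n) A))
    (G : PowerSeries (MvPolynomial (Fin n) (MvPolynomial (Fin n) A))) (N : ℕ)
    (j r : Fin n →₀ ℕ) :
    extract N j (fun i => r i + 1) (evSer ev (toVar (vSer n A Q)) * evSer ev (toVar G)) =
      ev (MvPolynomial.coeff j (PowerSeries.coeff N
        (Q * XCoords.uCoeff r (serMap (lower n (MvPolynomial (Fin n) A)) G)))) := by
  rw [← map_mul, ← map_mul, extract_eq, coeff_evSer, ← coe_ones_add, coeff_expnt_toVar,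
    coeff_coeff_vSer_mul]

end Extraction

/-! ### The sums in the explicit formulas as values of `total`. -/

section Sums

variable {n : ℕ} {Ω : TopologicalSpace.Opens (Fin n → ℂ)} {x : ℂ → ℂ}
  {H : XCoords n (analyticAlg Ω)}

theorem finsum_extract_u (hd : ∀ i, H.d i = partialD i)
    (hq : ∀ i (z : Ω), evAt z (H.xq i) = (deriv x ((z : Fin n → ℂ) i))⁻¹)
    (P : PowerSeries (MvPolynomial (Fin n) (analyticAlg Ω))) {F : (Fin n → ℂ) → Ser n}
    (hF : ∀ z : Ω, F z = evSer (evAt z) (toVar (uSer n _ P))) (N : ℕ) (z : Ω) :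
    ∑ᶠ r : Fin n → ℕ, opProd (fun i g => dInvDx x i g) r
        (fun z' => extract N 0 (fun i => r i + 1) (F z')) z =
      evAt z (H.total (lower n _ (PowerSeries.coeff N P))) :=
  finsum_opProd_eq hd hq _ (F := fun r z' => extract N 0 (fun i => r i + 1) (F z'))
    (fun r z => by simp only [hF]; exact (extract_evSer_uSer _ _ _ _).symm) z

theorem finsum_extract_v (hd : ∀ i, H.d i = partialD i)
    (hq : ∀ i (z : Ω), evAt z (H.xq i) = (deriv x ((z : Fin n → ℂ) i))⁻¹)
    (P : PowerSeries (MvPolynomial (Fin n) (analyticAlg Ω))) {F : (Fin n → ℂ) → Ser n}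
    (hF : ∀ z : Ω, F z = evSer (evAt z) (toVar (vSer n _ P))) (N : ℕ) (z : Ω) :
    ∑ᶠ r : Fin n → ℕ, opProd (fun i g => dInvDx x i g) r
        (fun z' => extract N (fun i => r i + 1) 0 (F z')) z =
      evAt z (H.total (lower n _ (PowerSeries.coeff N P))) :=
  finsum_opProd_eq hd hq _ (F := fun r z' => extract N (fun i => r i + 1) 0 (F z'))
    (fun r z => by simp only [hF]; exact (extract_evSer_vSer _ _ _ _).symm) z

theorem finsum_extract_uv (hd : ∀ i, H.d i = partialD i)
    (hq : ∀ i (z : Ω), evAt z (H.xq i) = (deriv x ((z : Fin n → ℂ) i))⁻¹)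
    (E : Fin n → PowerSeries (MvPolynomial (Fin n) (analyticAlg Ω)))
    (hE : ∀ i j, i ≠ j → serDeriv Unit (polyDeriv _ (H.d i)) (E j) = 0)
    (G : PowerSeries (MvPolynomial (Fin n) (MvPolynomial (Fin n) (analyticAlg Ω))))
    {P : Fin n → ℕ → (Fin n → ℂ) → Ser n} {F : (Fin n → ℂ) → Ser n}
    (hP : ∀ i r (z : Ω), P i r z =
      evSer (evAt z) (toVar (vSer n _ ((H.psiOp i ^ r) (E i)))))
    (hF : ∀ z : Ω, F z = evSer (evAt z) (toVar G)) (N : ℕ) (z : Ω) :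
    ∑ᶠ jr : (Fin n → ℕ) × (Fin n → ℕ), opProd (fun i g => dInvDx x i g) jr.1
        (fun z' => extract N jr.1 (fun i => jr.2 i + 1) ((∏ i, P i (jr.2 i) z') * F z')) z =
      evAt z (H.total (PowerSeries.coeff N ((∏ i, E i) *
        H.coords.strans (serMap (lower n (MvPolynomial (Fin n) (analyticAlg Ω))) G)))) := by
  classical
  set L := serMap (lower n (MvPolynomial (Fin n) (analyticAlg Ω))) G with hL
  -- The exponents of `u` occurring up to order `ħ^N`. There are finitely many, each coefficient
  -- being a polynomial.
  set s := (Finset.range (N + 1)).biUnion fun k => (PowerSeries.coeff k L).support with hs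
  have hsub : ∀ k ≤ N, (PowerSeries.coeff k L).support ⊆ s := fun k hk =>
    Finset.subset_biUnion_of_mem (fun k => (PowerSeries.coeff k L).support)
      (Finset.mem_range.mpr (by omega))
  rw [← H.sum_total_eq E hE L N s hsub, ← map_sum]
  refine finsum_opProd_pair_eq hd hq
    (fun r => PowerSeries.coeff N ((∏ i, (H.psiOp i ^ r i) (E i)) * XCoords.uCoeff r L))
    (fun r hr => ?_) (F := fun jr z' => extract N jr.1 (fun i => jr.2 i + 1)
      ((∏ i, P i (jr.2 i) z') * F z')) (fun j r z => ?_) z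
  · exact coeff_mul_uCoeff_eq_zero _ fun k hk =>
      MvPolynomial.notMem_support_iff.mp fun h => hr (hsub k hk h)
  · have h1 : (∏ i, P i (r i) z) = evSer (evAt z)
        (toVar (vSer n _ (∏ i, (H.psiOp i ^ r i) (E i)))) := by
      rw [map_prod, map_prod, map_prod]
      exact Finset.prod_congr rfl fun i _ => hP i _ z
    simp only [h1, hF]
    exact (extract_evSer_mul _ _ _ _ _ _).symm

end Sums

/-! ### Cycles with and without fixed points. -/

section Cycles

variable {n : ℕ}

theorem cycle_apply_ne (hn : 2 ≤ n) {σ : Equiv.Perm (Fin n)} (h : ∀ i j, σ.SameCycle i j)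
    (i : Fin n) : σ i ≠ i := by
  intro hi
  have : Nontrivial (Fin n) := Fin.nontrivial_iff_two_le.mpr hn
  obtain ⟨j, hj⟩ := exists_ne i
  exact hj ((Equiv.Perm.SameCycle.eq_of_left (h i j) hi).symm)

/-- For `n ≥ 2` an `n`-cycle has no fixed point, so the terms with `q` do not occur. The relation `k
(a - b) = 1` shows that `a - b` has nonzero constant term, so that its formal inverse is a true
inverse. -/
theorem cycleSum_eq (hn : 2 ≤ n) {a b : Fin n → Ser n} (q : Fin n → Ser n)
    {k : Equiv.Perm (Fin n) → Fin n → Ser n}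
    (hk : ∀ σ : Equiv.Perm (Fin n), (∀ i j, σ.SameCycle i j) →
      ∀ i, k σ i * (a i - b (σ i)) = 1) :
    open Classical in
    cycleSum a b q = (∏ i, var (Var.u i) * var Var.h) * ((-1) ^ (n - 1) *
      ∑ σ : Equiv.Perm (Fin n) with ∀ i j, σ.SameCycle i j, ∏ i, k σ i) := by
  classical
  rw [cycleSum, mul_left_comm, Finset.mul_sum (a := ∏ i, var (Var.u i) * var Var.h)]
  refine congrArg _ (Finset.sum_congr (by congr) fun σ hσ => ?_)
  have hσ' := (Finset.mem_filter.mp hσ).2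
  rw [← Finset.prod_mul_distrib]
  refine Finset.prod_congr rfl fun i _ => ?_
  have h1 := hk σ hσ' i
  have h0 : MvPowerSeries.constantCoeff (a i - b (σ i)) ≠ 0 := by
    intro h0
    have := congrArg MvPowerSeries.constantCoeff h1
    rw [map_mul, h0, mul_zero, map_one] at this
    exact zero_ne_one this
  rw [if_neg (cycle_apply_ne hn hσ' i), (MvPowerSeries.inv_eq_iff_mul_eq_one h0).mpr h1]

theorem cycleSum_one (a b q : Fin 1 → Ser 1) : cycleSum a b q = (q 0)⁻¹ := by
  classical
  rw [cycleSum, Finset.sum_eq_single 1]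
  · simp
  · intro σ _ hσ
    exact absurd (Subsingleton.elim σ 1) hσ
  · intro h
    refine absurd (Finset.mem_filter.mpr ⟨Finset.mem_univ _, fun i j => ?_⟩) h
    rw [Subsingleton.elim i j]

end Cycles

/-! ### The transformation of the cyclic sums. -/

section Algebra

variable {n : ℕ} {A : Type*} [CommRing A] [Algebra ℂ A] (H : XCoords n A)

theorem exists_inverse_aMul_sub {i j : Fin n} {y : A} (hy : y * (H.z i - H.z j) = 1) :
    ∃ k, k * (H.coords.aMul i - H.coords.bMul j) = 1 := by
  have h : PowerSeries.constantCoeff (H.coords.aMul i - H.coords.bMul j) =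
      MvPolynomial.C (MvPolynomial.C (H.z i - H.z j)) := by
    have he : ∀ (c : ℂ) (i : Fin n),
        PowerSeries.constantCoeff (Coords.expU (MvPolynomial (Fin n) A) c i) = 1 := fun c i => by
      rw [Coords.expU, constantCoeff_expSer]
    have hc : ∀ a : MvPolynomial (Fin n) A, PowerSeries.constantCoeff (Coords.cst n a) =
      MvPolynomial.C a := fun _ => rfl
    rw [Coords.aMul, Coords.bMul, map_sub, map_mul, map_mul, he, he, hc, hc, one_mul, one_mul,
      ← map_sub]
    exact congrArg _ (map_sub MvPolynomial.C _ _).symm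
  have hu : IsUnit (H.coords.aMul i - H.coords.bMul j) := by
    rw [PowerSeries.isUnit_iff_constantCoeff, h]
    exact ((IsUnit.of_mul_eq_one_right y hy).map MvPolynomial.C).map MvPolynomial.C
  exact hu.exists_left_inv

theorem exists_inverse_aAdd_sub {i j : Fin n} {y : A} (hy : y * (H.z i - H.z j) = 1) :
    ∃ k, k * (H.coords.aAdd i - H.coords.bAdd j) = 1 := by
  have h : PowerSeries.constantCoeff (H.coords.aAdd i - H.coords.bAdd j) =
      MvPolynomial.C (H.z i - H.z j) := by
    rw [Coords.aAdd, Coords.bAdd]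
    simp only [map_sub, map_add, map_mul, PowerSeries.constantCoeff_X, PowerSeries.constantCoeff_C,
      mul_zero, add_zero, sub_zero]
    rfl
  have hu : IsUnit (H.coords.aAdd i - H.coords.bAdd j) := by
    rw [PowerSeries.isUnit_iff_constantCoeff, h]
    exact (IsUnit.of_mul_eq_one_right y hy).map MvPolynomial.C
  exact hu.exists_left_inv

/-- The multiplicative cyclic sums are transformed into the additive ones. -/
theorem strans_lower_cycles (s : Finset (Equiv.Perm (Fin n)))
    {k : Equiv.Perm (Fin n) → Fin n → PowerSeries (MvPolynomial (Fin n) (MvPolynomial (Fin n) A))}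
    {k' : Equiv.Perm (Fin n) → Fin n → PowerSeries (MvPolynomial (Fin n) A)}
    (hk : ∀ σ ∈ s, ∀ i, k σ i * (H.coords.aMul i - H.coords.bMul (σ i)) = 1)
    (hk' : ∀ σ ∈ s, ∀ i, k' σ i * (H.coords.aAdd i - H.coords.bAdd (σ i)) = 1) (m : ℕ)
    (P : PowerSeries (MvPolynomial (Fin n) A)) :
    H.coords.expRatio * P * H.coords.strans (serMap (lower n (MvPolynomial (Fin n) A))
      (H.coords.expPhase * ((∏ i, (PowerSeries.C (MvPolynomial.X i) * PowerSeries.X)) *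
        ((-1) ^ m * ∑ σ ∈ s, ∏ i, k σ i)))) =
    serMap (lower n A) (P * ((∏ i, (PowerSeries.C (MvPolynomial.X i) * PowerSeries.X)) *
        ((-1) ^ m * ∑ σ ∈ s, ∏ i, k' σ i))) := by
  have hsum : H.coords.expRatio * H.coords.strans (H.coords.expPhase * ∑ σ ∈ s, ∏ i, k σ i) =
      ∑ σ ∈ s, ∏ i, k' σ i := by
    rw [Finset.mul_sum, map_sum, Finset.mul_sum]
    exact Finset.sum_congr rfl fun σ hσ =>
      H.coords.expRatio_mul_strans_prod σ _ (hk σ hσ) _ (hk' σ hσ)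
  have hsign : H.coords.expRatio * H.coords.strans
      (H.coords.expPhase * ((-1) ^ m * ∑ σ ∈ s, ∏ i, k σ i)) =
      (-1) ^ m * ∑ σ ∈ s, ∏ i, k' σ i := by
    rcases Nat.even_or_odd m with h | h
    · rw [h.neg_one_pow, h.neg_one_pow, one_mul, one_mul, hsum]
    · rw [h.neg_one_pow, h.neg_one_pow, neg_one_mul, neg_one_mul, mul_neg, map_neg, mul_neg, hsum]
  -- On either side `lower` removes the product of the variables and leaves `ħ^n`, which commutes
  -- with the transformation.
  rw [mul_left_comm, serMap_lower_mul, Coords.strans_X_pow_mul, mul_left_comm P, serMap_lower_mul,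
    ← hsign]
  generalize H.coords.expRatio = a
  generalize H.coords.strans _ = b
  ring

/-- Multiplied by `v`, the left side becomes `P - R P`, by `v_mul_strans_lower` and `T(e^Φ) R = 1`;
then `v` is divided out. The term with `R P` has no counterpart in (∗) and is cancelled by the
second summand of (∗∗). -/
theorem lower_coeff_mul_strans (H : XCoords 1 A) (P : PowerSeries (MvPolynomial (Fin 1) A))
    (N : ℕ) : PowerSeries.coeff N (H.coords.expRatio * P * H.coords.strans
      (serMap (lower 1 (MvPolynomial (Fin 1) A)) (H.coords.expPhase *
        (Coords.cst 1 (H.coords.w 0) * scaled S⁻¹ (MvPolynomial.X 0))))) =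
    lower 1 A (PowerSeries.coeff N P) -
      lower 1 A (PowerSeries.coeff N (H.coords.expRatio * P)) := by
  have h1 := H.coords.v_mul_strans_lower
  rw [mul_left_comm] at h1
  have h2 := H.coords.strans_expPhase_mul_expRatio
  set L := H.coords.strans (serMap (lower 1 (MvPolynomial (Fin 1) A)) (H.coords.expPhase *
        (Coords.cst 1 (H.coords.w 0) * scaled S⁻¹ (MvPolynomial.X 0)))) with hL
  have h3 : H.coords.expRatio * P * L * PowerSeries.C (H.coords.v 0) =
      P - H.coords.expRatio * P := by
    linear_combination (H.coords.expRatio * P) * h1 + P * h2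
  have h4 := congrArg (PowerSeries.coeff N) h3
  rw [PowerSeries.coeff_mul_C, map_sub] at h4
  have h5 := congrArg (lower 1 A) h4
  rw [map_sub] at h5
  rw [← h5]
  exact (Coords.lower_mul_X _).symm

end Algebra

/-! ### Factorization of the exponentials and the cyclic sums for several points. -/

section Exponentials

variable {n : ℕ} {A : Type*} [CommRing A] [Algebra ℂ A] (H : XCoords n A)

theorem sexp_expSerArg_sub {i : Fin n} {a : A} (ha : H.d i a = H.w i) (f : ℕ → A) :
    sexp (expSerArg (H.d i) (fun k => invSer (H.d i) a k - f k) i) =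
      sexp (H.coords.logRatio i) * sexp (-expSerArg (H.d i) f i) := by
  rw [expSerArg_sub, expSerArg_invSer H i ha, sub_eq_add_neg]
  exact sexp_add (H.coords.constantCoeff_logRatio i)
    (by rw [map_neg]; exact neg_eq_zero.mpr (constantCoeff_expSerArg _ _ _))

theorem prod_sexp_expSerArg_sub {a : Fin n → A} (ha : ∀ i, H.d i (a i) = H.w i)
    (f : Fin n → ℕ → A) :
    ∏ i, sexp (expSerArg (H.d i) (fun k => invSer (H.d i) (a i) k - f i k) i) =
      H.coords.expRatio * ∏ i, sexp (-expSerArg (H.d i) (f i) i) := by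
  rw [Finset.prod_congr rfl fun i _ => sexp_expSerArg_sub H (ha i) (f i),
    Finset.prod_mul_distrib]
  refine congrArg (· * _) ?_
  exact (sexp_sum _ _ fun i => H.coords.constantCoeff_logRatio i).symm

theorem serDeriv_sexp_expSerArg {i j : Fin n} {f : ℕ → A} (hf : ∀ k, H.d i (f k) = 0) :
    serDeriv Unit (polyDeriv _ (H.d i)) (sexp (expSerArg (H.d j) f j)) = 0 := by
  have h : serDeriv Unit (polyDeriv _ (H.d i)) (sexp (expSerArg (H.d j) f j)) =
      sexp (expSerArg (H.d j) f j) *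
        serDeriv Unit (polyDeriv _ (H.d i)) (expSerArg (H.d j) f j) :=
    derivation_sexp _ (fun _ => (polyDeriv _ (H.d i)).toLinearMap) (fun _ _ => rfl)
      (constantCoeff_expSerArg _ _ _)
  rw [h, serDeriv_expSerArg (H.d_comm i j) hf, mul_zero]

theorem evSer_prod_u_h (ev : A →ₐ[ℂ] ℂ) :
    evSer ev (toVar (∏ i, (PowerSeries.C (MvPolynomial.X i) * PowerSeries.X) :
      PowerSeries (MvPolynomial (Fin n) (MvPolynomial (Fin n) A)))) =
      ∏ i, var (Var.u i) * var Var.h := by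
  rw [map_prod, map_prod]
  refine Finset.prod_congr rfl fun i _ => ?_
  rw [map_mul, map_mul, toVar_u, toVar_X, evSer_X, evSer_X]

theorem uSer_prod_u_h :
    uSer n A (∏ i, (PowerSeries.C (MvPolynomial.X i) * PowerSeries.X)) =
      ∏ i, (PowerSeries.C (MvPolynomial.X i) * PowerSeries.X) := by
  rw [map_prod]
  refine Finset.prod_congr rfl fun i _ => ?_
  rw [map_mul, uSer_C, uSer_X, MvPolynomial.map_X]

variable (ev : A →ₐ[ℂ] ℂ) {z : Fin n → ℂ}

theorem addCycleSum_eq (hz : ∀ i, ev (H.z i) = z i) (hn : 2 ≤ n)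
    {s : Finset (Equiv.Perm (Fin n))}
    (hs : ∀ σ, σ ∈ s ↔ ∀ i j, σ.SameCycle i j)
    {k : Equiv.Perm (Fin n) → Fin n → PowerSeries (MvPolynomial (Fin n) A)}
    (hk : ∀ σ ∈ s, ∀ i, k σ i * (H.coords.aAdd i - H.coords.bAdd (σ i)) = 1) :
    addCycleSum z = evSer ev (toVar (uSer n A
      ((∏ i, (PowerSeries.C (MvPolynomial.X i) * PowerSeries.X)) *
        ((-1) ^ (n - 1) * ∑ σ ∈ s, ∏ i, k σ i)))) := by
  classical
  rw [addCycleSum, cycleSum_eq hn _ (k := fun σ i => evSer ev (toVar (uSer n A (k σ i))))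
    fun σ hσ i => by
      rw [← evSer_aAdd H ev hz, ← evSer_bAdd H ev hz, ← map_sub, ← map_sub, ← map_sub, ← map_mul,
        ← map_mul, ← map_mul, hk σ ((hs σ).mpr hσ) i, map_one, map_one, map_one],
    map_mul (uSer n A), uSer_prod_u_h, map_mul toVar, map_mul (evSer ev), evSer_prod_u_h]
  simp only [map_mul, map_pow, map_neg, map_one, map_sum, map_prod]
  refine congrArg _ (congrArg _ (Finset.sum_congr ?_ fun _ _ => rfl))
  ext σ
  rw [Finset.mem_filter, hs]
  exact and_iff_right (Finset.mem_univ σ)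

theorem mulCycleSum_eq (hz : ∀ i, ev (H.z i) = z i) (hn : 2 ≤ n)
    {s : Finset (Equiv.Perm (Fin n))}
    (hs : ∀ σ, σ ∈ s ↔ ∀ i j, σ.SameCycle i j)
    {k : Equiv.Perm (Fin n) → Fin n →
      PowerSeries (MvPolynomial (Fin n) (MvPolynomial (Fin n) A))}
    (hk : ∀ σ ∈ s, ∀ i, k σ i * (H.coords.aMul i - H.coords.bMul (σ i)) = 1) :
    mulCycleSum z = evSer ev (toVar
      ((∏ i, (PowerSeries.C (MvPolynomial.X i) * PowerSeries.X)) *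
        ((-1) ^ (n - 1) * ∑ σ ∈ s, ∏ i, k σ i))) := by
  classical
  rw [mulCycleSum, cycleSum_eq hn _ (k := fun σ i => evSer ev (toVar (k σ i)))
    fun σ hσ i => by
      rw [← evSer_aMul H ev hz, ← evSer_bMul H ev hz, ← map_sub, ← map_sub, ← map_mul,
        ← map_mul, hk σ ((hs σ).mpr hσ) i, map_one, map_one],
    map_mul toVar, map_mul (evSer ev), evSer_prod_u_h]
  simp only [map_mul, map_pow, map_neg, map_one, map_sum, map_prod]
  refine congrArg _ (congrArg _ (Finset.sum_congr ?_ fun _ _ => rfl))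
  ext σ
  rw [Finset.mem_filter, hs]
  exact and_iff_right (Finset.mem_univ σ)

end Exponentials

/-! ### The cyclic sums for one point. -/

section OnePoint

variable {A : Type*} [CommRing A] [Algebra ℂ A] (H : XCoords 1 A)

theorem addCycleSum_one (ev : A →ₐ[ℂ] ℂ) {W : PowerSeries (MvPolynomial (Fin 1) A)}
    (hW : W = 1) (z : Fin 1 → ℂ) : addCycleSum z = evSer ev (toVar (uSer 1 A W)) := by
  rw [hW, map_one, map_one, map_one, addCycleSum, cycleSum_one, MvPowerSeries.inv_eq_iff_mul_eq_one (by simp), mul_one]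

theorem mulCycleSum_one (ev : A →ₐ[ℂ] ℂ) {z : Fin 1 → ℂ} (hz : ∀ i, ev (H.z i) = z i) :
    mulCycleSum z = evSer ev (toVar
      (Coords.cst 1 (H.coords.w 0) * scaled S⁻¹ (MvPolynomial.X 0))) := by
  have h : evSer ev (toVar (Coords.cst 1 (H.coords.w 0) * scaled S⁻¹ (MvPolynomial.X 0))) *
      mulQuot 0 (z 0) = 1 := by
    have h1 : mulQuot 0 (z 0) = evSer ev (toVar
        (Coords.cst 1 (H.coords.z 0) * scaled S (MvPolynomial.X 0))) := by
      rw [map_mul, map_mul, evSer_toVar_scaled, toVar_cst_z, evSer_C, hz, mulQuot, mul_comm]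
    have h2 : Coords.cst 1 (H.coords.w 0) * scaled S⁻¹ (MvPolynomial.X 0) *
        (Coords.cst 1 (H.coords.z 0) * scaled S (MvPolynomial.X 0)) =
        (1 : PowerSeries (MvPolynomial (Fin 1) (MvPolynomial (Fin 1) A))) := by
      rw [mul_mul_mul_comm, ← map_mul, ← scaled_mul, mul_comm, mul_comm S⁻¹, S_mul_inv, scaled_one,
        one_mul, mul_comm (H.coords.w 0), H.coords.z_mul_w, map_one]
    rw [h1, ← map_mul, ← map_mul, h2, map_one, map_one]
  have h0 : MvPowerSeries.constantCoeff (mulQuot (0 : Fin 1) (z 0)) ≠ 0 := by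
    intro h0
    have := congrArg MvPowerSeries.constantCoeff h
    rw [map_mul, h0, mul_zero, map_one] at this
    exact zero_ne_one this
  rw [mulCycleSum, cycleSum_one]
  exact (MvPowerSeries.inv_eq_iff_mul_eq_one h0).mpr h

end OnePoint

/-! ### Both formulas as values of `total`. -/

section Comparison

variable {n : ℕ} {Ω : TopologicalSpace.Opens (Fin n → ℂ)} {l : ℂ → ℂ} {xh : ℕ → ℂ → ℂ}
  {H : XCoords n (analyticAlg Ω)}

theorem omegaYz_eq_total (hd : ∀ i, H.d i = partialD i)
    (hq : ∀ i (z : Ω), evAt z (H.xq i) = (deriv (xh 0) ((z : Fin n → ℂ) i))⁻¹)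
    {xa : Fin n → ℕ → analyticAlg Ω}
    (hxa : ∀ i k (z : Ω), evAt z (xa i k) = xh k ((z : Fin n → ℂ) i))
    {W : PowerSeries (MvPolynomial (Fin n) (analyticAlg Ω))}
    (hW : ∀ z : Ω, addCycleSum (z : Fin n → ℂ) = evSer (evAt z) (toVar (uSer n _ W)))
    (g : ℕ) (z : Ω) :
    omegaYz xh g n z = evAt z (H.total (lower n _ (PowerSeries.coeff (2 * g + 2 * n - 2)
      ((∏ i, sexp (-expSerArg (H.d i) (xa i) i)) * W)))) := by
  rw [omegaYz, xyFormula_eq _ flip_addCycleSum]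
  refine finsum_extract_u hd hq _ (F := fun z' => (∏ i, fexp (-(var (Var.u i) *
    (applyS deriv xh (Var.u i) (z' i) - const (xh 0 (z' i)))))) * addCycleSum z') (fun z => ?_) _ z
  rw [map_mul (uSer n _), map_mul toVar, map_mul (evSer (evAt z)), ← hW, map_prod, map_prod,
    map_prod]
  refine congrArg (· * _) (Finset.prod_congr rfl fun i _ => ?_)
  rw [hd]
  exact fexp_neg_u_eq (hxa i) z

/-- For `ŷ = z` the exponentials in the `uᵢ` are `e^Φ`, and integration by parts replaces the sum
over `r` by the transformation. The raised exponents of `u` are accounted for by `lower`. -/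
theorem osMain_eq_total (hd : ∀ i, H.d i = partialD i)
    (hq : ∀ i (z : Ω), evAt z (H.xq i) = (deriv (xh 0) ((z : Fin n → ℂ) i))⁻¹)
    (hz : ∀ i (z : Ω), evAt z (H.z i) = (z : Fin n → ℂ) i)
    {psi : ℕ → ℂ → ℂ} {p : Fin n → ℕ → analyticAlg Ω}
    (hp : ∀ i k (z : Ω), evAt z (p i k) = psi k ((z : Fin n → ℂ) i))
    (hp0 : ∀ i, H.d i (p i 0) = H.psip i)
    (hx : osX l psi (fun k w => if k = 0 then w else 0) = xh 0)
    {W : PowerSeries (MvPolynomial (Fin n) (MvPolynomial (Fin n) (analyticAlg Ω)))}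
    (hW : ∀ z : Ω, mulCycleSum (z : Fin n → ℂ) = evSer (evAt z) (toVar W)) (g : ℕ) (z : Ω) :
    osMain l psi (fun k w => if k = 0 then w else 0) g n z =
      evAt z (H.total (PowerSeries.coeff (2 * g + 2 * n - 2)
        ((∏ i, sexp (expSerArg (H.d i) (p i) i)) * H.coords.strans
          (serMap (lower n (MvPolynomial (Fin n) (analyticAlg Ω))) (H.coords.expPhase * W))))) := by
  rw [osMain, hx]
  simp only [if_true, mul_assoc]
  refine finsum_extract_uv hd hq (fun i => sexp (expSerArg (H.d i) (p i) i))
    (fun i j hij => serDeriv_sexp_expSerArg H fun k => ?_) _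
    (P := fun i r z' => psiFactor psi i r (z' i))
    (F := fun z' => (∏ i, expS eulerD (fun k w => if k = 0 then w else 0) (Var.u i) (z' i)) *
      mulCycleSum z') (fun i r z => psiFactor_eq hd (hp i) (hp0 i) r z) (fun z => ?_) _ z
  · rw [hd]
    exact partialD_of_ne hij (hp j k)
  · rw [map_mul toVar, map_mul (evSer (evAt z)), ← hW,
      ← prod_expS_eulerD_id H (evAt z) fun i => hz i z]

/-- For `g ≠ 0` the term `y dx` is absent. The remaining terms pair the operator power `j` with
`v^{j+1}`, a shift that `lower` performs, and `dy = dz`. -/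
theorem osExtra_eq_total {Ω : TopologicalSpace.Opens (Fin 1 → ℂ)} {H : XCoords 1 (analyticAlg Ω)}
    (hd : ∀ i, H.d i = partialD i)
    (hq : ∀ i (z : Ω), evAt z (H.xq i) = (deriv (xh 0) ((z : Fin 1 → ℂ) i))⁻¹)
    {psi : ℕ → ℂ → ℂ} {p : ℕ → analyticAlg Ω}
    (hp : ∀ k (z : Ω), evAt z (p k) = psi k ((z : Fin 1 → ℂ) 0))
    (hx : osX l psi (fun k w => if k = 0 then w else 0) = xh 0) {g N : ℕ} (hg : g ≠ 0)
    (hN : N = 2 * g) (z : Ω) :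
    osExtra l psi (fun k w => if k = 0 then w else 0) g (0 : Fin 1) z =
      evAt z (H.total (lower 1 _ (PowerSeries.coeff N
        (sexp (expSerArg (H.d 0) p 0))))) := by
  subst hN
  rw [osExtra, if_neg hg, zero_add, hx]
  have h1 := finsum_extract_v hd hq (sexp (expSerArg (H.d 0) p 0))
    (F := fun z' => expS deriv psi (Var.v (0 : Fin 1)) (z' 0))
    (fun z => by rw [hd]; exact expS_v_eq hp z) (2 * g) z
  rw [← h1, ← finsum_comp_equiv (Equiv.funUnique (Fin 1) ℕ).symm]
  refine finsum_congr fun j => ?_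
  have h2 : (fun z' : Fin 1 → ℂ => extract (2 * g) (Pi.single 0 (j + 1)) 0
      (expS deriv psi (Var.v (0 : Fin 1)) ((fun k w => if k = 0 then w else 0 : ℕ → ℂ → ℂ) 0 (z' 0))) *
        deriv ((fun k w => if k = 0 then w else 0 : ℕ → ℂ → ℂ) 0) (z' 0)) =
      fun z' => extract (2 * g) (fun i => (Equiv.funUnique (Fin 1) ℕ).symm j i + 1) 0
        (expS deriv psi (Var.v (0 : Fin 1)) (z' 0)) := by
    funext z'
    have h3 : (Pi.single 0 (j + 1) : Fin 1 → ℕ) =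
        fun i => (Equiv.funUnique (Fin 1) ℕ).symm j i + 1 := by
      funext i
      rw [Subsingleton.elim i 0, Pi.single_eq_same]
      rfl
    simp only [if_true, h3]
    rw [deriv_id'', mul_one]
  exact congrArg (fun f => ((dInvDx (xh 0) 0)^[j] f) (z : Fin 1 → ℂ)) h2

end Comparison

/-! ### Assembly of the case `y = z`. -/

section Final

variable {n : ℕ} {U : Set ℂ}

/-- The open set of `n`-tuples of pairwise distinct points of `U`. -/
def distinctPoints (n : ℕ) (hU : IsOpen U) : TopologicalSpace.Opens (Fin n → ℂ) where
  carrier := {z | (∀ i, z i ∈ U) ∧ Function.Injective z}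
  is_open' := by
    have h : {z : Fin n → ℂ | (∀ i, z i ∈ U) ∧ Function.Injective z} =
        (⋂ i, {z | z i ∈ U}) ∩ ⋂ i, ⋂ j, {z | i ≠ j → z i ≠ z j} := by
      ext z
      simp only [Set.mem_ofPred_eq, Set.mem_inter_iff, Set.mem_iInter]
      exact and_congr_right fun _ =>
        ⟨fun h i j hij he => hij (h he), fun h i j he => by_contra fun hij => h i j hij he⟩
    rw [h]
    refine (isOpen_iInter_of_finite fun i => hU.preimage (continuous_apply i)).inter
      (isOpen_iInter_of_finite fun i => isOpen_iInter_of_finite fun j => ?_)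
    by_cases hij : i = j
    · have : {z : Fin n → ℂ | i ≠ j → z i ≠ z j} = Set.univ :=
        Set.eq_univ_of_forall fun z h => absurd hij h
      rw [this]
      exact isOpen_univ
    · have : {z : Fin n → ℂ | i ≠ j → z i ≠ z j} = {z | z i ≠ z j} := by
        ext z
        exact ⟨fun h => h hij, fun h _ => h⟩
      rw [this]
      exact isOpen_ne_fun (continuous_apply i) (continuous_apply j)

theorem coeff_zero_S_inv : PowerSeries.coeff 0 S⁻¹ = 1 := by
  rw [PowerSeries.coeff_zero_eq_constantCoeff_apply, PowerSeries.constantCoeff_inv,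
    ← PowerSeries.coeff_zero_eq_constantCoeff_apply, coeff_zero_S, inv_one]

theorem osX_invS (l : ℂ → ℂ) (xh : ℕ → ℂ → ℂ) :
    osX l (fun k θ => invS l k θ - xh k θ) (fun k w => if k = 0 then w else 0) = xh 0 := by
  funext z
  simp only [osX, invS, if_true, mul_zero, coeff_zero_S_inv, iteratedDeriv_zero]
  ring

theorem invSer_zero {A : Type*} [CommRing A] [Algebra ℂ A] (D : Derivation ℂ A A) (a : A) :
    invSer D a 0 = a := by
  rw [invSer, mul_zero, coeff_zero_S_inv, one_smul, Function.iterate_zero_apply]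

theorem evAt_invSer {Ω : TopologicalSpace.Opens (Fin n → ℂ)} {l : ℂ → ℂ} {a : analyticAlg Ω}
    {i : Fin n} (ha : ∀ z : Ω, evAt z a = l ((z : Fin n → ℂ) i)) (k : ℕ) (z : Ω) :
    evAt z (invSer (partialD i) a k) = invS l k ((z : Fin n → ℂ) i) := by
  rw [invSer, map_smul, evAt_iterate_partialD ha, invS, smul_eq_mul]

theorem total_lower_one {A : Type*} [CommRing A] [Algebra ℂ A] (H : XCoords 1 A)
    (ev : A →ₐ[ℂ] ℂ) {P W : PowerSeries (MvPolynomial (Fin 1) A)} (hW : W = 1) (N : ℕ) :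
    ev (H.total (lower 1 A (PowerSeries.coeff N (P * W)))) =
      ev (H.total (PowerSeries.coeff N (H.coords.expRatio * P * H.coords.strans
        (serMap (lower 1 (MvPolynomial (Fin 1) A)) (H.coords.expPhase *
          (Coords.cst 1 (H.coords.w 0) * scaled S⁻¹ (MvPolynomial.X 0))))))) +
      ev (H.total (lower 1 A (PowerSeries.coeff N (H.coords.expRatio * P)))) := by
  rw [hW, mul_one, lower_coeff_mul_strans, map_sub, map_sub, sub_add_cancel]

theorem omegaYz_eq_omegaOS_of_coords {Ω : TopologicalSpace.Opens (Fin n → ℂ)} {l : ℂ → ℂ}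
    {xh : ℕ → ℂ → ℂ} {H : XCoords n (analyticAlg Ω)} (hd : ∀ i, H.d i = partialD i)
    (hq : ∀ i (z : Ω), evAt z (H.xq i) = (deriv (xh 0) ((z : Fin n → ℂ) i))⁻¹)
    (hz : ∀ i (z : Ω), evAt z (H.z i) = (z : Fin n → ℂ) i)
    {la : Fin n → analyticAlg Ω} (hla : ∀ i (z : Ω), evAt z (la i) = l ((z : Fin n → ℂ) i))
    (hw : ∀ i, H.d i (la i) = H.w i) {xa : Fin n → ℕ → analyticAlg Ω}
    (hxa : ∀ i k (z : Ω), evAt z (xa i k) = xh k ((z : Fin n → ℂ) i))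
    (hxp : ∀ i, H.d i (xa i 0) = H.xp i)
    (hinv : ∀ i j, i ≠ j → ∃ y, y * (H.z i - H.z j) = 1) (hn : 1 ≤ n) {g : ℕ}
    (hgn : (g, n) ≠ (0, 1)) (z : Ω) :
    omegaYz xh g n z = omegaOS l (fun k θ => invS l k θ - xh k θ)
      (fun k w => if k = 0 then w else 0) g n z := by
  classical
  set p : Fin n → ℕ → analyticAlg Ω := fun i k => invSer (H.d i) (la i) k - xa i k with hpdef
  have hp : ∀ i k (z : Ω), evAt z (p i k) =
      (fun k θ => invS l k θ - xh k θ : ℕ → ℂ → ℂ) k ((z : Fin n → ℂ) i) := fun i k z => by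
    rw [hpdef]
    simp only [map_sub]
    rw [hd, evAt_invSer (hla i), hxa]
  have hp0 : ∀ i, H.d i (p i 0) = H.psip i := fun i => by
    rw [hpdef]
    simp only [map_sub]
    rw [invSer_zero, hw, hxp, XCoords.psip]
  have hE := prod_sexp_expSerArg_sub H hw xa
  -- For `n ≥ 2` all differences that occur are invertible and `strans_lower_cycles` gives the
  -- equality. For `n = 1` the only cycle is a fixed point, and the second summand enters.
  rcases Nat.lt_or_ge 1 n with h2 | h1
  · have hcyc : ∀ σ : Equiv.Perm (Fin n), (∀ i j, σ.SameCycle i j) → ∀ i, i ≠ σ i :=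
      fun σ hσ i => (cycle_apply_ne h2 hσ i).symm
    have hmul : ∀ i j, ∃ k, i ≠ j → k * (H.coords.aMul i - H.coords.bMul j) = 1 := fun i j => by
      by_cases hij : i = j
      · exact ⟨0, fun h => absurd hij h⟩
      · obtain ⟨y, hy⟩ := hinv i j hij
        obtain ⟨k, hk⟩ := exists_inverse_aMul_sub H hy
        exact ⟨k, fun _ => hk⟩
    have hadd : ∀ i j, ∃ k, i ≠ j → k * (H.coords.aAdd i - H.coords.bAdd j) = 1 := fun i j => by
      by_cases hij : i = j
      · exact ⟨0, fun h => absurd hij h⟩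
      · obtain ⟨y, hy⟩ := hinv i j hij
        obtain ⟨k, hk⟩ := exists_inverse_aAdd_sub H hy
        exact ⟨k, fun _ => hk⟩
    choose km hkm using hmul
    choose ka hka using hadd
    obtain ⟨s, hs⟩ : ∃ s : Finset (Equiv.Perm (Fin n)),
        ∀ σ, σ ∈ s ↔ ∀ i j, σ.SameCycle i j :=
      ⟨Finset.univ.filter fun σ => ∀ i j, σ.SameCycle i j, fun σ => by simp⟩
    have hkm' : ∀ σ ∈ s, ∀ i, km i (σ i) * (H.coords.aMul i - H.coords.bMul (σ i)) = 1 :=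
      fun σ hσ i => hkm i (σ i) (hcyc σ ((hs σ).mp hσ) i)
    have hka' : ∀ σ ∈ s, ∀ i, ka i (σ i) * (H.coords.aAdd i - H.coords.bAdd (σ i)) = 1 :=
      fun σ hσ i => hka i (σ i) (hcyc σ ((hs σ).mp hσ) i)
    have hL := omegaYz_eq_total hd hq hxa (fun z => addCycleSum_eq H (evAt z)
      (fun i => hz i z) h2 hs (k := fun σ i => ka i (σ i)) hka') g z
    have hR := osMain_eq_total hd hq hz hp hp0 (osX_invS l xh) (fun z => mulCycleSum_eq H (evAt z)
      (fun i => hz i z) h2 hs (k := fun σ i => km i (σ i)) hkm') g z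
    have key := congrArg (PowerSeries.coeff (2 * g + 2 * n - 2)) (strans_lower_cycles H s
      (k := fun σ i => km i (σ i)) (k' := fun σ i => ka i (σ i)) hkm' hka' (n - 1)
      (∏ i, sexp (-expSerArg (H.d i) (xa i) i)))
    rw [coeff_serMap] at key
    rw [omegaOS, if_neg (by omega), add_zero, hL, hR, hE, key]
  · obtain rfl : n = 1 := le_antisymm h1 hn
    have hg : g ≠ 0 := fun h => hgn (by rw [h])
    -- For one point the order `ħ^{2g}` of the second summand is the raised order used in the first.
    have hN : 2 * g + 2 * 1 - 2 = 2 * g := by omega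
    obtain ⟨W, hW⟩ : ∃ W : PowerSeries (MvPolynomial (Fin 1) (analyticAlg Ω)), W = 1 := ⟨1, rfl⟩
    have hL := omegaYz_eq_total hd hq hxa (W := W)
      (fun z => addCycleSum_one (evAt z) hW _) g z
    have hR := osMain_eq_total hd hq hz hp hp0 (osX_invS l xh)
      (fun z => mulCycleSum_one H (evAt z) fun i => hz i z) g z
    have hX := osExtra_eq_total hd hq (hp 0) (osX_invS l xh) hg hN z
    have hE0 : sexp (expSerArg (H.d 0) (p 0) 0) = H.coords.expRatio *
        ∏ i, sexp (-expSerArg (H.d i) (xa i) i) := by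
      rw [← hE, Fin.prod_univ_one]
    rw [omegaOS, if_pos rfl, Fin.sum_univ_one, hL, hR, hE, hX, hE0]
    exact total_lower_one H (evAt z) hW _

/-- The case `y = z`. -/
theorem omegaYz_eq_omegaOS (hU : IsOpen U) {l : ℂ → ℂ} (hl : DifferentiableOn ℂ l U)
    (hexp : ∀ z ∈ U, Complex.exp (l z) = z) {xh : ℕ → ℂ → ℂ}
    (hxh : ∀ k, DifferentiableOn ℂ (xh k) U) (hdx : ∀ z ∈ U, deriv (xh 0) z ≠ 0) {g : ℕ}
    (hn : 1 ≤ n) (hgn : (g, n) ≠ (0, 1)) {z : Fin n → ℂ} (hz : ∀ i, z i ∈ U)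
    (hinj : Function.Injective z) :
    omegaYz xh g n z = omegaOS l (fun k θ => invS l k θ - xh k θ)
      (fun k w => if k = 0 then w else 0) g n z := by
  have h0 : ∀ z ∈ U, z ≠ 0 := fun z hz h => Complex.exp_ne_zero (l z) ((hexp z hz).trans h)
  have hΩ : ∀ z ∈ distinctPoints n hU, ∀ i, z i ∈ U := fun z hz => hz.1
  have hΩ' : ∀ z ∈ distinctPoints n hU, Function.Injective z := fun z hz => hz.2
  have hla := hl.analyticOnNhd hU
  have hxa := fun k => (hxh k).analyticOnNhd hU
  refine omegaYz_eq_omegaOS_of_coords (Ω := distinctPoints n hU)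
    (H := xCoords hΩ h0 (hxa 0) hdx) (la := coordFun hΩ hla)
    (xa := fun i k => coordFun hΩ (hxa k) i) (fun i => rfl) (fun i z => rfl)
    (fun i z => rfl) (fun i z => rfl) (fun i => analyticAlg_ext fun z => ?_) (fun i k z => rfl)
    (fun i => analyticAlg_ext fun z => ?_) (fun i j hij => exists_inverse_sub hΩ' hΩ hij) hn hgn
    ⟨z, hz, hinj⟩
  · refine (evAt_partialD_coordFun hΩ hla i z).trans ?_
    have hzU : (z : Fin n → ℂ) i ∈ U := hΩ _ z.2 i
    exact eq_inv_of_mul_eq_one_right (deriv_log hU hl hexp hzU)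
  · exact evAt_partialD_coordFun hΩ (hxa 0) i z

end Final

end OSFormula

end

theorem proposition7p1 (U : Set ℂ) (hU : IsOpen U)
    (l : ℂ → ℂ) (hl : DifferentiableOn ℂ l U) (hexp : ∀ z ∈ U, Complex.exp (l z) = z)
    (xh : ℕ → ℂ → ℂ) (hxh : ∀ k, DifferentiableOn ℂ (xh k) U)
    (hdx : ∀ z ∈ U, deriv (xh 0) z ≠ 0)
    (g n : ℕ) (hn : 1 ≤ n) (hgn : (g, n) ≠ (0, 1))
    (z : Fin n → ℂ) (hz : ∀ i, z i ∈ U) (hinj : Function.Injective z) :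
    OSFormula.omegaYz xh g n z =
        OSFormula.omegaOS l (fun k θ => OSFormula.invS l k θ - xh k θ)
          (fun k w => if k = 0 then w else 0) g n z ∧
      OSFormula.omegaYlog xh g n z =
        OSFormula.omegaOS l (fun k θ => if k = 0 then θ else 0)
          (fun k w => (if k = 0 then l w else 0) - xh k w) g n z :=
  ⟨OSFormula.omegaYz_eq_omegaOS hU hl hexp hxh hdx hn hgn hz hinj,
    OSFormula.omegaYlog_eq_omegaOS hU hl hexp hxh hgn hz⟩
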